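/- Let $k$ be a field and let $A$ be a weak Hopf algebra over $k$ (of arbitrary dimension): a $k$-algebra and $k$-coalgebra $(A,\Delta,\epsilon)$, $\Delta(h)=h_1\otimes h_2$, such that $\Delta(hh')=\Delta(h)\Delta(h')$, $(\Delta\otimes 1)\Delta(1)=(\Delta(1)\otimes 1)(1\otimes\Delta(1))=(1\otimes\Delta(1))(\Delta(1)\otimes 1)$ and $\epsilon(abc)=\epsilon(ab_1)\epsilon(b_2c)=\epsilon(ab_2)\epsilon(b_1c)$ for all $a,b,c,h,h'\in A$, and such that, with $$\sqcap^R(h)=1_1\epsilon(h1_2),\quad \overline\sqcap^R(h)=1_1\epsilon(1_2h),\quad \sqcap^L(h)=\epsilon(1_1h)1_2,\quad \overline\sqcap^L(h)=\epsilon(h1_1)1_2,$$ there is a linear map $\sigma:A\to A$ with $h_1\sigma(h_2)=\sqcap^L(h)$ and $\sigma(h_1)h_2=\sqcap^R(h)$ for all $h\in A$. Let $R=\sqcap^R(A)$ be the base algebra, a subalgebra of $A$, with separability element $\sum_i e_i\otimes f_i=1_1\otimes\sqcap^R(1_2)$ and Frobenius functional $\psi=\epsilon|_R$. Let $\bullet$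 be the tensor product over $R\otimes R^{\mathrm{op}}$ in the category $\mathrm{bim}(R\otimes R^{\mathrm{op}})$ of bimodules, with unit $j=R\otimes R^{\mathrm{op}}$. Let $a$ be the $\bullet$-monoid which is $A$ with the actions $(x\otimes y)h(x'\otimes y')=x\,\overline\sqcap^L(y)\,h\,x'\,\overline\sqcap^L(y')$, the unit $\eta:j\to a$, $p\otimes q\mapsto p\,\overline\sqcap^L(q)$, and the multiplication $\mu:a\bullet a\to a$ induced by that of $A$. Let $i$ be the bimodule $R\otimes R$ with the actions $(x\otimes y)(p\otimes q)(x'\otimes y')=y'px'\otimes xq\sum_i\psi(yf_i)e_i$, which is a $\bullet$-monoid via $\xi_0:i\bullet i\to i$, $(p\otimes q)\bullet(p'\otimes q')\mapsto\psi(pq')\,p'\otimes q$, and let $\varepsilon:a\to i$ be $h\mapsto\sqcap^R(h_1)\otimes\overline\sqcap^R(h_2)$. Then the following assertions are equivalent. * (i') $A$ is a separable $k$-algebra; that is, the multiplication $A\otimes A\to A$ has an $A$-bimodule section. * (i) $a$ is a separable monoid in $(\mathrm{bim}(R\otimes R^{\mathrm{op}}),\bullet,j)$; that is, $\mu$ has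 an $a$-bimodule section $a\to a\bullet a$ in $\mathrm{bim}(R\otimes R^{\mathrm{op}})$. * (ii') There is $t\in A$ with $ht=\sqcap^L(h)t$ for all $h\in A$ and $\overline\sqcap^R(t)=1$ (a normalized left integral in $A$). * (ii) The bimonoid $a$ has a normalized left integral in $\mathrm{bim}(R\otimes R^{\mathrm{op}})$; that is, a morphism $\theta:i\to a\bullet i$ of bimodules that is a left $a$-module map and a right $i$-module map (where $a$ acts on $i$ by $\xi_0(\varepsilon\bullet 1)$ and $i$ acts by $\xi_0$), with $\xi_0(\varepsilon\bullet 1)\theta=1_i$. * (ii, explicitly) There is $t\in A$ as in (ii') satisfying also $t\,\sqcap^L(x)=t\,\overline\sqcap^R\overline\sqcap^L(x)$ for all $x\in R$. * (iii') There is $t\in A$ with $th=t\sqcap^R(h)$ for all $h\in A$ and $\sqcap^R(t)=1$ (a normalized right integral in $A$). * (iii) The bimonoid $a$ has a normalized right integral in $\mathrm{bim}(R\otimes R^{\mathrm{op}})$; that is, a morphism $\theta:i\to i\bullet a$ of bimodules that is a right $a$-module map and a left $i$-module map, with $\xi_0(1\bullet\varepsilon)\theta=1_i$. * (iii, explicitly)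 There is $t\in A$ as in (iii') satisfying also $\overline\sqcap^L(x)\,t=\sqcap^R\sqcap^L(x)\,t$ for all $x\in R$. -/

import Mathlib

set_option linter.unusedSectionVars false

open CategoryTheory MonoidalCategory
open scoped TensorProduct

universe v u

/-! ### Separable monoids and integrals -/

section MonoidalDefs

variable {C : Type*} [Category C] [MonoidalCategory C]

/-- A monoid `(a, μ, η)` in a monoidal category is separable if there is `∇ : a ⟶ a ⊗ a` which is
an `a`-bimodule section of the multiplication. -/
def IsSeparableMon (a : C) [MonObj a] : Prop :=
  ∃ n : a ⟶ a ⊗ a,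
    a ◁ n ≫ (α_ a a a).inv ≫ MonObj.mul ▷ a = MonObj.mul ≫ n ∧
    n ▷ a ≫ (α_ a a a).hom ≫ a ◁ MonObj.mul = MonObj.mul ≫ n ∧
    n ≫ MonObj.mul = 𝟙 a

/-- Let `a` be the `•`-monoid of a bimonoid in a duoidal category, with counit `e : a ⟶ i`, and let
`i`, the `∘`-monoidal unit, carry its `•`-monoid structure with multiplication `ξ₀ : i • i ⟶ i`.
A morphism `θ : i ⟶ a • i` is a normalized left integral if it is a morphism of left `a`-modules and
of right `i`-modules and a section of the left `a`-action on `i`. -/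
structure IsNormalizedLeftIntegral {a i : C} [MonObj a] [MonObj i] (e : a ⟶ i)
    (θ : i ⟶ a ⊗ i) : Prop where
  left_linear : a ◁ θ ≫ (α_ a a i).inv ≫ MonObj.mul ▷ i = e ▷ i ≫ MonObj.mul ≫ θ
  right_linear : θ ▷ i ≫ (α_ a i i).hom ≫ a ◁ MonObj.mul = MonObj.mul ≫ θ
  normalized : θ ≫ e ▷ i ≫ MonObj.mul = 𝟙 i

/-- The left-right dual notion: `θ : i ⟶ i • a` is a normalized right integral if it is a morphism
of right `a`-modules and of left `i`-modules and a section of the right `a`-action on `i`. -/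
structure IsNormalizedRightIntegral {a i : C} [MonObj a] [MonObj i] (e : a ⟶ i)
    (θ : i ⟶ i ⊗ a) : Prop where
  right_linear : θ ▷ a ≫ (α_ i a a).hom ≫ i ◁ MonObj.mul = i ◁ e ≫ MonObj.mul ≫ θ
  left_linear : i ◁ θ ≫ (α_ i i a).inv ≫ MonObj.mul ▷ a = MonObj.mul ≫ θ
  normalized : θ ≫ i ◁ e ≫ MonObj.mul = 𝟙 i

end MonoidalDefs

/-- An algebra `A` over `k` is separable if its multiplication `A ⊗ A → A` has an `A`-bimodule
section. -/
def IsSeparableAlg (k : Type v) (A : Type u) [Field k] [Ring A] [Algebra k A] : Prop :=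
  ∃ s : A →ₗ[k] A ⊗[k] A,
    (∀ a b, s (a * b) = LinearMap.rTensor A (LinearMap.mulLeft k a) (s b)) ∧
    (∀ a b, s (a * b) = LinearMap.lTensor A (LinearMap.mulRight k b) (s a)) ∧
    ∀ a, LinearMap.mul' k A (s a) = a


/-- A bimodule over a `k`-algebra `B`: a `k`-module with commuting `k`-bilinear left and right
`B`-actions, both unital and associative. These are the objects of `bim(B)`. -/
structure AlgBimod (k : Type v) (B : Type u) [Field k] [Ring B] [Algebra k B] where
  carrier : Type u
  [addCommGroup : AddCommGroup carrier]
  [module : Module k carrier]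
  /-- the left action, `lact b m = b m` -/
  lact : B →ₗ[k] carrier →ₗ[k] carrier
  /-- the right action, `ract b m = m b` -/
  ract : B →ₗ[k] carrier →ₗ[k] carrier
  one_lact : ∀ m, lact 1 m = m
  mul_lact : ∀ b c m, lact (b * c) m = lact b (lact c m)
  ract_one : ∀ m, ract 1 m = m
  ract_mul : ∀ b c m, ract (b * c) m = ract c (ract b m)
  lact_ract : ∀ b c m, lact b (ract c m) = ract c (lact b m)

namespace AlgBimod

attribute [instance] AlgBimod.addCommGroup AlgBimod.module

variable {k : Type v} {B : Type u} [Field k] [Ring B] [Algebra k B]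

/-- Morphisms of bimodules: `k`-linear maps commuting with both actions. -/
@[ext]
structure Hom (M N : AlgBimod k B) where
  toLin : M.carrier →ₗ[k] N.carrier
  map_lact : ∀ b m, toLin (M.lact b m) = N.lact b (toLin m)
  map_ract : ∀ b m, toLin (M.ract b m) = N.ract b (toLin m)

instance : Category (AlgBimod k B) where
  Hom M N := Hom M N
  id M := ⟨LinearMap.id, fun _ _ => rfl, fun _ _ => rfl⟩
  comp f g := ⟨g.toLin ∘ₗ f.toLin,
    fun b m => by simp [f.map_lact, g.map_lact], fun b m => by simp [f.map_ract, g.map_ract]⟩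

/-- The linear map underlying a morphism of bimodules. -/
def lin {M N : AlgBimod k B} (f : M ⟶ N) : M.carrier →ₗ[k] N.carrier := Hom.toLin f

lemma hom_ext {M N : AlgBimod k B} {f g : M ⟶ N} (h : lin f = lin g) : f = g := Hom.ext h

@[simp] lemma lin_id (M : AlgBimod k B) : lin (𝟙 M) = LinearMap.id := rfl

@[simp] lemma lin_comp {M N P : AlgBimod k B} (f : M ⟶ N) (g : N ⟶ P) :
    lin (f ≫ g) = lin g ∘ₗ lin f := rfl

@[simp] lemma lin_lact {M N : AlgBimod k B} (f : M ⟶ N) (b : B) (m : M.carrier) :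
    lin f (M.lact b m) = N.lact b (lin f m) := Hom.map_lact f b m

@[simp] lemma lin_ract {M N : AlgBimod k B} (f : M ⟶ N) (b : B) (m : M.carrier) :
    lin f (M.ract b m) = N.ract b (lin f m) := Hom.map_ract f b m

/-- The isomorphism of bimodules given by a bimodule map with a linear two-sided inverse. -/
def mkIso {M N : AlgBimod k B} (f : M ⟶ N) (g : N.carrier →ₗ[k] M.carrier)
    (h₁ : g ∘ₗ lin f = LinearMap.id) (h₂ : lin f ∘ₗ g = LinearMap.id) : M ≅ N where
  hom := f
  inv := ⟨g,
    fun b n => by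
      have h := LinearMap.congr_fun h₂ n
      have h' := LinearMap.congr_fun h₁ (M.lact b (g n))
      simp only [LinearMap.comp_apply, LinearMap.id_apply, lin_lact] at h h'
      rw [← h', h],
    fun b n => by
      have h := LinearMap.congr_fun h₂ n
      have h' := LinearMap.congr_fun h₁ (M.ract b (g n))
      simp only [LinearMap.comp_apply, LinearMap.id_apply, lin_ract] at h h'
      rw [← h', h]⟩
  hom_inv_id := hom_ext h₁
  inv_hom_id := hom_ext h₂

@[simp] lemma lin_mkIso_hom {M N : AlgBimod k B} (f : M ⟶ N) (g : N.carrier →ₗ[k] M.carrier)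
    (h₁ : g ∘ₗ lin f = LinearMap.id) (h₂ : lin f ∘ₗ g = LinearMap.id) :
    lin (mkIso f g h₁ h₂).hom = lin f := rfl

@[simp] lemma lin_mkIso_inv {M N : AlgBimod k B} (f : M ⟶ N) (g : N.carrier →ₗ[k] M.carrier)
    (h₁ : g ∘ₗ lin f = LinearMap.id) (h₂ : lin f ∘ₗ g = LinearMap.id) :
    lin (mkIso f g h₁ h₂).inv = g := rfl

/-! ### The tensor product over `B` -/

/-- The relations `m b ⊗ n = m ⊗ b n` defining `M ⊗_B N` as a quotient of `M ⊗_k N`. -/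
def balRel (M N : AlgBimod k B) : Submodule k (M.carrier ⊗[k] N.carrier) :=
  Submodule.span k {z | ∃ m b n, z = M.ract b m ⊗ₜ[k] n - m ⊗ₜ[k] N.lact b n}

/-- The underlying `k`-module of `M ⊗_B N`. -/
abbrev Ten (M N : AlgBimod k B) : Type u := (M.carrier ⊗[k] N.carrier) ⧸ balRel M N

/-- The class of `m ⊗ n` in `M ⊗_B N`, as a bilinear map. -/
def tmk (M N : AlgBimod k B) : M.carrier →ₗ[k] N.carrier →ₗ[k] Ten M N :=
  (TensorProduct.mk k M.carrier N.carrier).compr₂ (balRel M N).mkQ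

lemma tmk_bal (M N : AlgBimod k B) (m : M.carrier) (b : B) (n : N.carrier) :
    tmk M N (M.ract b m) n = tmk M N m (N.lact b n) :=
  (Submodule.Quotient.eq _).2 (Submodule.subset_span ⟨m, b, n, rfl⟩)

/-- A balanced bilinear map induces a linear map on `M ⊗_B N`. -/
def tlift {M N : AlgBimod k B} {P : Type*} [AddCommGroup P] [Module k P]
    (f : M.carrier →ₗ[k] N.carrier →ₗ[k] P)
    (hf : ∀ m b n, f (M.ract b m) n = f m (N.lact b n)) : Ten M N →ₗ[k] P :=
  (balRel M N).liftQ (TensorProduct.lift f) (by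
    rw [balRel, Submodule.span_le]
    rintro _ ⟨m, b, n, rfl⟩
    simp [hf])

@[simp] lemma tlift_tmk {M N : AlgBimod k B} {P : Type*} [AddCommGroup P] [Module k P]
    (f : M.carrier →ₗ[k] N.carrier →ₗ[k] P) (hf) (m : M.carrier) (n : N.carrier) :
    tlift f hf (tmk M N m n) = f m n := by
  simp [tlift, tmk]

lemma ten_ext {M N : AlgBimod k B} {P : Type*} [AddCommGroup P] [Module k P]
    {f g : Ten M N →ₗ[k] P} (h : ∀ m n, f (tmk M N m n) = g (tmk M N m n)) : f = g := by
  refine Submodule.linearMap_qext _ (TensorProduct.ext' fun m n => ?_)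
  exact h m n

/-- The left action on `M ⊗_B N`, `b (m ⊗ n) = (b m) ⊗ n`. -/
def tenL (M N : AlgBimod k B) (b : B) : Ten M N →ₗ[k] Ten M N :=
  tlift ((tmk M N) ∘ₗ M.lact b) (fun m c n => by simp [M.lact_ract, tmk_bal])

/-- The right action on `M ⊗_B N`, `(m ⊗ n) b = m ⊗ (n b)`. -/
def tenR (M N : AlgBimod k B) (b : B) : Ten M N →ₗ[k] Ten M N :=
  tlift ((tmk M N).compl₂ (N.ract b)) (fun m c n => by simp [← N.lact_ract, tmk_bal])

@[simp] lemma tenL_tmk (M N : AlgBimod k B) (b : B) (m n) :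
    tenL M N b (tmk M N m n) = tmk M N (M.lact b m) n := by simp [tenL]

@[simp] lemma tenR_tmk (M N : AlgBimod k B) (b : B) (m n) :
    tenR M N b (tmk M N m n) = tmk M N m (N.ract b n) := by simp [tenR]

/-- The bimodule `M ⊗_B N`. -/
def ten (M N : AlgBimod k B) : AlgBimod k B where
  carrier := Ten M N
  lact := { toFun := tenL M N
            map_add' := fun b c => ten_ext fun m n => by simp
            map_smul' := fun r b => ten_ext fun m n => by simp }
  ract := { toFun := tenR M N
            map_add' := fun b c => ten_ext fun m n => by simp
            map_smul' := fun r b => ten_ext fun m n => by simp }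
  one_lact := fun x => by
    have : tenL M N 1 = LinearMap.id := ten_ext fun m n => by simp [M.one_lact]
    exact LinearMap.congr_fun this x
  mul_lact := fun b c x => by
    have : tenL M N (b * c) = tenL M N b ∘ₗ tenL M N c :=
      ten_ext fun m n => by simp [M.mul_lact]
    exact LinearMap.congr_fun this x
  ract_one := fun x => by
    have : tenR M N 1 = LinearMap.id := ten_ext fun m n => by simp [N.ract_one]
    exact LinearMap.congr_fun this x
  ract_mul := fun b c x => by
    have : tenR M N (b * c) = tenR M N c ∘ₗ tenR M N b :=
      ten_ext fun m n => by simp [N.ract_mul]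
    exact LinearMap.congr_fun this x
  lact_ract := fun b c x => by
    have : tenL M N b ∘ₗ tenR M N c = tenR M N c ∘ₗ tenL M N b :=
      ten_ext fun m n => by simp
    exact LinearMap.congr_fun this x

/-- The class of `m ⊗ n` as an element of the bimodule `ten M N`. -/
def tm (M N : AlgBimod k B) : M.carrier →ₗ[k] N.carrier →ₗ[k] (ten M N).carrier := tmk M N

lemma tm_bal (M N : AlgBimod k B) (m : M.carrier) (b : B) (n : N.carrier) :
    tm M N (M.ract b m) n = tm M N m (N.lact b n) := tmk_bal M N m b n

@[simp] lemma ten_lact_tm (M N : AlgBimod k B) (b : B) (m n) :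
    (ten M N).lact b (tm M N m n) = tm M N (M.lact b m) n := tenL_tmk M N b m n

@[simp] lemma ten_ract_tm (M N : AlgBimod k B) (b : B) (m n) :
    (ten M N).ract b (tm M N m n) = tm M N m (N.ract b n) := tenR_tmk M N b m n

/-- Linear maps out of `M ⊗_B N` from balanced bilinear maps. -/
def tl {M N : AlgBimod k B} {P : Type*} [AddCommGroup P] [Module k P]
    (f : M.carrier →ₗ[k] N.carrier →ₗ[k] P)
    (hf : ∀ m b n, f (M.ract b m) n = f m (N.lact b n)) : (ten M N).carrier →ₗ[k] P :=
  tlift f hf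

@[simp] lemma tl_tm {M N : AlgBimod k B} {P : Type*} [AddCommGroup P] [Module k P]
    (f : M.carrier →ₗ[k] N.carrier →ₗ[k] P) (hf) (m : M.carrier) (n : N.carrier) :
    tl f hf (tm M N m n) = f m n := tlift_tmk f hf m n

lemma tm_ext {M N : AlgBimod k B} {P : Type*} [AddCommGroup P] [Module k P]
    {f g : (ten M N).carrier →ₗ[k] P} (h : ∀ m n, f (tm M N m n) = g (tm M N m n)) : f = g :=
  ten_ext h

/-- A balanced bilinear map compatible with the outer actions induces a bimodule map. -/
def homOut {M N P : AlgBimod k B} (f : M.carrier →ₗ[k] N.carrier →ₗ[k] P.carrier)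
    (hf : ∀ m b n, f (M.ract b m) n = f m (N.lact b n))
    (hl : ∀ b m n, f (M.lact b m) n = P.lact b (f m n))
    (hr : ∀ b m n, f m (N.ract b n) = P.ract b (f m n)) : ten M N ⟶ P :=
  ⟨tl f hf,
    fun b x => by
      have : tl f hf ∘ₗ (ten M N).lact b = P.lact b ∘ₗ tl f hf := tm_ext fun m n => by simp [hl]
      exact LinearMap.congr_fun this x,
    fun b x => by
      have : tl f hf ∘ₗ (ten M N).ract b = P.ract b ∘ₗ tl f hf := tm_ext fun m n => by simp [hr]
      exact LinearMap.congr_fun this x⟩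

@[simp] lemma lin_homOut_tm {M N P : AlgBimod k B}
    (f : M.carrier →ₗ[k] N.carrier →ₗ[k] P.carrier) (hf hl hr) (m n) :
    lin (homOut (M := M) (N := N) (P := P) f hf hl hr) (tm M N m n) = f m n := tl_tm f hf m n

/-- The tensor product over `B` of two bimodule maps. -/
def tenMap {M M' N N' : AlgBimod k B} (f : M ⟶ M') (g : N ⟶ N') : ten M N ⟶ ten M' N' :=
  homOut ((tm M' N').compl₁₂ (lin f) (lin g))
    (fun m b n => by simp [tm_bal]) (fun b m n => by simp) (fun b m n => by simp)

@[simp] lemma lin_tenMap_tm {M M' N N' : AlgBimod k B} (f : M ⟶ M') (g : N ⟶ N') (m n) :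
    lin (tenMap f g) (tm M N m n) = tm M' N' (lin f m) (lin g n) := by
  simp [tenMap]

/-- The regular bimodule `B`, the unit of `⊗_B`. -/
def reg (k : Type v) (B : Type u) [Field k] [Ring B] [Algebra k B] : AlgBimod k B where
  carrier := B
  lact := LinearMap.mul k B
  ract := (LinearMap.mul k B).flip
  one_lact := fun m => by simp
  mul_lact := fun b c m => by simp [mul_assoc]
  ract_one := fun m => by simp
  ract_mul := fun b c m => by simp [mul_assoc]
  lact_ract := fun b c m => by simp [mul_assoc]

@[elab_as_elim]
lemma tm_ind {M N : AlgBimod k B} {p : (ten M N).carrier → Prop}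
    (h : ∀ m n, p (tm M N m n)) (h0 : p 0) (hadd : ∀ x y, p x → p y → p (x + y)) (x) : p x := by
  obtain ⟨z, rfl⟩ := Submodule.mkQ_surjective (balRel M N) x
  induction z using TensorProduct.induction_on with
  | zero => rw [map_zero]; exact h0
  | tmul m n => exact h m n
  | add a b ha hb => rw [map_add]; exact hadd _ _ ha hb

/-- `(m ⊗ n, p) ↦ m ⊗ (n ⊗ p)`. -/
def assocFun (M N P : AlgBimod k B) :
    (ten M N).carrier →ₗ[k] P.carrier →ₗ[k] (ten M (ten N P)).carrier :=
  tl (LinearMap.mk₂ k (fun m n => (tm M (ten N P) m) ∘ₗ (tm N P n))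
      (fun _ _ _ => by ext; simp) (fun _ _ _ => by ext; simp)
      (fun _ _ _ => by ext; simp) (fun _ _ _ => by ext; simp))
    (fun m b n => by ext p; simp [tm_bal])

@[simp] lemma assocFun_tm (M N P : AlgBimod k B) (m n p) :
    assocFun M N P (tm M N m n) p = tm M (ten N P) m (tm N P n p) := by
  simp [assocFun]

/-- `(m, n ⊗ p) ↦ (m ⊗ n) ⊗ p`. -/
def assocInvFun (M N P : AlgBimod k B) :
    M.carrier →ₗ[k] (ten N P).carrier →ₗ[k] (ten (ten M N) P).carrier :=
  LinearMap.flip (tl (LinearMap.mk₂ k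
      (fun n p => (LinearMap.flip (tm (ten M N) P) p) ∘ₗ (LinearMap.flip (tm M N) n))
      (fun _ _ _ => by ext; simp) (fun _ _ _ => by ext; simp)
      (fun _ _ _ => by ext; simp) (fun _ _ _ => by ext; simp))
    (fun n b p => by ext m; simp [← tm_bal]))

@[simp] lemma assocInvFun_tm (M N P : AlgBimod k B) (m n p) :
    assocInvFun M N P m (tm N P n p) = tm (ten M N) P (tm M N m n) p := by
  simp [assocInvFun]

/-- The associativity isomorphism `(m ⊗ n) ⊗ p ↦ m ⊗ (n ⊗ p)`. -/
def assoc (M N P : AlgBimod k B) : ten (ten M N) P ≅ ten M (ten N P) :=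
  mkIso
    (homOut (assocFun M N P)
      (fun x b p => by
        induction x using tm_ind with
        | h m n => simp [tm_bal]
        | h0 => simp
        | hadd x y hx hy => simp only [map_add, LinearMap.add_apply, hx, hy])
      (fun b x p => by
        induction x using tm_ind with
        | h m n => simp
        | h0 => simp
        | hadd x y hx hy => simp only [map_add, LinearMap.add_apply, hx, hy])
      (fun b x p => by
        induction x using tm_ind with
        | h m n => simp
        | h0 => simp
        | hadd x y hx hy => simp only [map_add, LinearMap.add_apply, hx, hy]))
    (tl (assocInvFun M N P)
      (fun m b x => by
        induction x using tm_ind with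
        | h m n => simp [tm_bal]
        | h0 => simp
        | hadd x y hx hy => simp only [map_add, hx, hy]))
    (tm_ext fun x p => by
      induction x using tm_ind with
      | h m n => simp
      | h0 => simp
      | hadd x y hx hy => simp only [map_add, LinearMap.add_apply, hx, hy])
    (tm_ext fun m x => by
      induction x using tm_ind with
      | h m n => simp
      | h0 => simp
      | hadd x y hx hy => simp only [map_add, hx, hy])

@[simp] lemma lin_assoc_hom_tm (M N P : AlgBimod k B) (m n p) :
    lin (assoc M N P).hom (tm (ten M N) P (tm M N m n) p) = tm M (ten N P) m (tm N P n p) := by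
  simp [assoc]

@[simp] lemma lin_assoc_inv_tm (M N P : AlgBimod k B) (m n p) :
    lin (assoc M N P).inv (tm M (ten N P) m (tm N P n p)) = tm (ten M N) P (tm M N m n) p := by
  simp [assoc]

/-- The map `b ⊗ m ↦ b m`. -/
def lunitHom (M : AlgBimod k B) : ten (reg k B) M ⟶ M :=
  homOut (M := reg k B) (N := M) (P := M) M.lact
    (fun b c m => M.mul_lact b c m) (fun b c m => M.mul_lact b c m)
    (fun b c m => M.lact_ract c b m)

/-- The map `m ⊗ b ↦ m b`. -/
def runitHom (M : AlgBimod k B) : ten M (reg k B) ⟶ M :=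
  homOut (M := M) (N := reg k B) (P := M) M.ract.flip
    (fun m b c => (M.ract_mul b c m).symm)
    (fun b m c => (M.lact_ract b c m).symm)
    (fun b m c => M.ract_mul c b m)

@[simp] lemma lin_lunitHom_tm (M : AlgBimod k B) (b : (reg k B).carrier) (m : M.carrier) :
    lin (lunitHom M) (tm (reg k B) M b m) = M.lact (show B from b) m :=
  tl_tm (M := reg k B) (N := M) M.lact (fun b c m => M.mul_lact b c m) b m

@[simp] lemma lin_runitHom_tm (M : AlgBimod k B) (m : M.carrier) (b : (reg k B).carrier) :
    lin (runitHom M) (tm M (reg k B) m b) = M.ract (show B from b) m :=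
  tl_tm (M := M) (N := reg k B) M.ract.flip (fun m b c => (M.ract_mul b c m).symm) m b

/-- The isomorphism `B ⊗_B M ≅ M`, `b ⊗ m ↦ b m`. -/
def lunit (M : AlgBimod k B) : ten (reg k B) M ≅ M :=
  mkIso (lunitHom M) (tm (reg k B) M (1 : B))
    (tm_ext fun b m => (congrArg (tm (reg k B) M (1 : B)) (lin_lunitHom_tm M b m)).trans
      ((tm_bal (reg k B) M (1 : B) b m).symm.trans
        (congrArg (fun c => tm (reg k B) M c m) (one_mul (M := B) b))))
    (LinearMap.ext fun m => (lin_lunitHom_tm M (1 : B) m).trans (M.one_lact m))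

/-- The isomorphism `M ⊗_B B ≅ M`, `m ⊗ b ↦ m b`. -/
def runit (M : AlgBimod k B) : ten M (reg k B) ≅ M :=
  mkIso (runitHom M) ((tm M (reg k B)).flip (1 : B))
    (tm_ext fun m b =>
      (congrArg (fun x => tm M (reg k B) x (1 : B)) (lin_runitHom_tm M m b)).trans
        ((tm_bal M (reg k B) m b (1 : B)).trans
          (congrArg (fun c => tm M (reg k B) m c) (mul_one (M := B) b))))
    (LinearMap.ext fun m => (lin_runitHom_tm M m (1 : B)).trans (M.ract_one m))

@[simp] lemma lin_lunit_tm (M : AlgBimod k B) (b : (reg k B).carrier) (m : M.carrier) :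
    lin (lunit M).hom (tm (reg k B) M b m) = M.lact (show B from b) m := lin_lunitHom_tm M b m

@[simp] lemma lin_runit_tm (M : AlgBimod k B) (m : M.carrier) (b : (reg k B).carrier) :
    lin (runit M).hom (tm M (reg k B) m b) = M.ract (show B from b) m := lin_runitHom_tm M m b

lemma hom_tm_ext {M N P : AlgBimod k B} {f g : ten M N ⟶ P}
    (h : ∀ m n, lin f (tm M N m n) = lin g (tm M N m n)) : f = g :=
  hom_ext (tm_ext h)

lemma hom_tm_ext₃ {M N P Q : AlgBimod k B} {f g : ten (ten M N) P ⟶ Q}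
    (h : ∀ m n p, lin f (tm (ten M N) P (tm M N m n) p) =
      lin g (tm (ten M N) P (tm M N m n) p)) : f = g :=
  hom_tm_ext fun x p => by
    have : (lin f ∘ₗ (tm (ten M N) P).flip p) = (lin g ∘ₗ (tm (ten M N) P).flip p) :=
      tm_ext fun m n => h m n p
    exact LinearMap.congr_fun this x

lemma hom_tm_ext₄ {M N P Q T : AlgBimod k B} {f g : ten (ten (ten M N) P) Q ⟶ T}
    (h : ∀ m n p q, lin f (tm (ten (ten M N) P) Q (tm (ten M N) P (tm M N m n) p) q) =
      lin g (tm (ten (ten M N) P) Q (tm (ten M N) P (tm M N m n) p) q)) : f = g :=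
  hom_tm_ext₃ fun x p q => by
    have : (lin f ∘ₗ (tm (ten (ten M N) P) Q).flip q ∘ₗ (tm (ten M N) P).flip p) =
        (lin g ∘ₗ (tm (ten (ten M N) P) Q).flip q ∘ₗ (tm (ten M N) P).flip p) :=
      tm_ext fun m n => h m n p q
    exact LinearMap.congr_fun this x

instance : MonoidalCategoryStruct (AlgBimod k B) where
  tensorObj := ten
  whiskerLeft M _ _ f := tenMap (𝟙 M) f
  whiskerRight f N := tenMap f (𝟙 N)
  tensorHom f g := tenMap f g
  tensorUnit := reg k B
  associator := assoc
  leftUnitor := lunit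
  rightUnitor := runit

/-- The category `bim(B)`, monoidal with respect to the tensor product over `B`. -/
instance : MonoidalCategory (AlgBimod k B) where
  tensorHom_def {M M' N N'} f g :=
    show tenMap f g = tenMap f (𝟙 N) ≫ tenMap (𝟙 M') g from
    hom_tm_ext fun m n => by simp
  id_tensorHom_id M N := show tenMap (𝟙 M) (𝟙 N) = 𝟙 (ten M N) from
    hom_tm_ext fun m n => by simp
  tensorHom_comp_tensorHom {_ _ _ _ _ _} f₁ f₂ g₁ g₂ :=
    show tenMap f₁ f₂ ≫ tenMap g₁ g₂ = tenMap (f₁ ≫ g₁) (f₂ ≫ g₂) from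
    hom_tm_ext fun m n => by simp
  whiskerLeft_id M N := show tenMap (𝟙 M) (𝟙 N) = 𝟙 (ten M N) from
    hom_tm_ext fun m n => by simp
  id_whiskerRight M N := show tenMap (𝟙 M) (𝟙 N) = 𝟙 (ten M N) from
    hom_tm_ext fun m n => by simp
  associator_naturality {M N P M' N' P'} f g h :=
    show tenMap (tenMap f g) h ≫ (assoc M' N' P').hom =
      (assoc M N P).hom ≫ tenMap f (tenMap g h) from
    hom_tm_ext₃ fun m n p => by simp
  leftUnitor_naturality {M N} f :=
    show tenMap (𝟙 (reg k B)) f ≫ (lunit N).hom = (lunit M).hom ≫ f from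
    hom_tm_ext fun b m => by
      simp only [lin_comp, LinearMap.comp_apply, lin_tenMap_tm, lin_lunit_tm]
      exact (lin_lact f _ m).symm
  rightUnitor_naturality {M N} f :=
    show tenMap f (𝟙 (reg k B)) ≫ (runit N).hom = (runit M).hom ≫ f from
    hom_tm_ext fun m b => by
      simp only [lin_comp, LinearMap.comp_apply, lin_tenMap_tm, lin_runit_tm]
      exact (lin_ract f _ m).symm
  pentagon M N P Q :=
    show tenMap (assoc M N P).hom (𝟙 Q) ≫ (assoc M (ten N P) Q).hom ≫
        tenMap (𝟙 M) (assoc N P Q).hom = (assoc (ten M N) P Q).hom ≫ (assoc M N (ten P Q)).hom from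
    hom_tm_ext₄ fun m n p q => by simp
  triangle M N :=
    show (assoc M (reg k B) N).hom ≫ tenMap (𝟙 M) (lunit N).hom = tenMap (runit M).hom (𝟙 N) from
    hom_tm_ext₃ fun m b n => by
      simp only [lin_comp, LinearMap.comp_apply, lin_tenMap_tm, lin_assoc_hom_tm, lin_lunit_tm,
        lin_runit_tm, lin_id, LinearMap.id_apply]
      exact (tm_bal M N m b n).symm

/-! The structure morphisms on elements `m ⊗ n`. -/

/-- The class of `m ⊗ n` as an element of `M ⊗ N` in the monoidal category `bim(B)`. -/
def tmul {M N : AlgBimod k B} (m : M.carrier) (n : N.carrier) :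
    (M ⊗ N : AlgBimod k B).carrier := tm M N m n

lemma tmul_bal {M N : AlgBimod k B} (m : M.carrier) (b : B) (n : N.carrier) :
    tmul (M.ract b m) n = tmul m (N.lact b n) := tm_bal M N m b n

lemma tensor_ext {M N P : AlgBimod k B} {f g : M ⊗ N ⟶ P}
    (h : ∀ m n, lin f (tmul m n) = lin g (tmul m n)) : f = g := hom_tm_ext h

lemma tensor_ext₃ {M N P Q : AlgBimod k B} {f g : (M ⊗ N) ⊗ P ⟶ Q}
    (h : ∀ m n p, lin f (tmul (tmul m n) p) = lin g (tmul (tmul m n) p)) : f = g :=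
  hom_tm_ext₃ h

@[simp] lemma tensor_lact {M N : AlgBimod k B} (b : B) (m : M.carrier) (n : N.carrier) :
    (M ⊗ N : AlgBimod k B).lact b (tmul m n) = tmul (M.lact b m) n := ten_lact_tm M N b m n

@[simp] lemma tensor_ract {M N : AlgBimod k B} (b : B) (m : M.carrier) (n : N.carrier) :
    (M ⊗ N : AlgBimod k B).ract b (tmul m n) = tmul m (N.ract b n) := ten_ract_tm M N b m n

@[simp] lemma lin_whiskerLeft (M : AlgBimod k B) {N N' : AlgBimod k B} (g : N ⟶ N')
    (m : M.carrier) (n : N.carrier) : lin (M ◁ g) (tmul m n) = tmul m (lin g n) :=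
  lin_tenMap_tm (𝟙 M) g m n

@[simp] lemma lin_whiskerRight {M M' : AlgBimod k B} (f : M ⟶ M') (N : AlgBimod k B)
    (m : M.carrier) (n : N.carrier) : lin (f ▷ N) (tmul m n) = tmul (lin f m) n :=
  lin_tenMap_tm f (𝟙 N) m n

@[simp] lemma lin_associator_hom {M N P : AlgBimod k B}
    (m : M.carrier) (n : N.carrier) (p : P.carrier) :
    lin (α_ M N P).hom (tmul (tmul m n) p) = tmul m (tmul n p) := lin_assoc_hom_tm M N P m n p

@[simp] lemma lin_associator_inv {M N P : AlgBimod k B}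
    (m : M.carrier) (n : N.carrier) (p : P.carrier) :
    lin (α_ M N P).inv (tmul m (tmul n p)) = tmul (tmul m n) p := lin_assoc_inv_tm M N P m n p

@[simp] lemma lin_leftUnitor (M : AlgBimod k B) (b : (𝟙_ (AlgBimod k B)).carrier)
    (m : M.carrier) : lin (λ_ M).hom (tmul b m) = M.lact (show B from b) m := lin_lunit_tm M b m

@[simp] lemma lin_rightUnitor (M : AlgBimod k B) (m : M.carrier)
    (b : (𝟙_ (AlgBimod k B)).carrier) : lin (ρ_ M).hom (tmul m b) = M.ract (show B from b) m :=
  lin_runit_tm M m b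

/-- A balanced bilinear map compatible with the outer actions, as a morphism `M ⊗ N ⟶ P`. -/
def tensorDesc {M N P : AlgBimod k B} (f : M.carrier →ₗ[k] N.carrier →ₗ[k] P.carrier)
    (hf : ∀ m b n, f (M.ract b m) n = f m (N.lact b n))
    (hl : ∀ b m n, f (M.lact b m) n = P.lact b (f m n))
    (hr : ∀ b m n, f m (N.ract b n) = P.ract b (f m n)) : M ⊗ N ⟶ P := homOut f hf hl hr

@[simp] lemma lin_tensorDesc {M N P : AlgBimod k B}
    (f : M.carrier →ₗ[k] N.carrier →ₗ[k] P.carrier) (hf hl hr) (m : M.carrier) (n : N.carrier) :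
    lin (tensorDesc (M := M) (N := N) (P := P) f hf hl hr) (tmul m n) = f m n :=
  lin_homOut_tm f hf hl hr m n

/-! ### Monoids in `bim(B)` from algebra homomorphisms -/

variable {A : Type u} [Ring A] [Algebra k A]

/-- The `B`-bimodule `A` induced by an algebra homomorphism `η : B → A`:
`b h b' = η(b) h η(b')`. -/
def ofAlgHom (f : B →ₐ[k] A) : AlgBimod k B where
  carrier := A
  lact := LinearMap.mul k A ∘ₗ f.toLinearMap
  ract := (LinearMap.mul k A).flip ∘ₗ f.toLinearMap
  one_lact := fun m => by simp
  mul_lact := fun b c m => by simp [mul_assoc]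
  ract_one := fun m => by simp
  ract_mul := fun b c m => by simp [mul_assoc]
  lact_ract := fun b c m => by simp [mul_assoc]

/-- The unit morphism of the monoid `A` in `bim(B)`: it is `η` itself. -/
def ofAlgHomUnit (f : B →ₐ[k] A) : 𝟙_ (AlgBimod k B) ⟶ ofAlgHom f :=
  ⟨f.toLinearMap, fun (b m : B) => map_mul f b m, fun (b m : B) => map_mul f m b⟩

/-- The multiplication morphism of the monoid `A` in `bim(B)`, through which the algebra
multiplication factorizes. -/
def ofAlgHomMul (f : B →ₐ[k] A) : ofAlgHom f ⊗ ofAlgHom f ⟶ ofAlgHom f :=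
  tensorDesc (M := ofAlgHom f) (N := ofAlgHom f) (P := ofAlgHom f) (LinearMap.mul k A)
    (fun a b c => mul_assoc (G := A) a (f b) c)
    (fun b a c => mul_assoc (G := A) (f b) a c)
    (fun b a c => (mul_assoc (G := A) a c (f b)).symm)

lemma lin_ofAlgHomMul (f : B →ₐ[k] A) (a b : (ofAlgHom f).carrier) :
    lin (ofAlgHomMul f) (tmul a b) = (show A from a) * (show A from b) :=
  lin_tensorDesc (M := ofAlgHom f) (N := ofAlgHom f) (P := ofAlgHom f) (LinearMap.mul k A) _ _ _ a b

instance (f : B →ₐ[k] A) : MonObj (ofAlgHom f) where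
  one := ofAlgHomUnit f
  mul := ofAlgHomMul f
  one_mul := tensor_ext fun b a => by
    rw [lin_comp, LinearMap.comp_apply, lin_whiskerRight, lin_leftUnitor]
    exact lin_ofAlgHomMul f _ _
  mul_one := tensor_ext fun a b => by
    rw [lin_comp, LinearMap.comp_apply, lin_whiskerLeft, lin_rightUnitor]
    exact lin_ofAlgHomMul f _ _
  mul_assoc := tensor_ext₃ fun a b c => by
    simp only [lin_comp, LinearMap.comp_apply, lin_whiskerRight, lin_whiskerLeft,
      lin_associator_hom, lin_ofAlgHomMul]
    exact mul_assoc (G := A) a b c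

end AlgBimod
/-! ### Weak bialgebras and weak Hopf algebras -/

/-- A weak bialgebra over `k`: an algebra and a coalgebra such that the comultiplication is
multiplicative,
`Δ²(1) = (Δ(1) ⊗ 1)(1 ⊗ Δ(1)) = (1 ⊗ Δ(1))(Δ(1) ⊗ 1)`, and
`ε(abc) = ε(a b₁) ε(b₂ c) = ε(a b₂) ε(b₁ c)`. -/
class IsWeakBialgebra (k : Type v) (A : Type u) [Field k] [Ring A] [Algebra k A]
    [Coalgebra k A] : Prop where
  comul_mul : ∀ a b : A,
    Coalgebra.comul (R := k) (a * b) = Coalgebra.comul (R := k) a * Coalgebra.comul (R := k) b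
  comul_comul_one :
    LinearMap.rTensor A (Coalgebra.comul (R := k)) (Coalgebra.comul (R := k) (1 : A)) =
      (Coalgebra.comul (R := k) (1 : A) ⊗ₜ[k] (1 : A)) *
        (TensorProduct.assoc k A A A).symm ((1 : A) ⊗ₜ[k] Coalgebra.comul (R := k) (1 : A))
  comul_comul_one' :
    LinearMap.rTensor A (Coalgebra.comul (R := k)) (Coalgebra.comul (R := k) (1 : A)) =
      (TensorProduct.assoc k A A A).symm ((1 : A) ⊗ₜ[k] Coalgebra.comul (R := k) (1 : A)) *
        (Coalgebra.comul (R := k) (1 : A) ⊗ₜ[k] (1 : A))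
  counit_mul_mul : ∀ a b c : A,
    Coalgebra.counit (R := k) (a * b * c) =
      LinearMap.mul' k k (TensorProduct.map
        (Coalgebra.counit (R := k) ∘ₗ LinearMap.mulLeft k a)
        (Coalgebra.counit (R := k) ∘ₗ LinearMap.mulRight k c) (Coalgebra.comul (R := k) b))
  counit_mul_mul' : ∀ a b c : A,
    Coalgebra.counit (R := k) (a * b * c) =
      LinearMap.mul' k k (TensorProduct.map
        (Coalgebra.counit (R := k) ∘ₗ LinearMap.mulLeft k a)
        (Coalgebra.counit (R := k) ∘ₗ LinearMap.mulRight k c)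
        (TensorProduct.comm k A A (Coalgebra.comul (R := k) b)))

namespace WeakBialg

section Slices

variable {k : Type v} {A : Type u} [Field k] [Ring A] [Algebra k A]

/-- `a ⊗ b ↦ f(b) a`. -/
def sliceR (f : A →ₗ[k] k) : A ⊗[k] A →ₗ[k] A :=
  (TensorProduct.rid k A).toLinearMap ∘ₗ LinearMap.lTensor A f

/-- `a ⊗ b ↦ f(a) b`. -/
def sliceL (f : A →ₗ[k] k) : A ⊗[k] A →ₗ[k] A :=
  (TensorProduct.lid k A).toLinearMap ∘ₗ LinearMap.rTensor A f

@[simp] lemma sliceR_tmul (f : A →ₗ[k] k) (a b : A) : sliceR f (a ⊗ₜ b) = f b • a := by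
  simp [sliceR]

@[simp] lemma sliceL_tmul (f : A →ₗ[k] k) (a b : A) : sliceL f (a ⊗ₜ b) = f a • b := by
  simp [sliceL]

lemma sliceR_left (f : A →ₗ[k] k) (a : A) (z : A ⊗[k] A) :
    sliceR f ((a ⊗ₜ 1) * z) = a * sliceR f z := by
  induction z using TensorProduct.induction_on with
  | zero => simp
  | tmul x y => simp
  | add x y hx hy => simp only [mul_add, map_add, hx, hy]

lemma sliceR_right (f : A →ₗ[k] k) (a : A) (z : A ⊗[k] A) :
    sliceR f (z * (a ⊗ₜ 1)) = sliceR f z * a := by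
  induction z using TensorProduct.induction_on with
  | zero => simp
  | tmul x y => simp
  | add x y hx hy => simp only [add_mul, map_add, hx, hy]

lemma sliceR_left' (f : A →ₗ[k] k) (b : A) (z : A ⊗[k] A) :
    sliceR f ((1 ⊗ₜ b) * z) = sliceR (f ∘ₗ LinearMap.mulLeft k b) z := by
  induction z using TensorProduct.induction_on with
  | zero => simp
  | tmul x y => simp
  | add x y hx hy => simp only [mul_add, map_add, hx, hy]

lemma sliceR_right' (f : A →ₗ[k] k) (b : A) (z : A ⊗[k] A) :
    sliceR f (z * (1 ⊗ₜ b)) = sliceR (f ∘ₗ LinearMap.mulRight k b) z := by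
  induction z using TensorProduct.induction_on with
  | zero => simp
  | tmul x y => simp
  | add x y hx hy => simp only [add_mul, map_add, hx, hy]

lemma sliceL_left (f : A →ₗ[k] k) (b : A) (z : A ⊗[k] A) :
    sliceL f ((1 ⊗ₜ b) * z) = b * sliceL f z := by
  induction z using TensorProduct.induction_on with
  | zero => simp
  | tmul x y => simp
  | add x y hx hy => simp only [mul_add, map_add, hx, hy]

lemma sliceL_right (f : A →ₗ[k] k) (b : A) (z : A ⊗[k] A) :
    sliceL f (z * (1 ⊗ₜ b)) = sliceL f z * b := by
  induction z using TensorProduct.induction_on with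
  | zero => simp
  | tmul x y => simp
  | add x y hx hy => simp only [add_mul, map_add, hx, hy]

lemma sliceL_left' (f : A →ₗ[k] k) (a : A) (z : A ⊗[k] A) :
    sliceL f ((a ⊗ₜ 1) * z) = sliceL (f ∘ₗ LinearMap.mulLeft k a) z := by
  induction z using TensorProduct.induction_on with
  | zero => simp
  | tmul x y => simp
  | add x y hx hy => simp only [mul_add, map_add, hx, hy]

lemma sliceL_right' (f : A →ₗ[k] k) (a : A) (z : A ⊗[k] A) :
    sliceL f (z * (a ⊗ₜ 1)) = sliceL (f ∘ₗ LinearMap.mulRight k a) z := by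
  induction z using TensorProduct.induction_on with
  | zero => simp
  | tmul x y => simp
  | add x y hx hy => simp only [add_mul, map_add, hx, hy]

lemma apply_sliceL (f g : A →ₗ[k] k) (z : A ⊗[k] A) :
    g (sliceL f z) = LinearMap.mul' k k (TensorProduct.map f g z) := by
  induction z using TensorProduct.induction_on with
  | zero => simp
  | tmul x y => simp
  | add x y hx hy => simp only [map_add, hx, hy]

lemma apply_sliceR (f g : A →ₗ[k] k) (z : A ⊗[k] A) :
    g (sliceR f z) = LinearMap.mul' k k (TensorProduct.map g f z) := by
  induction z using TensorProduct.induction_on with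
  | zero => simp
  | tmul x y => simp [mul_comm]
  | add x y hx hy => simp only [map_add, hx, hy]

lemma apply_sliceL' (f g : A →ₗ[k] k) (z : A ⊗[k] A) :
    g (sliceL f z) = LinearMap.mul' k k (TensorProduct.map g f (TensorProduct.comm k A A z)) := by
  induction z using TensorProduct.induction_on with
  | zero => simp
  | tmul x y => simp [mul_comm]
  | add x y hx hy => simp only [map_add, hx, hy]

lemma apply_sliceR' (f g : A →ₗ[k] k) (z : A ⊗[k] A) :
    g (sliceR f z) = LinearMap.mul' k k (TensorProduct.map f g (TensorProduct.comm k A A z)) := by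
  induction z using TensorProduct.induction_on with
  | zero => simp
  | tmul x y => simp
  | add x y hx hy => simp only [map_add, hx, hy]

/-- Slicing the third leg. -/
def slice3 (f : A →ₗ[k] k) : (A ⊗[k] A) ⊗[k] A →ₗ[k] A ⊗[k] A :=
  (TensorProduct.rid k (A ⊗[k] A)).toLinearMap ∘ₗ LinearMap.lTensor (A ⊗[k] A) f

/-- Slicing the first leg. -/
def slice1 (f : A →ₗ[k] k) : (A ⊗[k] A) ⊗[k] A →ₗ[k] A ⊗[k] A :=
  (TensorProduct.lid k (A ⊗[k] A)).toLinearMap ∘ₗ LinearMap.rTensor (A ⊗[k] A) f ∘ₗ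
    (TensorProduct.assoc k A A A).toLinearMap

/-- Slicing the middle leg. -/
def slice2 (f : A →ₗ[k] k) : (A ⊗[k] A) ⊗[k] A →ₗ[k] A ⊗[k] A :=
  LinearMap.rTensor A (sliceR f)

lemma slice3_left (f : A →ₗ[k] k) (w z : A ⊗[k] A) :
    slice3 f ((w ⊗ₜ 1) * (TensorProduct.assoc k A A A).symm (1 ⊗ₜ z)) =
      w * (1 ⊗ₜ sliceR f z) := by
  induction z using TensorProduct.induction_on with
  | zero => simp
  | tmul x y => simp [slice3]
  | add x y hx hy => simp only [TensorProduct.tmul_add, mul_add, map_add, hx, hy]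

lemma slice3_right (f : A →ₗ[k] k) (w z : A ⊗[k] A) :
    slice3 f ((TensorProduct.assoc k A A A).symm (1 ⊗ₜ z) * (w ⊗ₜ 1)) =
      (1 ⊗ₜ sliceR f z) * w := by
  induction z using TensorProduct.induction_on with
  | zero => simp
  | tmul x y => simp [slice3]
  | add x y hx hy => simp only [TensorProduct.tmul_add, add_mul, map_add, hx, hy]

lemma slice1_left (f : A →ₗ[k] k) (w z : A ⊗[k] A) :
    slice1 f ((z ⊗ₜ 1) * (TensorProduct.assoc k A A A).symm (1 ⊗ₜ w)) =
      (sliceL f z ⊗ₜ 1) * w := by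
  induction z using TensorProduct.induction_on with
  | zero => simp
  | tmul x y =>
    induction w using TensorProduct.induction_on with
    | zero => simp
    | tmul a b => simp [slice1, TensorProduct.smul_tmul']
    | add a b ha hb => simp only [TensorProduct.tmul_add, mul_add, map_add, ha, hb]
  | add x y hx hy => simp only [TensorProduct.add_tmul, add_mul, map_add, hx, hy]

lemma slice1_right (f : A →ₗ[k] k) (w z : A ⊗[k] A) :
    slice1 f ((TensorProduct.assoc k A A A).symm (1 ⊗ₜ w) * (z ⊗ₜ 1)) =
      w * (sliceL f z ⊗ₜ 1) := by
  induction z using TensorProduct.induction_on with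
  | zero => simp
  | tmul x y =>
    induction w using TensorProduct.induction_on with
    | zero => simp
    | tmul a b => simp [slice1, TensorProduct.smul_tmul']
    | add a b ha hb => simp only [TensorProduct.tmul_add, add_mul, map_add, ha, hb]
  | add x y hx hy => simp only [TensorProduct.add_tmul, mul_add, map_add, hx, hy]

end Slices

section Maps

variable (k : Type v) (A : Type u) [Field k] [Ring A] [Algebra k A] [Coalgebra k A]

/-- `Δ(1) = 1₁ ⊗ 1₂`. -/
def comulOne : A ⊗[k] A := Coalgebra.comul (R := k) (1 : A)

/-- `⊓ᴿ(h) = 1₁ ε(h 1₂)`. -/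
def piR : A →ₗ[k] A :=
  (TensorProduct.rid k A).toLinearMap ∘ₗ
    LinearMap.lTensor A (Coalgebra.counit (R := k) ∘ₗ LinearMap.mul' k A ∘ₗ
      (TensorProduct.comm k A A).toLinearMap) ∘ₗ
    (TensorProduct.assoc k A A A).toLinearMap ∘ₗ TensorProduct.mk k (A ⊗[k] A) A (comulOne k A)

/-- `⊓̄ᴿ(h) = 1₁ ε(1₂ h)`. -/
def piRbar : A →ₗ[k] A :=
  (TensorProduct.rid k A).toLinearMap ∘ₗ
    LinearMap.lTensor A (Coalgebra.counit (R := k) ∘ₗ LinearMap.mul' k A) ∘ₗ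
    (TensorProduct.assoc k A A A).toLinearMap ∘ₗ TensorProduct.mk k (A ⊗[k] A) A (comulOne k A)

/-- `⊓ᴸ(h) = ε(1₁ h) 1₂`. -/
def piL : A →ₗ[k] A :=
  (TensorProduct.lid k A).toLinearMap ∘ₗ
    LinearMap.rTensor A (Coalgebra.counit (R := k) ∘ₗ LinearMap.mul' k A ∘ₗ
      (TensorProduct.comm k A A).toLinearMap) ∘ₗ
    (TensorProduct.assoc k A A A).symm.toLinearMap ∘ₗ
    (TensorProduct.mk k A (A ⊗[k] A)).flip (comulOne k A)

/-- `⊓̄ᴸ(h) = ε(h 1₁) 1₂`. -/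
def piLbar : A →ₗ[k] A :=
  (TensorProduct.lid k A).toLinearMap ∘ₗ
    LinearMap.rTensor A (Coalgebra.counit (R := k) ∘ₗ LinearMap.mul' k A) ∘ₗ
    (TensorProduct.assoc k A A A).symm.toLinearMap ∘ₗ
    (TensorProduct.mk k A (A ⊗[k] A)).flip (comulOne k A)

variable {A}

/-- The functional `ε(h -)`. -/
def epsL (h : A) : A →ₗ[k] k := Coalgebra.counit (R := k) ∘ₗ LinearMap.mulLeft k h

/-- The functional `ε(- h)`. -/
def epsR (h : A) : A →ₗ[k] k := Coalgebra.counit (R := k) ∘ₗ LinearMap.mulRight k h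

@[simp] lemma epsL_apply (h a : A) : epsL k h a = Coalgebra.counit (R := k) (h * a) := rfl

@[simp] lemma epsR_apply (h a : A) : epsR k h a = Coalgebra.counit (R := k) (a * h) := rfl

lemma piR_apply (h : A) : piR k A h = sliceR (epsL k h) (comulOne k A) := by
  unfold piR
  simp only [LinearMap.comp_apply, LinearEquiv.coe_coe, TensorProduct.mk_apply]
  induction comulOne k A using TensorProduct.induction_on with
  | zero => simp
  | tmul x y => simp
  | add x y hx hy => simp only [TensorProduct.add_tmul, map_add, hx, hy]

lemma piRbar_apply (h : A) : piRbar k A h = sliceR (epsR k h) (comulOne k A) := by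
  unfold piRbar
  simp only [LinearMap.comp_apply, LinearEquiv.coe_coe, TensorProduct.mk_apply]
  induction comulOne k A using TensorProduct.induction_on with
  | zero => simp
  | tmul x y => simp
  | add x y hx hy => simp only [TensorProduct.add_tmul, map_add, hx, hy]

lemma piL_apply (h : A) : piL k A h = sliceL (epsR k h) (comulOne k A) := by
  unfold piL
  simp only [LinearMap.comp_apply, LinearEquiv.coe_coe, LinearMap.flip_apply,
    TensorProduct.mk_apply]
  induction comulOne k A using TensorProduct.induction_on with
  | zero => simp
  | tmul x y => simp
  | add x y hx hy => simp only [TensorProduct.tmul_add, map_add, hx, hy]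

lemma piLbar_apply (h : A) : piLbar k A h = sliceL (epsL k h) (comulOne k A) := by
  unfold piLbar
  simp only [LinearMap.comp_apply, LinearEquiv.coe_coe, LinearMap.flip_apply,
    TensorProduct.mk_apply]
  induction comulOne k A using TensorProduct.induction_on with
  | zero => simp
  | tmul x y => simp
  | add x y hx hy => simp only [TensorProduct.tmul_add, map_add, hx, hy]

end Maps

section Basic

variable {k : Type v} {A : Type u} [Field k] [Ring A] [Algebra k A] [Coalgebra k A]

lemma sliceL_counit (h : A) :
    sliceL (Coalgebra.counit (R := k)) (Coalgebra.comul (R := k) h) = h := by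
  simp [sliceL]

lemma sliceR_counit (h : A) :
    sliceR (Coalgebra.counit (R := k)) (Coalgebra.comul (R := k) h) = h := by
  simp [sliceR]

lemma comul_sliceR (f : A →ₗ[k] k) (z : A ⊗[k] A) :
    Coalgebra.comul (R := k) (sliceR f z) =
      slice3 f (LinearMap.rTensor A (Coalgebra.comul (R := k)) z) := by
  induction z using TensorProduct.induction_on with
  | zero => simp
  | tmul x y => simp [slice3]
  | add x y hx hy => simp only [map_add, hx, hy]

lemma comul_sliceL (f : A →ₗ[k] k) (z : A ⊗[k] A) :
    Coalgebra.comul (R := k) (sliceL f z) =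
      slice1 f ((TensorProduct.assoc k A A A).symm
        (LinearMap.lTensor A (Coalgebra.comul (R := k)) z)) := by
  induction z using TensorProduct.induction_on with
  | zero => simp
  | tmul x y => simp [slice1]
  | add x y hx hy => simp only [map_add, hx, hy]

lemma lTensor_comul_comulOne :
    (TensorProduct.assoc k A A A).symm
      (LinearMap.lTensor A (Coalgebra.comul (R := k)) (comulOne k A)) =
      LinearMap.rTensor A (Coalgebra.comul (R := k)) (comulOne k A) := by
  rw [LinearEquiv.symm_apply_eq, comulOne, Coalgebra.coassoc_apply]

lemma piR_of_comul {r : A}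
    (h : Coalgebra.comul (R := k) r = (1 ⊗ₜ r) * comulOne k A) : piR k A r = r := by
  conv_rhs => rw [← sliceR_counit (k := k) r, h, sliceR_left']
  rw [piR_apply]; rfl

variable [IsWeakBialgebra k A]

lemma epsL_piLbar (a : A) : epsL k (piLbar k A a) = epsL k a := by
  ext h
  have := IsWeakBialgebra.counit_mul_mul (k := k) a 1 h
  rw [mul_one] at this
  rw [epsL_apply, epsL_apply, this, piLbar_apply]
  exact apply_sliceL (epsL k a) (epsR k h) _

lemma epsR_piRbar (a : A) : epsR k (piRbar k A a) = epsR k a := by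
  ext h
  have := IsWeakBialgebra.counit_mul_mul (k := k) h 1 a
  rw [mul_one] at this
  rw [epsR_apply, epsR_apply, this, piRbar_apply]
  exact apply_sliceR (epsR k a) (epsL k h) _

lemma epsR_piL (a : A) : epsR k (piL k A a) = epsR k a := by
  ext h
  have := IsWeakBialgebra.counit_mul_mul' (k := k) h 1 a
  rw [mul_one] at this
  rw [epsR_apply, epsR_apply, this, piL_apply]
  exact apply_sliceL' (epsR k a) (epsL k h) _

lemma epsL_piR (a : A) : epsL k (piR k A a) = epsL k a := by
  ext h
  have := IsWeakBialgebra.counit_mul_mul' (k := k) a 1 h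
  rw [mul_one] at this
  rw [epsL_apply, epsL_apply, this, piR_apply]
  exact apply_sliceR' (epsL k a) (epsR k h) _

lemma comul_sliceR_one (f : A →ₗ[k] k) :
    Coalgebra.comul (R := k) (sliceR f (comulOne k A)) =
      comulOne k A * (1 ⊗ₜ sliceR f (comulOne k A)) := by
  rw [comul_sliceR, ← slice3_left]
  exact congrArg _ IsWeakBialgebra.comul_comul_one

lemma comul_sliceR_one' (f : A →ₗ[k] k) :
    Coalgebra.comul (R := k) (sliceR f (comulOne k A)) =
      (1 ⊗ₜ sliceR f (comulOne k A)) * comulOne k A := by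
  rw [comul_sliceR, ← slice3_right]
  exact congrArg _ IsWeakBialgebra.comul_comul_one'

lemma comul_sliceL_one (f : A →ₗ[k] k) :
    Coalgebra.comul (R := k) (sliceL f (comulOne k A)) =
      (sliceL f (comulOne k A) ⊗ₜ 1) * comulOne k A := by
  rw [comul_sliceL, ← slice1_left, lTensor_comul_comulOne]
  exact congrArg _ IsWeakBialgebra.comul_comul_one

lemma comul_sliceL_one' (f : A →ₗ[k] k) :
    Coalgebra.comul (R := k) (sliceL f (comulOne k A)) =
      comulOne k A * (sliceL f (comulOne k A) ⊗ₜ 1) := by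
  rw [comul_sliceL, ← slice1_right, lTensor_comul_comulOne]
  exact congrArg _ IsWeakBialgebra.comul_comul_one'

lemma comul_mul_comulOne (h : A) :
    Coalgebra.comul (R := k) h * comulOne k A = Coalgebra.comul (R := k) h := by
  rw [comulOne, ← IsWeakBialgebra.comul_mul, mul_one]

lemma comulOne_mul_comul (h : A) :
    comulOne k A * Coalgebra.comul (R := k) h = Coalgebra.comul (R := k) h := by
  rw [comulOne, ← IsWeakBialgebra.comul_mul, one_mul]

/-! Elements `r` with `Δ(r) = (1 ⊗ r)Δ(1)`. -/

lemma comul_of_mem {r : A} (h : r ∈ LinearMap.range (piR k A)) :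
    Coalgebra.comul (R := k) r = (1 ⊗ₜ r) * comulOne k A := by
  obtain ⟨a, rfl⟩ := h
  rw [piR_apply]; exact comul_sliceR_one' _

lemma comul_of_mem' {r : A} (h : r ∈ LinearMap.range (piR k A)) :
    Coalgebra.comul (R := k) r = comulOne k A * (1 ⊗ₜ r) := by
  obtain ⟨a, rfl⟩ := h
  rw [piR_apply]; exact comul_sliceR_one _

lemma mem_of_comul {r : A} (h : Coalgebra.comul (R := k) r = (1 ⊗ₜ r) * comulOne k A) :
    r ∈ LinearMap.range (piR k A) := ⟨r, piR_of_comul h⟩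

variable (k A) in
/-- The base algebra `R`: the image of `⊓ᴿ`, a subalgebra of `A`. -/
def baseAlgebra : Subalgebra k A where
  carrier := LinearMap.range (piR k A)
  mul_mem' := by
    intro r s hr hs
    refine mem_of_comul ?_
    rw [IsWeakBialgebra.comul_mul, comul_of_mem hr, mul_assoc, comulOne_mul_comul,
      comul_of_mem hs, ← mul_assoc]
    simp
  add_mem' := fun ha hb => Submodule.add_mem _ ha hb
  algebraMap_mem' := by
    intro c
    refine mem_of_comul ?_
    rw [Algebra.algebraMap_eq_smul_one, map_smul, TensorProduct.tmul_smul,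
      ← Algebra.TensorProduct.one_def, smul_mul_assoc, one_mul]
    rfl

/-! Elements `l` in the image of `⊓ᴸ`, characterized by `Δ(l) = (l ⊗ 1)Δ(1) = Δ(1)(l ⊗ 1)`. -/

variable (k) in
/-- `Δ(l) = (l ⊗ 1)Δ(1) = Δ(1)(l ⊗ 1)`. -/
def IsLeftBase (l : A) : Prop :=
  Coalgebra.comul (R := k) l = (l ⊗ₜ 1) * comulOne k A ∧
    Coalgebra.comul (R := k) l = comulOne k A * (l ⊗ₜ 1)

lemma isLeftBase_piL (h : A) : IsLeftBase k (piL k A h) := by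
  rw [piL_apply]; exact ⟨comul_sliceL_one _, comul_sliceL_one' _⟩

lemma isLeftBase_piLbar (h : A) : IsLeftBase k (piLbar k A h) := by
  rw [piLbar_apply]; exact ⟨comul_sliceL_one _, comul_sliceL_one' _⟩

lemma comul_mem_mul {r : A} (hr : r ∈ LinearMap.range (piR k A)) (h : A) :
    Coalgebra.comul (R := k) (r * h) = (1 ⊗ₜ r) * Coalgebra.comul (R := k) h := by
  rw [IsWeakBialgebra.comul_mul, comul_of_mem hr, mul_assoc, comulOne_mul_comul]

lemma comul_mul_mem {r : A} (hr : r ∈ LinearMap.range (piR k A)) (h : A) :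
    Coalgebra.comul (R := k) (h * r) = Coalgebra.comul (R := k) h * (1 ⊗ₜ r) := by
  rw [IsWeakBialgebra.comul_mul, comul_of_mem' hr, ← mul_assoc, comul_mul_comulOne]

lemma IsLeftBase.comul_mul {l : A} (hl : IsLeftBase k l) (h : A) :
    Coalgebra.comul (R := k) (l * h) = (l ⊗ₜ 1) * Coalgebra.comul (R := k) h := by
  rw [IsWeakBialgebra.comul_mul, hl.1, mul_assoc, comulOne_mul_comul]

lemma IsLeftBase.mul_comul {l : A} (hl : IsLeftBase k l) (h : A) :
    Coalgebra.comul (R := k) (h * l) = Coalgebra.comul (R := k) h * (l ⊗ₜ 1) := by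
  rw [IsWeakBialgebra.comul_mul, hl.2, ← mul_assoc, comul_mul_comulOne]

/-- Elements of the base algebra commute with the image of `⊓ᴸ`. -/
lemma IsLeftBase.commute {l r : A} (hl : IsLeftBase k l)
    (hr : r ∈ LinearMap.range (piR k A)) : r * l = l * r := by
  rw [← sliceL_counit (k := k) (r * l), ← sliceL_counit (k := k) (l * r),
    comul_mem_mul hr, hl.comul_mul, hl.1, comul_of_mem hr, ← mul_assoc, ← mul_assoc]
  simp

lemma slice2_left (f : A →ₗ[k] k) (b : A) (w : (A ⊗[k] A) ⊗[k] A) :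
    slice2 f (((1 ⊗ₜ b) ⊗ₜ 1) * w) = slice2 (f ∘ₗ LinearMap.mulLeft k b) w := by
  induction w using TensorProduct.induction_on with
  | zero => simp
  | tmul x y => simp [slice2, sliceR_left']
  | add x y hx hy => simp only [mul_add, map_add, hx, hy]

lemma slice2_right (f : A →ₗ[k] k) (b : A) (w : (A ⊗[k] A) ⊗[k] A) :
    slice2 f (w * ((1 ⊗ₜ b) ⊗ₜ 1)) = slice2 (f ∘ₗ LinearMap.mulRight k b) w := by
  induction w using TensorProduct.induction_on with
  | zero => simp
  | tmul x y => simp [slice2, sliceR_right']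
  | add x y hx hy => simp only [add_mul, map_add, hx, hy]

lemma slice2_rTensor_comul (z : A ⊗[k] A) :
    slice2 (Coalgebra.counit (R := k)) (LinearMap.rTensor A (Coalgebra.comul (R := k)) z) = z := by
  induction z using TensorProduct.induction_on with
  | zero => simp
  | tmul x y => simp [slice2, sliceR_counit]
  | add x y hx hy => simp only [map_add, hx, hy]

lemma slice2_assoc_tmul (f : A →ₗ[k] k) (x : A) (w : A ⊗[k] A) :
    slice2 f ((TensorProduct.assoc k A A A).symm (x ⊗ₜ w)) = x ⊗ₜ sliceL f w := by
  induction w using TensorProduct.induction_on with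
  | zero => simp
  | tmul x y => simp [slice2, TensorProduct.smul_tmul]
  | add x y hx hy => simp only [TensorProduct.tmul_add, map_add, hx, hy]

/-- `x ⊗ y ↦ x ⊗ y₁ ⊗ y₂`. -/
def comulSnd (z : A ⊗[k] A) : (A ⊗[k] A) ⊗[k] A :=
  (TensorProduct.assoc k A A A).symm (LinearMap.lTensor A (Coalgebra.comul (R := k)) z)

lemma slice2_comulSnd (z : A ⊗[k] A) :
    slice2 (Coalgebra.counit (R := k)) (comulSnd z) = z := by
  unfold comulSnd
  induction z using TensorProduct.induction_on with
  | zero => simp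
  | tmul x y => simp only [LinearMap.lTensor_tmul, slice2_assoc_tmul, sliceL_counit]
  | add x y hx hy => simp only [map_add, hx, hy]

lemma assoc_symm_mul (x y : A ⊗[k] (A ⊗[k] A)) :
    (TensorProduct.assoc k A A A).symm (x * y) =
      (TensorProduct.assoc k A A A).symm x * (TensorProduct.assoc k A A A).symm y :=
  map_mul (Algebra.TensorProduct.assoc k k k A A A).symm x y

lemma IsLeftBase.comulSnd_mul {l : A} (hl : IsLeftBase k l) (z : A ⊗[k] A) :
    comulSnd ((1 ⊗ₜ l) * z) = ((1 ⊗ₜ l) ⊗ₜ 1) * comulSnd z := by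
  have e : (((1 : A) ⊗ₜ[k] l) ⊗ₜ[k] (1 : A)) =
      (TensorProduct.assoc k A A A).symm (1 ⊗ₜ (l ⊗ₜ 1)) := by simp
  unfold comulSnd
  rw [e, ← assoc_symm_mul]
  congr 1
  induction z using TensorProduct.induction_on with
  | zero => simp
  | tmul x y => simp [hl.comul_mul]
  | add x y hx hy => simp only [mul_add, map_add, hx, hy]

lemma IsLeftBase.mul_comulSnd {l : A} (hl : IsLeftBase k l) (z : A ⊗[k] A) :
    comulSnd (z * (1 ⊗ₜ l)) = comulSnd z * ((1 ⊗ₜ l) ⊗ₜ 1) := by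
  have e : (((1 : A) ⊗ₜ[k] l) ⊗ₜ[k] (1 : A)) =
      (TensorProduct.assoc k A A A).symm (1 ⊗ₜ (l ⊗ₜ 1)) := by simp
  unfold comulSnd
  rw [e, ← assoc_symm_mul]
  congr 1
  induction z using TensorProduct.induction_on with
  | zero => simp
  | tmul x y => simp [hl.mul_comul]
  | add x y hx hy => simp only [add_mul, map_add, hx, hy]

lemma rTensor_comul_mul {r : A} (hr : r ∈ LinearMap.range (piR k A)) (z : A ⊗[k] A) :
    LinearMap.rTensor A (Coalgebra.comul (R := k)) ((r ⊗ₜ 1) * z) =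
      ((1 ⊗ₜ r) ⊗ₜ 1) * LinearMap.rTensor A (Coalgebra.comul (R := k)) z := by
  induction z using TensorProduct.induction_on with
  | zero => simp
  | tmul x y => simp [comul_mem_mul hr]
  | add x y hx hy => simp only [mul_add, map_add, hx, hy]

lemma rTensor_comul_mul' {r : A} (hr : r ∈ LinearMap.range (piR k A)) (z : A ⊗[k] A) :
    LinearMap.rTensor A (Coalgebra.comul (R := k)) (z * (r ⊗ₜ 1)) =
      LinearMap.rTensor A (Coalgebra.comul (R := k)) z * ((1 ⊗ₜ r) ⊗ₜ 1) := by
  induction z using TensorProduct.induction_on with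
  | zero => simp
  | tmul x y => simp [comul_mul_mem hr]
  | add x y hx hy => simp only [add_mul, map_add, hx, hy]

/-- `r 1₁ ⊗ 1₂ = 1₁ ⊗ ⊓̄ᴸ(r) 1₂`. -/
lemma mem_mul_comulOne {r : A} (hr : r ∈ LinearMap.range (piR k A)) :
    (r ⊗ₜ 1) * comulOne k A = (1 ⊗ₜ piLbar k A r) * comulOne k A := by
  conv_lhs => rw [← slice2_rTensor_comul (k := k) ((r ⊗ₜ[k] (1 : A)) * comulOne k A)]
  conv_rhs => rw [← slice2_comulSnd (k := k) (((1 : A) ⊗ₜ[k] piLbar k A r) * comulOne k A)]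
  rw [rTensor_comul_mul hr, (isLeftBase_piLbar r).comulSnd_mul, slice2_left, slice2_left,
    comulSnd, lTensor_comul_comulOne]
  exact congrArg (fun f => slice2 f _) (epsL_piLbar r).symm

lemma piRbar_mem (h : A) : piRbar k A h ∈ LinearMap.range (piR k A) := by
  rw [piRbar_apply]; exact mem_of_comul (comul_sliceR_one' _)

/-- `1₁ ⊗ 1₂ l = 1₁ ⊓̄ᴿ(l) ⊗ 1₂`. -/
lemma IsLeftBase.comulOne_mul {l : A} (hl : IsLeftBase k l) :
    comulOne k A * (1 ⊗ₜ l) = comulOne k A * (piRbar k A l ⊗ₜ 1) := by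
  conv_rhs => rw [← slice2_rTensor_comul (k := k) (comulOne k A * (piRbar k A l ⊗ₜ[k] (1 : A)))]
  conv_lhs => rw [← slice2_comulSnd (k := k) (comulOne k A * ((1 : A) ⊗ₜ[k] l))]
  rw [rTensor_comul_mul' (piRbar_mem l), hl.mul_comulSnd, slice2_right, slice2_right,
    comulSnd, lTensor_comul_comulOne]
  exact congrArg (fun f => slice2 f _) (epsR_piRbar l).symm

lemma piLbar_one : piLbar k A 1 = 1 := by
  rw [piLbar_apply]
  have : epsL k (1 : A) = Coalgebra.counit (R := k) := by ext; simp
  rw [this, comulOne, sliceL_counit]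

lemma piRbar_one : piRbar k A 1 = 1 := by
  rw [piRbar_apply]
  have : epsR k (1 : A) = Coalgebra.counit (R := k) := by ext; simp
  rw [this, comulOne, sliceR_counit]

lemma piLbar_eq (r : A) :
    piLbar k A r = sliceL (Coalgebra.counit (R := k)) ((r ⊗ₜ 1) * comulOne k A) := by
  rw [sliceL_left', piLbar_apply]; rfl

lemma piRbar_eq (r : A) :
    piRbar k A r = sliceR (Coalgebra.counit (R := k)) (comulOne k A * (1 ⊗ₜ r)) := by
  rw [sliceR_right', piRbar_apply]; rfl

/-- `⊓̄ᴸ` is anti-multiplicative on the base algebra. -/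
lemma piLbar_mul {r s : A} (hr : r ∈ LinearMap.range (piR k A))
    (hs : s ∈ LinearMap.range (piR k A)) :
    piLbar k A (r * s) = piLbar k A s * piLbar k A r := by
  have e : ((r * s) ⊗ₜ[k] (1 : A)) = (r ⊗ₜ 1) * (s ⊗ₜ 1) := by simp
  have e' : (r ⊗ₜ[k] (1 : A)) * (1 ⊗ₜ piLbar k A s) = (1 ⊗ₜ piLbar k A s) * (r ⊗ₜ 1) := by simp
  rw [piLbar_eq, e, mul_assoc, mem_mul_comulOne hs, ← mul_assoc, e', mul_assoc,
    mem_mul_comulOne hr, sliceL_left, sliceL_left, comulOne, sliceL_counit, mul_one]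

/-- `⊓̄ᴿ` is anti-multiplicative on the image of `⊓ᴸ`. -/
lemma piRbar_mul {l m : A} (hl : IsLeftBase k l) (hm : IsLeftBase k m) :
    piRbar k A (l * m) = piRbar k A m * piRbar k A l := by
  have e : ((1 : A) ⊗ₜ[k] (l * m)) = (1 ⊗ₜ l) * (1 ⊗ₜ m) := by simp
  have e' : (piRbar k A l ⊗ₜ[k] (1 : A)) * (1 ⊗ₜ m) = (1 ⊗ₜ m) * (piRbar k A l ⊗ₜ 1) := by simp
  rw [piRbar_eq, e, ← mul_assoc, hl.comulOne_mul, mul_assoc, e', ← mul_assoc,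
    hm.comulOne_mul, sliceR_right, sliceR_right, comulOne, sliceR_counit, one_mul]

/-! ### The Frobenius-separability structure of the base algebra -/

variable (k A) in
/-- The separability element `Σ eᵢ ⊗ fᵢ = 1₁ ⊗ ⊓ᴿ(1₂)` of the base algebra, regarded in
`A ⊗ A`. -/
def sepElt : A ⊗[k] A := LinearMap.lTensor A (piR k A) (comulOne k A)

variable (k A) in
/-- `y ↦ Σ ψ(y fᵢ) eᵢ`, where the Frobenius functional `ψ` is the restriction of the counit and
`Σ eᵢ ⊗ fᵢ` is the separability element of the base algebra. -/
def nak : A →ₗ[k] A :=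
  (TensorProduct.rid k A).toLinearMap ∘ₗ
    LinearMap.lTensor A (Coalgebra.counit (R := k) ∘ₗ LinearMap.mul' k A ∘ₗ
      (TensorProduct.comm k A A).toLinearMap) ∘ₗ
    (TensorProduct.assoc k A A A).toLinearMap ∘ₗ TensorProduct.mk k (A ⊗[k] A) A (sepElt k A)

lemma nak_apply (y : A) : nak k A y = sliceR (epsL k y) (sepElt k A) := by
  unfold nak
  simp only [LinearMap.comp_apply, LinearEquiv.coe_coe, TensorProduct.mk_apply]
  induction sepElt k A using TensorProduct.induction_on with
  | zero => simp
  | tmul x y => simp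
  | add x y hx hy => simp only [TensorProduct.add_tmul, map_add, hx, hy]

lemma nak_eq (y : A) : nak k A y = piRbar k A (piLbar k A y) := by
  have e : epsL k y ∘ₗ piR k A = epsR k (piLbar k A y) := by
    ext b
    simp only [LinearMap.comp_apply, epsR_apply]
    have h1 := apply_sliceR (epsL k b) (epsL k y) (comulOne k A)
    have h2 := apply_sliceL (epsL k y) (epsL k b) (comulOne k A)
    rw [← piR_apply] at h1
    rw [← piLbar_apply] at h2
    rw [h1, ← h2, epsL_apply]
  rw [nak_apply, sepElt, piRbar_apply, ← e]
  induction comulOne k A using TensorProduct.induction_on with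
  | zero => simp
  | tmul x y => simp
  | add x y hx hy => simp only [map_add, hx, hy]

lemma nak_mem (y : A) : nak k A y ∈ LinearMap.range (piR k A) := by
  rw [nak_eq]; exact piRbar_mem _

lemma nak_one : nak k A 1 = 1 := by rw [nak_eq, piLbar_one, piRbar_one]

lemma nak_mul {r s : A} (hr : r ∈ LinearMap.range (piR k A))
    (hs : s ∈ LinearMap.range (piR k A)) : nak k A (r * s) = nak k A r * nak k A s := by
  rw [nak_eq, nak_eq, nak_eq, piLbar_mul hr hs,
    piRbar_mul (isLeftBase_piLbar s) (isLeftBase_piLbar r)]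

/-- `ψ(y r) = ψ(r ν(y))` for `ν(y) = Σ ψ(y fᵢ) eᵢ`. -/
lemma counit_mul_nak (y : A) {r : A} (hr : r ∈ LinearMap.range (piR k A)) :
    Coalgebra.counit (R := k) (y * r) = Coalgebra.counit (R := k) (r * nak k A y) := by
  have h1 := LinearMap.congr_fun (epsR_piRbar (k := k) (piLbar k A y)) r
  have h2 := LinearMap.congr_fun (epsL_piLbar (k := k) y) r
  simp only [epsR_apply, epsL_apply] at h1 h2
  rw [nak_eq, h1, (isLeftBase_piLbar y).commute hr, h2]

/-! ### Module properties of `⊓ᴿ` and `⊓̄ᴿ` -/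

lemma piR_of_mem {r : A} (hr : r ∈ LinearMap.range (piR k A)) : piR k A r = r :=
  piR_of_comul (comul_of_mem hr)

lemma piRbar_of_mem {r : A} (hr : r ∈ LinearMap.range (piR k A)) : piRbar k A r = r := by
  conv_rhs => rw [← sliceR_counit (k := k) r, comul_of_mem' hr]
  rw [piRbar_eq]

lemma piRbar_congr {a b : A} (h : epsR k a = epsR k b) : piRbar k A a = piRbar k A b := by
  rw [piRbar_apply, piRbar_apply, h]

lemma piR_congr {a b : A} (h : epsL k a = epsL k b) : piR k A a = piR k A b := by
  rw [piR_apply, piR_apply, h]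

lemma piRbar_mul_piL (h x : A) : piRbar k A (h * piL k A x) = piRbar k A (h * x) := by
  refine piRbar_congr ?_
  ext a
  have := LinearMap.congr_fun (epsR_piL (k := k) x) (a * h)
  simpa [mul_assoc] using this

lemma piR_piLbar_mul (y a : A) : piR k A (piLbar k A y * a) = piR k A (y * a) := by
  refine piR_congr ?_
  ext b
  have := LinearMap.congr_fun (epsL_piLbar (k := k) y) (a * b)
  simpa [mul_assoc] using this

lemma comulOne_mul_mem {x : A} (hx : x ∈ LinearMap.range (piR k A)) :
    comulOne k A * (1 ⊗ₜ piL k A x) = comulOne k A * (x ⊗ₜ 1) := by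
  have h : piRbar k A (piL k A x) = x := by
    have := piRbar_mul_piL (k := k) 1 x
    rw [one_mul, one_mul] at this
    rw [this, piRbar_of_mem hx]
  rw [(isLeftBase_piL x).comulOne_mul, h]

lemma comul_mul_piL (h : A) {x : A} (hx : x ∈ LinearMap.range (piR k A)) :
    Coalgebra.comul (R := k) h * (1 ⊗ₜ piL k A x) = Coalgebra.comul (R := k) h * (x ⊗ₜ 1) := by
  rw [← comul_mul_comulOne, mul_assoc, comulOne_mul_mem hx, mul_assoc]

lemma mem_mul_comul {y : A} (hy : y ∈ LinearMap.range (piR k A)) (h : A) :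
    (y ⊗ₜ 1) * Coalgebra.comul (R := k) h = (1 ⊗ₜ piLbar k A y) * Coalgebra.comul (R := k) h := by
  rw [← comulOne_mul_comul, ← mul_assoc, mem_mul_comulOne hy, mul_assoc]

lemma piR_mul_mem (h : A) {x : A} (hx : x ∈ LinearMap.range (piR k A)) :
    piR k A (h * x) = piR k A h * x := by
  have e : epsL k (h * x) = epsL k h ∘ₗ LinearMap.mulLeft k x := by ext; simp [mul_assoc]
  have e' : epsL k h ∘ₗ LinearMap.mulRight k (piL k A x) = epsL k h ∘ₗ LinearMap.mulRight k x := by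
    ext a
    have := LinearMap.congr_fun (epsR_piL (k := k) x) (h * a)
    simpa [mul_assoc] using this
  rw [piR_apply, e, ← sliceR_left', ← comul_of_mem hx, comul_of_mem' hx, sliceR_right', ← e',
    ← sliceR_right', comulOne_mul_mem hx, sliceR_right, piR_apply]

lemma piR_mul_piLbar (h : A) {y : A} (hy : y ∈ LinearMap.range (piR k A)) :
    piR k A (h * piLbar k A y) = y * piR k A h := by
  have e : epsL k (h * piLbar k A y) = epsL k h ∘ₗ LinearMap.mulLeft k (piLbar k A y) := by
    ext; simp [mul_assoc]
  rw [piR_apply, e, ← sliceR_left', ← mem_mul_comulOne hy, sliceR_left, piR_apply]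

lemma piRbar_mem_mul (h : A) {x : A} (hx : x ∈ LinearMap.range (piR k A)) :
    piRbar k A (x * h) = x * piRbar k A h := by
  have e : epsR k (x * h) = epsR k h ∘ₗ LinearMap.mulRight k x := by ext; simp [mul_assoc]
  have e' : epsR k h ∘ₗ LinearMap.mulLeft k (piLbar k A x) = epsR k h ∘ₗ LinearMap.mulLeft k x := by
    ext a
    have := LinearMap.congr_fun (epsL_piLbar (k := k) x) (a * h)
    simpa [mul_assoc] using this
  rw [piRbar_apply, e, ← sliceR_right', ← comul_of_mem' hx, comul_of_mem hx, sliceR_left', ← e',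
    ← sliceR_left', ← mem_mul_comulOne hx, sliceR_left, piRbar_apply]

lemma piRbar_piLbar_mul (h : A) (y : A) :
    piRbar k A (piLbar k A y * h) = piRbar k A h * nak k A y := by
  have e : epsR k (piLbar k A y * h) = epsR k h ∘ₗ LinearMap.mulRight k (piLbar k A y) := by
    ext; simp [mul_assoc]
  rw [nak_eq, piRbar_apply k (piLbar k A y * h), e, ← sliceR_right',
    (isLeftBase_piLbar y).comulOne_mul, sliceR_right, piRbar_apply k h]

end Basic

section Duoidal

variable (k : Type v) (A : Type u) [Field k] [Ring A] [Algebra k A] [Coalgebra k A]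
  [IsWeakBialgebra k A]

/-- The enveloping algebra `R ⊗ Rᵒᵖ` of the base algebra. -/
abbrev Env : Type u := baseAlgebra k A ⊗[k] (baseAlgebra k A)ᵐᵒᵖ

/-- The algebra homomorphism `Rᵒᵖ → A`, `q ↦ ⊓̄ᴸ(q)`. -/
def piLbarHom : (baseAlgebra k A)ᵐᵒᵖ →ₐ[k] A :=
  AlgHom.ofLinearMap
    (piLbar k A ∘ₗ (baseAlgebra k A).val.toLinearMap ∘ₗ
      (MulOpposite.opLinearEquiv k).symm.toLinearMap)
    piLbar_one
    (fun x y => piLbar_mul y.unop.2 x.unop.2)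

/-- The algebra homomorphism `η : R ⊗ Rᵒᵖ → A`, `p ⊗ q ↦ p ⊓̄ᴸ(q)`. -/
def unitHom : Env k A →ₐ[k] A :=
  Algebra.TensorProduct.lift (baseAlgebra k A).val (piLbarHom k A)
    (fun x y => (isLeftBase_piLbar (y.unop : A)).commute x.2)

lemma unitHom_tmul (p : baseAlgebra k A) (q : (baseAlgebra k A)ᵐᵒᵖ) :
    unitHom k A (p ⊗ₜ q) = (p : A) * piLbar k A (q.unop : A) := rfl

/-- The `•`-monoid `a` in `bim(R ⊗ Rᵒᵖ)`: the bimodule `A` with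
`(x ⊗ y) h (x' ⊗ y') = x ⊓̄ᴸ(y) h x' ⊓̄ᴸ(y')`, with the unit morphism `η` and the multiplication
induced by the multiplication of `A`. -/
abbrev monA : AlgBimod k (Env k A) := AlgBimod.ofAlgHom (unitHom k A)

variable {k A}

/-- `⊓ᴿ` with values in the base algebra. -/
def piRR : A →ₗ[k] baseAlgebra k A :=
  LinearMap.codRestrict (Subalgebra.toSubmodule (baseAlgebra k A)) (piR k A) (fun h => ⟨h, rfl⟩)

/-- `⊓̄ᴿ` with values in the base algebra. -/
def piRbarR : A →ₗ[k] baseAlgebra k A :=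
  LinearMap.codRestrict (Subalgebra.toSubmodule (baseAlgebra k A)) (piRbar k A) piRbar_mem

/-- `y ↦ Σ ψ(y fᵢ) eᵢ` as a map on the base algebra. -/
def nakR : baseAlgebra k A →ₗ[k] baseAlgebra k A :=
  LinearMap.codRestrict (Subalgebra.toSubmodule (baseAlgebra k A))
    (nak k A ∘ₗ (baseAlgebra k A).val.toLinearMap) (fun y => nak_mem (y : A))

/-- The Frobenius functional: the restriction of the counit to the base algebra. -/
def psi : baseAlgebra k A →ₗ[k] k :=
  Coalgebra.counit (R := k) ∘ₗ (baseAlgebra k A).val.toLinearMap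

@[simp] lemma coe_piRR (h : A) : ((piRR (k := k) h : baseAlgebra k A) : A) = piR k A h := rfl

@[simp] lemma coe_piRbarR (h : A) :
    ((piRbarR (k := k) h : baseAlgebra k A) : A) = piRbar k A h := rfl

@[simp] lemma coe_nakR (y : baseAlgebra k A) : ((nakR y : baseAlgebra k A) : A) = nak k A y := rfl

lemma psi_apply (r : baseAlgebra k A) : psi r = Coalgebra.counit (R := k) (r : A) := rfl

lemma nakR_one : nakR (1 : baseAlgebra k A) = 1 := Subtype.ext nak_one

lemma nakR_mul (r s : baseAlgebra k A) : nakR (r * s) = nakR r * nakR s :=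
  Subtype.ext (nak_mul r.2 s.2)

lemma psi_mul_nakR (y r : baseAlgebra k A) : psi (y * r) = psi (r * nakR y) :=
  counit_mul_nak (y : A) r.2

/-- The left action of `R ⊗ Rᵒᵖ` on `i`: `(x ⊗ y)(p ⊗ q) = p ⊗ x q Σ ψ(y fᵢ) eᵢ`. -/
def iL : Env k A →ₗ[k] (baseAlgebra k A ⊗[k] baseAlgebra k A) →ₗ[k]
    (baseAlgebra k A ⊗[k] baseAlgebra k A) :=
  TensorProduct.lift (LinearMap.mk₂ k
    (fun x y => LinearMap.lTensor (baseAlgebra k A)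
      (LinearMap.mulLeft k x ∘ₗ LinearMap.mulRight k (nakR (MulOpposite.unop y))))
    (fun _ _ _ => TensorProduct.ext' fun p q => by simp [add_mul, TensorProduct.tmul_add])
    (fun _ _ _ => TensorProduct.ext' fun p q => by simp)
    (fun _ _ _ => TensorProduct.ext' fun p q => by simp [mul_add, TensorProduct.tmul_add])
    (fun _ _ _ => TensorProduct.ext' fun p q => by simp))

/-- The right action of `R ⊗ Rᵒᵖ` on `i`: `(p ⊗ q)(x ⊗ y) = y p x ⊗ q`. -/
def iR : Env k A →ₗ[k] (baseAlgebra k A ⊗[k] baseAlgebra k A) →ₗ[k]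
    (baseAlgebra k A ⊗[k] baseAlgebra k A) :=
  TensorProduct.lift (LinearMap.mk₂ k
    (fun x y => LinearMap.rTensor (baseAlgebra k A)
      (LinearMap.mulLeft k (MulOpposite.unop y) ∘ₗ LinearMap.mulRight k x))
    (fun _ _ _ => TensorProduct.ext' fun p q => by simp [mul_add, TensorProduct.add_tmul])
    (fun _ _ _ => TensorProduct.ext' fun p q => by simp [TensorProduct.smul_tmul'])
    (fun _ _ _ => TensorProduct.ext' fun p q => by simp [add_mul, TensorProduct.add_tmul])
    (fun _ _ _ => TensorProduct.ext' fun p q => by simp [TensorProduct.smul_tmul']))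

@[simp] lemma iL_tmul (x p q : baseAlgebra k A) (y : (baseAlgebra k A)ᵐᵒᵖ) :
    iL (x ⊗ₜ y) (p ⊗ₜ q) = p ⊗ₜ[k] (x * q * nakR y.unop) := by
  simp [iL, mul_assoc]

@[simp] lemma iR_tmul (x p q : baseAlgebra k A) (y : (baseAlgebra k A)ᵐᵒᵖ) :
    iR (x ⊗ₜ y) (p ⊗ₜ q) = (y.unop * p * x) ⊗ₜ[k] q := by
  simp [iR, mul_assoc]

/-- Induction over two elements of `R ⊗ Rᵒᵖ`. -/
lemma env_ind₂ {P : Env k A → Env k A → Prop}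
    (h : ∀ x y x' y', P (x ⊗ₜ y) (x' ⊗ₜ y')) (hl0 : ∀ c, P 0 c) (hr0 : ∀ b, P b 0)
    (hl : ∀ b b' c, P b c → P b' c → P (b + b') c)
    (hr : ∀ b c c', P b c → P b c' → P b (c + c')) (b c : Env k A) : P b c := by
  induction b using TensorProduct.induction_on with
  | zero => exact hl0 c
  | tmul x y =>
    induction c using TensorProduct.induction_on with
    | zero => exact hr0 _
    | tmul x' y' => exact h x y x' y'
    | add c c' hc hc' => exact hr _ _ _ hc hc'
  | add b b' hb hb' => exact hl _ _ _ hb hb'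

lemma iL_mul (b c : Env k A) : iL (b * c) = iL b ∘ₗ iL c :=
  env_ind₂ (P := fun b c => iL (b * c) = iL b ∘ₗ iL c)
    (fun x y x' y' => TensorProduct.ext' fun p q => by simp [nakR_mul, mul_assoc])
    (fun c => by simp) (fun b => by simp)
    (fun b b' c h h' => by simp only [add_mul, map_add, h, h', LinearMap.add_comp])
    (fun b c c' h h' => by simp only [mul_add, map_add, h, h', LinearMap.comp_add]) b c

lemma iR_mul (b c : Env k A) : iR (b * c) = iR c ∘ₗ iR b :=
  env_ind₂ (P := fun b c => iR (b * c) = iR c ∘ₗ iR b)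
    (fun x y x' y' => TensorProduct.ext' fun p q => by simp [mul_assoc])
    (fun c => by simp) (fun b => by simp)
    (fun b b' c h h' => by simp only [add_mul, map_add, h, h', LinearMap.comp_add])
    (fun b c c' h h' => by simp only [mul_add, map_add, h, h', LinearMap.add_comp]) b c

lemma iL_iR (b c : Env k A) : iL b ∘ₗ iR c = iR c ∘ₗ iL b :=
  env_ind₂ (P := fun b c => iL b ∘ₗ iR c = iR c ∘ₗ iL b)
    (fun x y x' y' => TensorProduct.ext' fun p q => by simp)
    (fun c => by simp) (fun b => by simp)
    (fun b b' c h h' => by simp only [map_add, h, h', LinearMap.comp_add, LinearMap.add_comp])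
    (fun b c c' h h' => by simp only [map_add, h, h', LinearMap.comp_add, LinearMap.add_comp]) b c

lemma iL_one : iL (1 : Env k A) = LinearMap.id :=
  TensorProduct.ext' fun p q => by simp [Algebra.TensorProduct.one_def, nakR_one]

lemma iR_one : iR (1 : Env k A) = LinearMap.id :=
  TensorProduct.ext' fun p q => by simp [Algebra.TensorProduct.one_def]

variable (k A)

/-- The `∘`-monoidal unit `i` of `bim(R ⊗ Rᵒᵖ)`: the vector space `R ⊗ R` with the actions
`(x ⊗ y)(p ⊗ q)(x' ⊗ y') = y' p x' ⊗ x q Σ ψ(y fᵢ) eᵢ`. -/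
def unitI : AlgBimod k (Env k A) where
  carrier := baseAlgebra k A ⊗[k] baseAlgebra k A
  lact := iL
  ract := iR
  one_lact := LinearMap.congr_fun iL_one
  mul_lact := fun b c => LinearMap.congr_fun (iL_mul b c)
  ract_one := LinearMap.congr_fun iR_one
  ract_mul := fun b c => LinearMap.congr_fun (iR_mul b c)
  lact_ract := fun b c => LinearMap.congr_fun (iL_iR b c)

variable {k A}

/-- The map `h ↦ ⊓ᴿ(h₁) ⊗ ⊓̄ᴿ(h₂)`. -/
def epsFun : A →ₗ[k] baseAlgebra k A ⊗[k] baseAlgebra k A :=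
  TensorProduct.map piRR piRbarR ∘ₗ Coalgebra.comul (R := k)

lemma map_right_left {x : baseAlgebra k A} (z : A ⊗[k] A) :
    TensorProduct.map piRR piRbarR (z * ((x : A) ⊗ₜ[k] (1 : A))) =
      LinearMap.rTensor _ (LinearMap.mulRight k x) (TensorProduct.map (piRR (k := k)) piRbarR z) := by
  induction z using TensorProduct.induction_on with
  | zero => simp
  | tmul a b =>
    have : piRR (k := k) (a * (x : A)) = piRR a * x := Subtype.ext (piR_mul_mem a x.2)
    simp [this]
  | add a b ha hb => simp only [add_mul, map_add, ha, hb]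

lemma map_right_right {x : baseAlgebra k A} (z : A ⊗[k] A) :
    TensorProduct.map (piRR (k := k)) piRbarR (z * ((1 : A) ⊗ₜ[k] (x : A))) =
      TensorProduct.map piRR piRbarR (z * ((1 : A) ⊗ₜ[k] piL k A (x : A))) := by
  induction z using TensorProduct.induction_on with
  | zero => simp
  | tmul a b =>
    have : piRbarR (k := k) (b * piL k A (x : A)) = piRbarR (b * (x : A)) :=
      Subtype.ext (piRbar_mul_piL b (x : A))
    simp [this]
  | add a b ha hb => simp only [add_mul, map_add, ha, hb]

lemma map_right_piLbar {y : baseAlgebra k A} (z : A ⊗[k] A) :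
    TensorProduct.map piRR piRbarR (z * (piLbar k A (y : A) ⊗ₜ[k] (1 : A))) =
      LinearMap.rTensor _ (LinearMap.mulLeft k y) (TensorProduct.map (piRR (k := k)) piRbarR z) := by
  induction z using TensorProduct.induction_on with
  | zero => simp
  | tmul a b =>
    have : piRR (k := k) (a * piLbar k A (y : A)) = y * piRR a :=
      Subtype.ext (piR_mul_piLbar a y.2)
    simp [this]
  | add a b ha hb => simp only [add_mul, map_add, ha, hb]

lemma map_left_right {x : baseAlgebra k A} (z : A ⊗[k] A) :
    TensorProduct.map piRR piRbarR (((1 : A) ⊗ₜ[k] (x : A)) * z) =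
      LinearMap.lTensor _ (LinearMap.mulLeft k x) (TensorProduct.map (piRR (k := k)) piRbarR z) := by
  induction z using TensorProduct.induction_on with
  | zero => simp
  | tmul a b =>
    have : piRbarR (k := k) ((x : A) * b) = x * piRbarR b := Subtype.ext (piRbar_mem_mul b x.2)
    simp [this]
  | add a b ha hb => simp only [mul_add, map_add, ha, hb]

lemma map_left_piLbar {y : baseAlgebra k A} (z : A ⊗[k] A) :
    TensorProduct.map (piRR (k := k)) piRbarR ((piLbar k A (y : A) ⊗ₜ[k] (1 : A)) * z) =
      TensorProduct.map piRR piRbarR (((y : A) ⊗ₜ[k] (1 : A)) * z) := by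
  induction z using TensorProduct.induction_on with
  | zero => simp
  | tmul a b =>
    have : piRR (k := k) (piLbar k A (y : A) * a) = piRR ((y : A) * a) :=
      Subtype.ext (piR_piLbar_mul (y : A) a)
    simp [this]
  | add a b ha hb => simp only [mul_add, map_add, ha, hb]

lemma map_left_piLbar' {y : baseAlgebra k A} (z : A ⊗[k] A) :
    TensorProduct.map piRR piRbarR (((1 : A) ⊗ₜ[k] piLbar k A (y : A)) * z) =
      LinearMap.lTensor _ (LinearMap.mulRight k (nakR y))
        (TensorProduct.map (piRR (k := k)) piRbarR z) := by
  induction z using TensorProduct.induction_on with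
  | zero => simp
  | tmul a b =>
    have : piRbarR (k := k) (piLbar k A (y : A) * b) = piRbarR b * nakR y :=
      Subtype.ext (piRbar_piLbar_mul b (y : A))
    simp [this]
  | add a b ha hb => simp only [mul_add, map_add, ha, hb]

lemma epsFun_mem_mul (x : baseAlgebra k A) (h : A) :
    epsFun (k := k) ((x : A) * h) =
      LinearMap.lTensor _ (LinearMap.mulLeft k x) (epsFun (k := k) h) := by
  simp only [epsFun, LinearMap.comp_apply]
  rw [comul_mem_mul x.2, map_left_right]

lemma epsFun_piLbar_mul (y : baseAlgebra k A) (h : A) :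
    epsFun (k := k) (piLbar k A (y : A) * h) =
      LinearMap.lTensor _ (LinearMap.mulRight k (nakR y)) (epsFun (k := k) h) := by
  simp only [epsFun, LinearMap.comp_apply]
  rw [(isLeftBase_piLbar (y : A)).comul_mul, map_left_piLbar, mem_mul_comul y.2, map_left_piLbar']

lemma epsFun_mul_mem (x : baseAlgebra k A) (h : A) :
    epsFun (k := k) (h * (x : A)) =
      LinearMap.rTensor _ (LinearMap.mulRight k x) (epsFun (k := k) h) := by
  simp only [epsFun, LinearMap.comp_apply]
  rw [comul_mul_mem x.2, map_right_right, comul_mul_piL h x.2, map_right_left]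

lemma epsFun_mul_piLbar (y : baseAlgebra k A) (h : A) :
    epsFun (k := k) (h * piLbar k A (y : A)) =
      LinearMap.rTensor _ (LinearMap.mulLeft k y) (epsFun (k := k) h) := by
  simp only [epsFun, LinearMap.comp_apply]
  rw [(isLeftBase_piLbar (y : A)).mul_comul, map_right_piLbar]

lemma epsFun_lact (b : Env k A) (h : A) :
    epsFun (k := k) (unitHom k A b * h) = iL b (epsFun (k := k) h) := by
  induction b using TensorProduct.induction_on with
  | zero => simp
  | tmul x y =>
    rw [unitHom_tmul, mul_assoc, epsFun_mem_mul, epsFun_piLbar_mul, ← LinearMap.comp_apply,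
      ← LinearMap.lTensor_comp]
    simp [iL]
  | add b c hb hc => simp only [map_add, add_mul, hb, hc, LinearMap.add_apply]

lemma epsFun_ract (b : Env k A) (h : A) :
    epsFun (k := k) (h * unitHom k A b) = iR b (epsFun (k := k) h) := by
  induction b using TensorProduct.induction_on with
  | zero => simp
  | tmul x y =>
    rw [unitHom_tmul, ← mul_assoc, epsFun_mul_piLbar, epsFun_mul_mem, ← LinearMap.comp_apply,
      ← LinearMap.rTensor_comp]
    simp [iR]
  | add b c hb hc => simp only [map_add, mul_add, hb, hc, LinearMap.add_apply]

variable (k A)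

/-- The counit `ε : a ⟶ i` of the `∘`-comonoid `a`, `h ↦ ⊓ᴿ(h₁) ⊗ ⊓̄ᴿ(h₂)`. -/
def epsHom : monA k A ⟶ unitI k A := 
  ⟨epsFun (k := k) (A := A), fun (b : Env k A) (h : A) => epsFun_lact b h,
    fun (b : Env k A) (h : A) => epsFun_ract b h⟩

/-- The bilinear map `(p ⊗ q, p' ⊗ q') ↦ ψ(p q') p' ⊗ q`. -/
def xiFun : (baseAlgebra k A ⊗[k] baseAlgebra k A) →ₗ[k]
    (baseAlgebra k A ⊗[k] baseAlgebra k A) →ₗ[k] (baseAlgebra k A ⊗[k] baseAlgebra k A) :=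
  TensorProduct.lift (LinearMap.mk₂ k
    (fun p q => LinearMap.lTensor (baseAlgebra k A)
      ((psi ∘ₗ LinearMap.mulLeft k p).smulRight q))
    (fun _ _ _ => TensorProduct.ext' fun p q => by
      simp [add_mul, add_smul, TensorProduct.tmul_add])
    (fun _ _ _ => TensorProduct.ext' fun p q => by simp [mul_smul])
    (fun _ _ _ => TensorProduct.ext' fun p q => by simp [TensorProduct.tmul_add])
    (fun c _ _ => TensorProduct.ext' fun p q => by simp [smul_comm _ c]))

variable {k A}

@[simp] lemma xiFun_tmul (p q p' q' : baseAlgebra k A) :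
    xiFun k A (p ⊗ₜ q) (p' ⊗ₜ q') = psi (p * q') • (p' ⊗ₜ[k] q) := by
  simp [xiFun]

lemma rr_ext₂ {P : Type*} [AddCommGroup P] [Module k P]
    {f g : (baseAlgebra k A ⊗[k] baseAlgebra k A) →ₗ[k]
      (baseAlgebra k A ⊗[k] baseAlgebra k A) →ₗ[k] P}
    (h : ∀ p q p' q', f (p ⊗ₜ q) (p' ⊗ₜ q') = g (p ⊗ₜ q) (p' ⊗ₜ q')) : f = g :=
  TensorProduct.ext' fun p q => TensorProduct.ext' fun p' q' => h p q p' q'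

lemma xiFun_bal (b : Env k A) :
    xiFun k A ∘ₗ iR b = (xiFun k A).compl₂ (iL b) := by
  induction b using TensorProduct.induction_on with
  | zero => ext; simp
  | tmul x y =>
    refine rr_ext₂ fun p q p' q' => ?_
    have : psi (y.unop * p * x * q') = psi (p * (x * q' * nakR y.unop)) := by
      rw [mul_assoc, mul_assoc, psi_mul_nakR]; simp only [mul_assoc]
    simp [this]
  | add b c hb hc =>
    rw [map_add, map_add, LinearMap.comp_add, hb, hc]
    ext; simp

lemma xiFun_lact (b : Env k A) : xiFun k A ∘ₗ iL b = (xiFun k A).compr₂ (iL b) := by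
  induction b using TensorProduct.induction_on with
  | zero => ext; simp
  | tmul x y => exact rr_ext₂ fun p q p' q' => by simp
  | add b c hb hc =>
    rw [map_add, LinearMap.comp_add, hb, hc]
    ext; simp

lemma xiFun_ract (b : Env k A) : (xiFun k A).compl₂ (iR b) = (xiFun k A).compr₂ (iR b) := by
  induction b using TensorProduct.induction_on with
  | zero => ext; simp
  | tmul x y => exact rr_ext₂ fun p q p' q' => by simp
  | add b c hb hc =>
    have h1 : (xiFun k A).compl₂ (iR b + iR c) =
        (xiFun k A).compl₂ (iR b) + (xiFun k A).compl₂ (iR c) := by ext; simp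
    rw [map_add, h1, hb, hc]
    ext; simp

variable (k A)

/-- The structure morphism `ξ₀ : i • i ⟶ i` of the duoidal category `bim(R ⊗ Rᵒᵖ)`,
`(p ⊗ q) • (p' ⊗ q') ↦ ψ(p q') p' ⊗ q`. -/
def xiZero : unitI k A ⊗ unitI k A ⟶ unitI k A :=
  AlgBimod.tensorDesc (M := unitI k A) (N := unitI k A) (P := unitI k A) (xiFun k A)
    (fun m b n => LinearMap.congr_fun₂ (xiFun_bal b) m n)
    (fun b m n => LinearMap.congr_fun₂ (xiFun_lact b) m n)
    (fun b m n => LinearMap.congr_fun₂ (xiFun_ract b) m n)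

/-- The structure morphism `ξ₀⁰ : j ⟶ i`, equal to `ε ∘ η`. -/
def xiZeroZero : 𝟙_ (AlgBimod k (Env k A)) ⟶ unitI k A :=
  AlgBimod.ofAlgHomUnit (unitHom k A) ≫ epsHom k A

variable {k A}

open AlgBimod in
lemma lin_xiZero (m n : (unitI k A).carrier) :
    lin (xiZero k A) (tmul m n) = xiFun k A m n :=
  lin_tensorDesc (M := unitI k A) (N := unitI k A) (P := unitI k A) (xiFun k A) _ _ _ m n

lemma psi_piRR (h : A) (r : baseAlgebra k A) :
    psi (piRR h * r) = Coalgebra.counit (R := k) (h * (r : A)) :=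
  LinearMap.congr_fun (epsL_piR (k := k) h) (r : A)

lemma psi_piRbarR (h : A) (r : baseAlgebra k A) :
    psi (r * piRbarR h) = Coalgebra.counit (R := k) ((r : A) * h) :=
  LinearMap.congr_fun (epsR_piRbar (k := k) h) (r : A)

lemma xi_left (z : A ⊗[k] A) (p q : baseAlgebra k A) :
    xiFun k A (TensorProduct.map piRR piRbarR z) (p ⊗ₜ q) =
      p ⊗ₜ[k] piRbarR (sliceL (Coalgebra.counit (R := k)) (z * ((q : A) ⊗ₜ 1))) := by
  induction z using TensorProduct.induction_on with
  | zero => simp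
  | tmul a b => simp [psi_piRR]
  | add a b ha hb => simp only [add_mul, map_add, LinearMap.add_apply, ha, hb,
      TensorProduct.tmul_add]

lemma xi_right (z : A ⊗[k] A) (p q : baseAlgebra k A) :
    xiFun k A (p ⊗ₜ q) (TensorProduct.map piRR piRbarR z) =
      piRR (sliceR (Coalgebra.counit (R := k)) (((1 : A) ⊗ₜ (p : A)) * z)) ⊗ₜ[k] q := by
  induction z using TensorProduct.induction_on with
  | zero => simp
  | tmul a b => simp [psi_piRbarR, TensorProduct.smul_tmul']
  | add a b ha hb => simp only [mul_add, map_add, ha, hb, TensorProduct.add_tmul]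

lemma xi_one_left (m : baseAlgebra k A ⊗[k] baseAlgebra k A) :
    xiFun k A (epsFun 1) m = m := by
  induction m using TensorProduct.induction_on with
  | zero => simp
  | tmul p q =>
    refine (xi_left _ p q).trans ?_
    congr 1
    apply Subtype.ext
    have h := comulOne_mul_mem (k := k) q.2
    have h2 : sliceL (Coalgebra.counit (R := k))
        (comulOne k A * ((1 : A) ⊗ₜ[k] piL k A (q : A))) = piL k A (q : A) := by
      rw [sliceL_right, comulOne, sliceL_counit, one_mul]
    rw [h] at h2
    have h3 := piRbar_mul_piL (k := k) 1 (q : A)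
    rw [one_mul, one_mul, piRbar_of_mem q.2] at h3
    rw [coe_piRbarR]
    exact (congrArg (piRbar k A) h2).trans h3
  | add a b ha hb => rw [map_add, ha, hb]

lemma xi_one_right (m : baseAlgebra k A ⊗[k] baseAlgebra k A) :
    xiFun k A m (epsFun 1) = m := by
  induction m using TensorProduct.induction_on with
  | zero => simp
  | tmul p q =>
    refine (xi_right _ p q).trans ?_
    congr 1
    apply Subtype.ext
    rw [coe_piRR]
    have h2 : sliceR (Coalgebra.counit (R := k)) (((1 : A) ⊗ₜ[k] (p : A)) * comulOne k A) =
        (p : A) := by rw [← comul_of_mem p.2, sliceR_counit]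
    exact (congrArg (piR k A) h2).trans (piR_of_mem p.2)
  | add a b ha hb => rw [map_add, LinearMap.add_apply, ha, hb]

lemma xi_assoc (l m n : baseAlgebra k A ⊗[k] baseAlgebra k A) :
    xiFun k A (xiFun k A l m) n = xiFun k A l (xiFun k A m n) := by
  induction l using TensorProduct.induction_on with
  | zero => simp
  | tmul p q =>
    induction m using TensorProduct.induction_on with
    | zero => simp
    | tmul p' q' =>
      induction n using TensorProduct.induction_on with
      | zero => simp
      | tmul p'' q'' => simp [smul_smul, mul_comm]
      | add a b ha hb => simp only [map_add, ha, hb]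
    | add a b ha hb => simp only [map_add, LinearMap.add_apply, ha, hb]
  | add a b ha hb => simp only [map_add, LinearMap.add_apply, ha, hb]

open AlgBimod in
/-- The `∘`-monoidal unit `i` is a `•`-monoid with multiplication `ξ₀` and unit `ξ₀⁰`. -/
instance : MonObj (unitI k A) where
  one := xiZeroZero k A
  mul := xiZero k A
  one_mul := tensor_ext fun b m => by
    rw [lin_comp, LinearMap.comp_apply, lin_whiskerRight, lin_leftUnitor, lin_xiZero]
    have h : lin (xiZeroZero k A) b = iL (show Env k A from b) (epsFun (k := k) 1) := by
      rw [← epsFun_lact, mul_one]; rfl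
    rw [h]
    refine (LinearMap.congr_fun₂ (xiFun_lact (show Env k A from b)) (epsFun 1) m).trans ?_
    exact congrArg (iL (show Env k A from b)) (xi_one_left m)
  mul_one := tensor_ext fun m b => by
    rw [lin_comp, LinearMap.comp_apply, lin_whiskerLeft, lin_rightUnitor, lin_xiZero]
    have h : lin (xiZeroZero k A) b = iR (show Env k A from b) (epsFun (k := k) 1) := by
      rw [← epsFun_ract, one_mul]; rfl
    rw [h]
    refine (LinearMap.congr_fun₂ (xiFun_ract (show Env k A from b)) m (epsFun 1)).trans ?_
    exact congrArg (iR (show Env k A from b)) (xi_one_right m)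
  mul_assoc := tensor_ext₃ fun l m n => by
    simp only [lin_comp, LinearMap.comp_apply, lin_whiskerRight, lin_whiskerLeft,
      lin_associator_hom, lin_xiZero]
    exact xi_assoc l m n

end Duoidal

end WeakBialg

/-- A weak Hopf algebra: a weak bialgebra admitting a linear map `σ : A → A` (an antipode) with
`h₁ σ(h₂) = ⊓ᴸ(h)` and `σ(h₁) h₂ = ⊓ᴿ(h)`. (If such a `σ` exists, then there is a unique one
satisfying `σ(h₁) h₂ σ(h₃) = σ(h)` in addition, namely `h ↦ σ(h₁) h₂ σ(h₃)`.) -/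
class IsWeakHopfAlgebra (k : Type v) (A : Type u) [Field k] [Ring A] [Algebra k A]
    [Coalgebra k A] : Prop extends IsWeakBialgebra k A where
  exists_antipode : ∃ σ : A →ₗ[k] A,
    LinearMap.mul' k A ∘ₗ LinearMap.lTensor A σ ∘ₗ Coalgebra.comul (R := k) = WeakBialg.piL k A ∧
    LinearMap.mul' k A ∘ₗ LinearMap.rTensor A σ ∘ₗ Coalgebra.comul (R := k) = WeakBialg.piR k A

/-- `t` is a normalized left integral of a weak Hopf algebra: `h t = ⊓ᴸ(h) t` for all `h`, and
`⊓̄ᴿ(t) = 1`. -/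
structure IsNormalizedLeftInt (k : Type v) {A : Type u} [Field k] [Ring A] [Algebra k A]
    [Coalgebra k A] (t : A) : Prop where
  mul_left : ∀ h : A, h * t = WeakBialg.piL k A h * t
  normalized : WeakBialg.piRbar k A t = 1

/-- `t` is a normalized right integral of a weak Hopf algebra: `t h = t ⊓ᴿ(h)` for all `h`, and
`⊓ᴿ(t) = 1`. -/
structure IsNormalizedRightInt (k : Type v) {A : Type u} [Field k] [Ring A] [Algebra k A]
    [Coalgebra k A] (t : A) : Prop where
  mul_right : ∀ h : A, t * h = t * WeakBialg.piR k A h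
  normalized : WeakBialg.piR k A t = 1

/-!
Two constructions carry the equivalences.

*Maschke's theorem.* A bimodule section of the multiplication is a Casimir element `Σ xⱼ ⊗ yⱼ` with
product `1`; then `Σ ⊓ᴿ(xⱼ) yⱼ` is a normalized right integral. Conversely, a normalized left
integral `t` gives the Casimir element `Σ t₁ eᵢ ⊗ fᵢ σ(t₂)`. Its Casimir property is verified after
applying the Galois map `a ⊗ b ↦ a₁ ⊗ a₂ b`, which the map `a ⊗ b ↦ a₁ ⊗ σ(a₂) b` inverts up to the
idempotents `a ⊗ b ↦ Σ a eᵢ ⊗ fᵢ b` and `a ⊗ b ↦ 1₁ a ⊗ 1₂ b`. This uses only the identities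
`h₁ σ(h₂) = ⊓ᴸ(h)` and `σ(h₁) h₂ = ⊓ᴿ(h)`, and no anti-multiplicativity of `σ`
(`IsNormalizedLeftInt.isSeparableAlg`, `IsNormalizedRightInt.isSeparableAlg`).

*Passing between `A` and `bim(R ⊗ Rᵒᵖ)`.* A Casimir element of `A` projects to a section of
`μ : a • a → a`, and a section of `μ` yields a left integral through the balanced map
`a ⊗ c ↦ Σ a eᵢ ⊓ᴸ(fᵢ c)`. As `R` is Frobenius, `i` with the multiplication `ξ₀` is the algebra of
`k`-linear endomorphisms of `R`, so a right `i`-linear map `i → a • i` amounts to a map from `R` to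
the quotient of `A` by the left ideal generated by the elements `⊓̄ᴸ(y) - ν(y)`, where `ν = ⊓̄ᴿ ⊓̄ᴸ`
is the Nakayama automorphism. Left `a`-linearity forces it to be `q ↦ q t` for the class of an
integral `t`. Right multiplication by `⊓ᴸ(1₁) ⊓̄ᴿ(1₂)` (`leftAvg`) splits the quotient map: it lifts
the class of `t` to an integral in `A`, and turns any normalized left integral into one with
`t ⊓ᴸ(x) = t ν(x)`. The element `⊓̄ᴸ(1₁) ⊓ᴿ(1₂)` (`rightAvg`) plays this role for right integrals.
-/

namespace WeakBialg

/-! ### Further identities in weak bialgebras -/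

section Identities

variable {k : Type v} {A : Type u} [Field k] [Ring A] [Algebra k A] [Coalgebra k A]

lemma lTensor_piLbar (z : A ⊗[k] A) :
    LinearMap.lTensor A (piLbar k A) z = slice2 (Coalgebra.counit (R := k))
      ((z ⊗ₜ 1) * (TensorProduct.assoc k A A A).symm (1 ⊗ₜ comulOne k A)) := by
  induction z using TensorProduct.induction_on with
  | zero => simp
  | tmul x y =>
    rw [LinearMap.lTensor_tmul, piLbar_apply]
    induction comulOne k A using TensorProduct.induction_on with
    | zero => simp
    | tmul c d => simp [slice2, TensorProduct.smul_tmul]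
    | add c d hc hd => simp only [TensorProduct.tmul_add, mul_add, map_add, hc, hd]
  | add x y hx hy => simp only [TensorProduct.add_tmul, add_mul, map_add, hx, hy]

lemma lTensor_piL (z : A ⊗[k] A) :
    LinearMap.lTensor A (piL k A) z = slice2 (Coalgebra.counit (R := k))
      ((TensorProduct.assoc k A A A).symm (1 ⊗ₜ comulOne k A) * (z ⊗ₜ 1)) := by
  induction z using TensorProduct.induction_on with
  | zero => simp
  | tmul x y =>
    rw [LinearMap.lTensor_tmul, piL_apply]
    induction comulOne k A using TensorProduct.induction_on with
    | zero => simp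
    | tmul c d => simp [slice2, TensorProduct.smul_tmul]
    | add c d hc hd => simp only [TensorProduct.tmul_add, add_mul, map_add, hc, hd]
  | add x y hx hy => simp only [TensorProduct.add_tmul, mul_add, map_add, hx, hy]

lemma rTensor_piRbar (z : A ⊗[k] A) :
    LinearMap.rTensor A (piRbar k A) z = slice2 (Coalgebra.counit (R := k))
      ((comulOne k A ⊗ₜ 1) * (TensorProduct.assoc k A A A).symm (1 ⊗ₜ z)) := by
  induction z using TensorProduct.induction_on with
  | zero => simp
  | tmul x y =>
    rw [LinearMap.rTensor_tmul, piRbar_apply]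
    induction comulOne k A using TensorProduct.induction_on with
    | zero => simp
    | tmul c d => simp [slice2]
    | add c d hc hd => simp only [TensorProduct.add_tmul, add_mul, map_add, hc, hd]
  | add x y hx hy => simp only [TensorProduct.tmul_add, mul_add, map_add, hx, hy]

lemma rTensor_piR (z : A ⊗[k] A) :
    LinearMap.rTensor A (piR k A) z = slice2 (Coalgebra.counit (R := k))
      ((TensorProduct.assoc k A A A).symm (1 ⊗ₜ z) * (comulOne k A ⊗ₜ 1)) := by
  induction z using TensorProduct.induction_on with
  | zero => simp
  | tmul x y =>
    rw [LinearMap.rTensor_tmul, piR_apply]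
    induction comulOne k A using TensorProduct.induction_on with
    | zero => simp
    | tmul c d => simp [slice2]
    | add c d hc hd => simp only [TensorProduct.add_tmul, mul_add, map_add, hc, hd]
  | add x y hx hy => simp only [TensorProduct.tmul_add, add_mul, map_add, hx, hy]

variable [IsWeakBialgebra k A]

lemma rTensor_comul_tmul_mul (a : A) (z : A ⊗[k] A) :
    LinearMap.rTensor A (Coalgebra.comul (R := k)) ((a ⊗ₜ 1) * z) =
      (Coalgebra.comul (R := k) a ⊗ₜ 1) * LinearMap.rTensor A (Coalgebra.comul (R := k)) z := by
  induction z using TensorProduct.induction_on with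
  | zero => simp
  | tmul x y => simp [IsWeakBialgebra.comul_mul]
  | add x y hx hy => simp only [mul_add, map_add, hx, hy]

lemma rTensor_comul_mul_tmul (a : A) (z : A ⊗[k] A) :
    LinearMap.rTensor A (Coalgebra.comul (R := k)) (z * (a ⊗ₜ 1)) =
      LinearMap.rTensor A (Coalgebra.comul (R := k)) z * (Coalgebra.comul (R := k) a ⊗ₜ 1) := by
  induction z using TensorProduct.induction_on with
  | zero => simp
  | tmul x y => simp [IsWeakBialgebra.comul_mul]
  | add x y hx hy => simp only [add_mul, map_add, hx, hy]

lemma comulSnd_mul_tmul (a : A) (z : A ⊗[k] A) :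
    comulSnd (z * (1 ⊗ₜ a)) =
      comulSnd z * (TensorProduct.assoc k A A A).symm (1 ⊗ₜ Coalgebra.comul (R := k) a) := by
  unfold comulSnd
  rw [← assoc_symm_mul]
  congr 1
  induction z using TensorProduct.induction_on with
  | zero => simp
  | tmul x y => simp [IsWeakBialgebra.comul_mul]
  | add x y hx hy => simp only [add_mul, map_add, hx, hy]

lemma comulSnd_tmul_mul (a : A) (z : A ⊗[k] A) :
    comulSnd ((1 ⊗ₜ a) * z) =
      (TensorProduct.assoc k A A A).symm (1 ⊗ₜ Coalgebra.comul (R := k) a) * comulSnd z := by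
  unfold comulSnd
  rw [← assoc_symm_mul]
  congr 1
  induction z using TensorProduct.induction_on with
  | zero => simp
  | tmul x y => simp [IsWeakBialgebra.comul_mul]
  | add x y hx hy => simp only [mul_add, map_add, hx, hy]

/-- `h₁ ⊗ ⊓̄ᴸ(h₂) = h 1₁ ⊗ 1₂`. -/
lemma lTensor_piLbar_comul (h : A) :
    LinearMap.lTensor A (piLbar k A) (Coalgebra.comul (R := k) h) =
      (h ⊗ₜ 1) * comulOne k A := by
  have e : (Coalgebra.comul (R := k) h ⊗ₜ[k] (1 : A)) =
      (Coalgebra.comul (R := k) h ⊗ₜ 1) * (comulOne k A ⊗ₜ 1) := by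
    rw [Algebra.TensorProduct.tmul_mul_tmul, comul_mul_comulOne, one_mul]
  rw [← slice2_rTensor_comul (k := k) ((h ⊗ₜ[k] (1 : A)) * comulOne k A), lTensor_piLbar, e,
    mul_assoc, rTensor_comul_tmul_mul]
  exact congrArg (fun w => slice2 _ (_ * w)) IsWeakBialgebra.comul_comul_one.symm

/-- `h₁ ⊗ ⊓ᴸ(h₂) = 1₁ h ⊗ 1₂`. -/
lemma lTensor_piL_comul (h : A) :
    LinearMap.lTensor A (piL k A) (Coalgebra.comul (R := k) h) =
      comulOne k A * (h ⊗ₜ 1) := by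
  have e : (Coalgebra.comul (R := k) h ⊗ₜ[k] (1 : A)) =
      (comulOne k A ⊗ₜ 1) * (Coalgebra.comul (R := k) h ⊗ₜ 1) := by
    rw [Algebra.TensorProduct.tmul_mul_tmul, comulOne_mul_comul, one_mul]
  rw [← slice2_rTensor_comul (k := k) (comulOne k A * (h ⊗ₜ[k] (1 : A))), lTensor_piL, e,
    ← mul_assoc, rTensor_comul_mul_tmul]
  exact congrArg (fun w => slice2 _ (w * _)) IsWeakBialgebra.comul_comul_one'.symm

/-- `⊓̄ᴿ(h₁) ⊗ h₂ = 1₁ ⊗ 1₂ h`. -/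
lemma rTensor_piRbar_comul (h : A) :
    LinearMap.rTensor A (piRbar k A) (Coalgebra.comul (R := k) h) =
      comulOne k A * (1 ⊗ₜ h) := by
  have e : ((1 : A) ⊗ₜ[k] Coalgebra.comul (R := k) h) =
      (1 ⊗ₜ comulOne k A) * (1 ⊗ₜ Coalgebra.comul (R := k) h) := by
    rw [Algebra.TensorProduct.tmul_mul_tmul, comulOne_mul_comul, one_mul]
  rw [← slice2_comulSnd (k := k) (comulOne k A * ((1 : A) ⊗ₜ[k] h)), rTensor_piRbar, e,
    assoc_symm_mul, ← mul_assoc, comulSnd_mul_tmul, comulSnd, lTensor_comul_comulOne]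
  exact congrArg (fun w => slice2 _ (w * _)) IsWeakBialgebra.comul_comul_one.symm

/-- `⊓ᴿ(h₁) ⊗ h₂ = 1₁ ⊗ h 1₂`. -/
lemma rTensor_piR_comul (h : A) :
    LinearMap.rTensor A (piR k A) (Coalgebra.comul (R := k) h) =
      (1 ⊗ₜ h) * comulOne k A := by
  have e : ((1 : A) ⊗ₜ[k] Coalgebra.comul (R := k) h) =
      (1 ⊗ₜ Coalgebra.comul (R := k) h) * (1 ⊗ₜ comulOne k A) := by
    rw [Algebra.TensorProduct.tmul_mul_tmul, comul_mul_comulOne, one_mul]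
  rw [← slice2_comulSnd (k := k) (((1 : A) ⊗ₜ[k] h) * comulOne k A), rTensor_piR, e,
    assoc_symm_mul, mul_assoc, comulSnd_tmul_mul, comulSnd, lTensor_comul_comulOne]
  exact congrArg (fun w => slice2 _ (_ * w)) IsWeakBialgebra.comul_comul_one'.symm

/-- Since `Δ(1)` lies in the tensor product of the images of `⊓̄ᴿ` and `⊓̄ᴸ`, linear maps agree on
it as soon as they agree on the tensors `r ⊗ l` with `r` and `l` in those images. -/
lemma comulOne_ext {P : Type*} [AddCommGroup P] [Module k P] {f g : A ⊗[k] A →ₗ[k] P}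
    (h : ∀ r l : A, r ∈ LinearMap.range (piR k A) → IsLeftBase k l → f (r ⊗ₜ l) = g (r ⊗ₜ l)) :
    f (comulOne k A) = g (comulOne k A) := by
  have e : TensorProduct.map (piRbar k A) (piLbar k A) (comulOne k A) = comulOne k A := by
    have h1 := lTensor_piLbar_comul (k := k) (1 : A)
    have h2 := rTensor_piRbar_comul (k := k) (1 : A)
    rw [← Algebra.TensorProduct.one_def, one_mul] at h1
    rw [← Algebra.TensorProduct.one_def, mul_one] at h2
    rw [← LinearMap.rTensor_comp_lTensor, LinearMap.comp_apply]
    exact (congrArg _ h1).trans h2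
  have e' : f ∘ₗ TensorProduct.map (piRbar k A) (piLbar k A) =
      g ∘ₗ TensorProduct.map (piRbar k A) (piLbar k A) :=
    TensorProduct.ext' fun a b => h _ _ (piRbar_mem a) (isLeftBase_piLbar b)
  rw [← e]
  exact LinearMap.congr_fun e' _

lemma piL_congr {a b : A} (h : epsR k a = epsR k b) : piL k A a = piL k A b := by
  rw [piL_apply, piL_apply, h]

lemma piLbar_congr {a b : A} (h : epsL k a = epsL k b) : piLbar k A a = piLbar k A b := by
  rw [piLbar_apply, piLbar_apply, h]

lemma piL_piRbar (h : A) : piL k A (piRbar k A h) = piL k A h := piL_congr (epsR_piRbar h)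

lemma piRbar_piL (h : A) : piRbar k A (piL k A h) = piRbar k A h := piRbar_congr (epsR_piL h)

lemma piR_piLbar (h : A) : piR k A (piLbar k A h) = piR k A h := piR_congr (epsL_piLbar h)

lemma piLbar_piR (h : A) : piLbar k A (piR k A h) = piLbar k A h := piLbar_congr (epsL_piR h)

lemma piL_mul_piL (h x : A) : piL k A (h * piL k A x) = piL k A (h * x) := by
  rw [← piL_piRbar, piRbar_mul_piL, piL_piRbar]

lemma piR_piR_mul (h x : A) : piR k A (piR k A h * x) = piR k A (h * x) := by
  rw [← piR_piLbar_mul, piLbar_piR, piR_piLbar_mul]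

lemma IsLeftBase.piLbar_eq {l : A} (hl : IsLeftBase k l) : piLbar k A l = l := by
  rw [WeakBialg.piLbar_eq, ← hl.1, sliceL_counit]

lemma IsLeftBase.piL_eq {l : A} (hl : IsLeftBase k l) : piL k A l = l := by
  conv_rhs => rw [← sliceL_counit (k := k) l, hl.2, sliceL_right']
  rw [piL_apply]; rfl

lemma piL_one : piL k A 1 = 1 := by
  have h := (isLeftBase_piLbar (k := k) (1 : A)).piL_eq
  rwa [piLbar_one] at h

lemma piR_one : piR k A 1 = 1 := by
  have h := piR_of_mem (piRbar_mem (k := k) (1 : A))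
  rwa [piRbar_one] at h

lemma IsLeftBase.piL_mul {l : A} (hl : IsLeftBase k l) (h : A) :
    piL k A (l * h) = l * piL k A h := by
  have e : epsR k (l * h) = epsR k h ∘ₗ LinearMap.mulRight k l := by ext; simp [mul_assoc]
  have e' : epsR k h ∘ₗ LinearMap.mulLeft k l = epsR k h ∘ₗ LinearMap.mulLeft k (piR k A l) := by
    ext a
    have := LinearMap.congr_fun (epsL_piR (k := k) l) (a * h)
    simpa [mul_assoc] using this.symm
  rw [piL_apply, e, ← sliceL_right', ← hl.2, hl.1, sliceL_left', e', ← sliceL_left',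
    mem_mul_comulOne ⟨l, rfl⟩, piLbar_piR, hl.piLbar_eq, sliceL_left, piL_apply]

/-- `⊓ᴸ` is anti-multiplicative on the base algebra. -/
lemma piL_mul {r : A} (hr : r ∈ LinearMap.range (piR k A)) (s : A) :
    piL k A (r * s) = piL k A s * piL k A r := by
  have e : ∀ x : A, piL k A x = sliceL (Coalgebra.counit (R := k)) (comulOne k A * (x ⊗ₜ 1)) :=
    fun x => by rw [sliceL_right', piL_apply]; rfl
  have e1 : ((r * s) ⊗ₜ[k] (1 : A)) = (r ⊗ₜ 1) * (s ⊗ₜ 1) := by simp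
  have e2 : ((1 : A) ⊗ₜ[k] piL k A r) * (s ⊗ₜ 1) = (s ⊗ₜ 1) * (1 ⊗ₜ piL k A r) := by simp
  rw [e (r * s), e1, ← mul_assoc, ← comulOne_mul_mem hr, mul_assoc, e2, ← mul_assoc, sliceL_right,
    ← e]

/-- `⊓ᴿ` is anti-multiplicative on the image of `⊓ᴸ`, in the form `⊓ᴿ(⊓̄ᴸ(r) l) = ⊓ᴿ(l) r`. -/
lemma IsLeftBase.piR_piLbar_mul {r l : A} (hr : r ∈ LinearMap.range (piR k A))
    (hl : IsLeftBase k l) : piR k A (piLbar k A r * l) = piR k A l * r := by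
  have h := piR_mul_piLbar (k := k) (piLbar k A r) (y := piR k A l) ⟨l, rfl⟩
  rwa [piLbar_piR, hl.piLbar_eq, piR_piLbar, piR_of_mem hr] at h

/-- `h₁ ⊓ᴿ(h₂) = h`. -/
lemma mul_lTensor_piR_comul (h : A) :
    LinearMap.mul' k A (LinearMap.lTensor A (piR k A) (Coalgebra.comul (R := k) h)) = h := by
  have e : ∀ z : A ⊗[k] A, LinearMap.mul' k A (LinearMap.lTensor A (piR k A) z) =
      sliceR (Coalgebra.counit (R := k)) (z * comulOne k A) := fun z => by
    induction z using TensorProduct.induction_on with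
    | zero => simp
    | tmul x y =>
      have : x ⊗ₜ[k] y = (x ⊗ₜ 1) * (1 ⊗ₜ y) := by simp
      rw [LinearMap.lTensor_tmul, LinearMap.mul'_apply, this, mul_assoc, sliceR_left, sliceR_left',
        piR_apply]
      rfl
    | add x y hx hy => simp only [map_add, add_mul, hx, hy]
  rw [e, comul_mul_comulOne, sliceR_counit]

/-- `⊓ᴸ(h₁) h₂ = h`. -/
lemma mul_rTensor_piL_comul (h : A) :
    LinearMap.mul' k A (LinearMap.rTensor A (piL k A) (Coalgebra.comul (R := k) h)) = h := by
  have e : ∀ z : A ⊗[k] A, LinearMap.mul' k A (LinearMap.rTensor A (piL k A) z) =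
      sliceL (Coalgebra.counit (R := k)) (comulOne k A * z) := fun z => by
    induction z using TensorProduct.induction_on with
    | zero => simp
    | tmul x y =>
      have : x ⊗ₜ[k] y = (x ⊗ₜ 1) * (1 ⊗ₜ y) := by simp
      rw [LinearMap.rTensor_tmul, LinearMap.mul'_apply, this, ← mul_assoc, sliceL_right,
        sliceL_right', piL_apply]
      rfl
    | add x y hx hy => simp only [map_add, mul_add, hx, hy]
  rw [e, comulOne_mul_comul, sliceL_counit]

/-- `h₁ ⊗ ⊓ᴿ(h₂) = Σ h eᵢ ⊗ fᵢ`. -/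
lemma lTensor_piR_comul (h : A) :
    LinearMap.lTensor A (piR k A) (Coalgebra.comul (R := k) h) = (h ⊗ₜ 1) * sepElt k A := by
  have e : piR k A = piR k A ∘ₗ piLbar k A := LinearMap.ext fun x => (piR_piLbar x).symm
  rw [e, LinearMap.lTensor_comp, LinearMap.comp_apply, lTensor_piLbar_comul, sepElt]
  induction comulOne k A using TensorProduct.induction_on with
  | zero => simp
  | tmul x y => simp
  | add x y hx hy => simp only [map_add, mul_add, hx, hy]

/-- `⊓ᴸ(h₁) ⊗ h₂ = ⊓ᴸ(1₁) ⊗ 1₂ h`. -/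
lemma rTensor_piL_comul (h : A) :
    LinearMap.rTensor A (piL k A) (Coalgebra.comul (R := k) h) =
      LinearMap.rTensor A (piL k A) (comulOne k A) * (1 ⊗ₜ h) := by
  have e : piL k A = piL k A ∘ₗ piRbar k A := LinearMap.ext fun x => (piL_piRbar x).symm
  conv_lhs => rw [e, LinearMap.rTensor_comp, LinearMap.comp_apply, rTensor_piRbar_comul]
  induction comulOne k A using TensorProduct.induction_on with
  | zero => simp
  | tmul x y => simp
  | add x y hx hy => simp only [map_add, add_mul, hx, hy]

/-- `Σ r eᵢ ⊗ fᵢ = Σ eᵢ ⊗ fᵢ r` for `r` in the base algebra. -/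
lemma mem_mul_sepElt {r : A} (hr : r ∈ LinearMap.range (piR k A)) :
    (r ⊗ₜ 1) * sepElt k A = sepElt k A * (1 ⊗ₜ r) := by
  have e : (r ⊗ₜ[k] (1 : A)) * sepElt k A =
      LinearMap.lTensor A (piR k A) ((1 ⊗ₜ piLbar k A r) * comulOne k A) := by
    rw [← mem_mul_comulOne hr, sepElt]
    induction comulOne k A using TensorProduct.induction_on with
    | zero => simp
    | tmul x y => simp
    | add x y hx hy => simp only [map_add, mul_add, hx, hy]
  rw [e]
  exact comulOne_ext
    (f := LinearMap.lTensor A (piR k A) ∘ₗ LinearMap.mulLeft k ((1 : A) ⊗ₜ[k] piLbar k A r))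
    (g := LinearMap.mulRight k ((1 : A) ⊗ₜ[k] r) ∘ₗ LinearMap.lTensor A (piR k A))
    fun s l _ hl => by simp [hl.piR_piLbar_mul hr]

/-! ### Averaging over the separability element -/

variable (k A) in
/-- The map `c ↦ Σ eᵢ ⊓ᴸ(fᵢ c)`. -/
def sepPiL : A →ₗ[k] A :=
  LinearMap.mul' k A ∘ₗ LinearMap.lTensor A (piL k A) ∘ₗ LinearMap.mulLeft k (sepElt k A) ∘ₗ
    TensorProduct.mk k A A 1

lemma sepPiL_apply (c : A) : sepPiL k A c =
    LinearMap.mul' k A (LinearMap.lTensor A (piL k A) (sepElt k A * (1 ⊗ₜ c))) := rfl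

lemma mem_mul_sepPiL {r : A} (hr : r ∈ LinearMap.range (piR k A)) (c : A) :
    r * sepPiL k A c = sepPiL k A (r * c) := by
  have e : ((1 : A) ⊗ₜ[k] (r * c)) = (1 ⊗ₜ r) * (1 ⊗ₜ c) := by simp
  rw [sepPiL_apply, sepPiL_apply, e, ← mul_assoc, ← mem_mul_sepElt hr]
  induction sepElt k A using TensorProduct.induction_on with
  | zero => simp
  | tmul x y => simp [mul_assoc]
  | add x y hx hy => simp only [map_add, mul_add, add_mul, hx, hy]

lemma IsLeftBase.mul_sepPiL {l : A} (hl : IsLeftBase k l) (c : A) :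
    l * sepPiL k A c = sepPiL k A (l * c) := by
  rw [sepPiL_apply, sepPiL_apply]
  exact comulOne_ext
    (f := LinearMap.mulLeft k l ∘ₗ LinearMap.mul' k A ∘ₗ LinearMap.lTensor A (piL k A) ∘ₗ
      LinearMap.mulRight k ((1 : A) ⊗ₜ[k] c) ∘ₗ LinearMap.lTensor A (piR k A))
    (g := LinearMap.mul' k A ∘ₗ LinearMap.lTensor A (piL k A) ∘ₗ
      LinearMap.mulRight k ((1 : A) ⊗ₜ[k] (l * c)) ∘ₗ LinearMap.lTensor A (piR k A))
    fun r m hr _ => by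
      simp only [LinearMap.comp_apply, LinearMap.lTensor_tmul, LinearMap.mulRight_apply,
        Algebra.TensorProduct.tmul_mul_tmul, mul_one, LinearMap.mul'_apply,
        LinearMap.mulLeft_apply]
      rw [← mul_assoc (piR k A m), hl.commute ⟨m, rfl⟩, mul_assoc l, hl.piL_mul, ← mul_assoc,
        ← mul_assoc, hl.commute hr]

lemma sepPiL_mul_piL (c h : A) : sepPiL k A (c * piL k A h) = sepPiL k A (c * h) := by
  rw [sepPiL_apply, sepPiL_apply]
  induction sepElt k A using TensorProduct.induction_on with
  | zero => simp
  | tmul x y => simp [← mul_assoc, piL_mul_piL]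
  | add x y hx hy => simp only [map_add, add_mul, hx, hy]

lemma mul_sepElt : LinearMap.mul' k A (sepElt k A) = 1 := mul_lTensor_piR_comul 1

lemma piRbar_mul_sepPiL (a c : A) : piRbar k A (a * sepPiL k A c) = piRbar k A (a * c) := by
  have e : ∀ z : A ⊗[k] A, piRbar k A (a * LinearMap.mul' k A
      (LinearMap.lTensor A (piL k A) (z * (1 ⊗ₜ c)))) =
      piRbar k A (a * (LinearMap.mul' k A z * c)) := fun z => by
    induction z using TensorProduct.induction_on with
    | zero => simp
    | tmul x y =>
      simp only [Algebra.TensorProduct.tmul_mul_tmul, mul_one, LinearMap.lTensor_tmul,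
        LinearMap.mul'_apply]
      rw [← mul_assoc, piRbar_mul_piL]
      simp only [mul_assoc]
    | add x y hx hy => simp only [map_add, mul_add, add_mul, hx, hy]
  rw [sepPiL_apply, e, mul_sepElt, one_mul]

variable (k A) in
/-- The element `⊓ᴸ(1₁) ⊓̄ᴿ(1₂) = Σ ⊓ᴸ(eᵢ) ν(fᵢ)`, where `ν = ⊓̄ᴿ ⊓̄ᴸ` is the Nakayama automorphism
of the base algebra. Right multiplication by it turns left integrals into ones compatible with the
actions of `R ⊗ Rᵒᵖ`. -/
def leftAvg : A := LinearMap.mul' k A (TensorProduct.map (piL k A) (piRbar k A) (comulOne k A))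

lemma leftAvg_mul_piL {x : A} (hx : x ∈ LinearMap.range (piR k A)) :
    leftAvg k A * piL k A x = leftAvg k A * nak k A x := by
  have e1 : leftAvg k A * piL k A x =
      LinearMap.mul' k A (TensorProduct.map (piL k A) (piRbar k A) ((x ⊗ₜ 1) * comulOne k A)) :=
    comulOne_ext
      (f := LinearMap.mulRight k (piL k A x) ∘ₗ LinearMap.mul' k A ∘ₗ
        TensorProduct.map (piL k A) (piRbar k A))
      (g := LinearMap.mul' k A ∘ₗ TensorProduct.map (piL k A) (piRbar k A) ∘ₗ
        LinearMap.mulLeft k (x ⊗ₜ[k] (1 : A)))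
      fun r l _ _ => by
        simp [piL_mul hx, mul_assoc, (isLeftBase_piL x).commute (piRbar_mem l)]
  rw [e1, mem_mul_comulOne hx, leftAvg]
  induction comulOne k A using TensorProduct.induction_on with
  | zero => simp
  | tmul a b => simp [piRbar_piLbar_mul, mul_assoc]
  | add a b ha hb => simp only [map_add, mul_add, add_mul, ha, hb]

lemma piLbar_mul_leftAvg (y : A) :
    piLbar k A y * leftAvg k A = nak k A y * leftAvg k A := by
  have e : piLbar k A y = piL k A (nak k A y) := by
    rw [nak_eq, piL_piRbar, (isLeftBase_piLbar y).piL_eq]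
  have e1 : piLbar k A y * leftAvg k A = LinearMap.mul' k A (TensorProduct.map (piL k A)
      (piRbar k A) (comulOne k A * (nak k A y ⊗ₜ 1))) :=
    comulOne_ext
      (f := LinearMap.mulLeft k (piLbar k A y) ∘ₗ LinearMap.mul' k A ∘ₗ
        TensorProduct.map (piL k A) (piRbar k A))
      (g := LinearMap.mul' k A ∘ₗ TensorProduct.map (piL k A) (piRbar k A) ∘ₗ
        LinearMap.mulRight k (nak k A y ⊗ₜ[k] (1 : A)))
      fun r l hr _ => by simp [piL_mul hr, ← e, mul_assoc]
  rw [e1, ← comulOne_mul_mem (nak_mem y), leftAvg]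
  exact comulOne_ext
    (f := LinearMap.mul' k A ∘ₗ TensorProduct.map (piL k A) (piRbar k A) ∘ₗ
      LinearMap.mulRight k ((1 : A) ⊗ₜ[k] piL k A (nak k A y)))
    (g := LinearMap.mulLeft k (nak k A y) ∘ₗ LinearMap.mul' k A ∘ₗ
      TensorProduct.map (piL k A) (piRbar k A))
    fun r l _ hl => by
      simp only [LinearMap.comp_apply, LinearMap.mulRight_apply, LinearMap.mulLeft_apply,
        Algebra.TensorProduct.tmul_mul_tmul, TensorProduct.map_tmul, LinearMap.mul'_apply, mul_one]
      rw [piRbar_mul_piL, ← hl.commute (nak_mem y), piRbar_mem_mul _ (nak_mem y), ← mul_assoc,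
        ← mul_assoc, (isLeftBase_piL r).commute (nak_mem y)]

/-- This holds because `⊓̄ᴿ(1₂) 1₁ = (id ⊗ ε)(Δ(1) Δ(1)) = 1`. -/
lemma piRbar_mul_leftAvg (a : A) : piRbar k A (a * leftAvg k A) = piRbar k A a := by
  have e1 : leftAvg k A = LinearMap.mul' k A (TensorProduct.map (piRbar k A) (piL k A)
      (TensorProduct.comm k A A (comulOne k A))) :=
    comulOne_ext
      (f := LinearMap.mul' k A ∘ₗ TensorProduct.map (piL k A) (piRbar k A))
      (g := LinearMap.mul' k A ∘ₗ TensorProduct.map (piRbar k A) (piL k A) ∘ₗ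
        (TensorProduct.comm k A A).toLinearMap)
      fun r l _ _ => by simp [(isLeftBase_piL r).commute (piRbar_mem l)]
  have e2 : ∀ z : A ⊗[k] A, piRbar k A (a * LinearMap.mul' k A
      (TensorProduct.map (piRbar k A) (piL k A) (TensorProduct.comm k A A z))) =
      piRbar k A (a * LinearMap.mul' k A (LinearMap.rTensor A (piRbar k A)
        (TensorProduct.comm k A A z))) := fun z => by
    induction z using TensorProduct.induction_on with
    | zero => simp
    | tmul x y =>
      simp only [TensorProduct.comm_tmul, TensorProduct.map_tmul, LinearMap.rTensor_tmul,
        LinearMap.mul'_apply]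
      rw [← mul_assoc, piRbar_mul_piL, mul_assoc]
    | add x y hx hy => simp only [map_add, mul_add, hx, hy]
  have e3 : ∀ z : A ⊗[k] A, LinearMap.mul' k A (LinearMap.rTensor A (piRbar k A)
      (TensorProduct.comm k A A z)) =
      sliceR (Coalgebra.counit (R := k)) (comulOne k A * z) := fun z => by
    induction z using TensorProduct.induction_on with
    | zero => simp
    | tmul x y =>
      have : x ⊗ₜ[k] y = (1 ⊗ₜ y) * (x ⊗ₜ 1) := by simp
      rw [TensorProduct.comm_tmul, LinearMap.rTensor_tmul, LinearMap.mul'_apply, this, ← mul_assoc,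
        sliceR_right, ← piRbar_eq]
    | add x y hx hy => simp only [map_add, mul_add, hx, hy]
  rw [e1, e2, e3, comulOne, ← IsWeakBialgebra.comul_mul, mul_one, sliceR_counit, mul_one]

variable (k A) in
/-- The element `⊓̄ᴸ(1₁) ⊓ᴿ(1₂)`, the left-right dual of `leftAvg`. -/
def rightAvg : A := LinearMap.mul' k A (TensorProduct.map (piLbar k A) (piR k A) (comulOne k A))

lemma rightAvg_mul_piLbar {y : A} (hy : y ∈ LinearMap.range (piR k A)) :
    rightAvg k A * piLbar k A y = rightAvg k A * y := by
  have e1 : rightAvg k A * piLbar k A y =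
      LinearMap.mul' k A (TensorProduct.map (piLbar k A) (piR k A) ((y ⊗ₜ 1) * comulOne k A)) :=
    comulOne_ext
      (f := LinearMap.mulRight k (piLbar k A y) ∘ₗ LinearMap.mul' k A ∘ₗ
        TensorProduct.map (piLbar k A) (piR k A))
      (g := LinearMap.mul' k A ∘ₗ TensorProduct.map (piLbar k A) (piR k A) ∘ₗ
        LinearMap.mulLeft k (y ⊗ₜ[k] (1 : A)))
      fun r l hr _ => by
        simp [piLbar_mul hy hr, mul_assoc, (isLeftBase_piLbar y).commute (r := piR k A l) ⟨l, rfl⟩]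
  rw [e1, mem_mul_comulOne hy, rightAvg]
  exact comulOne_ext
    (f := LinearMap.mul' k A ∘ₗ TensorProduct.map (piLbar k A) (piR k A) ∘ₗ
      LinearMap.mulLeft k ((1 : A) ⊗ₜ[k] piLbar k A y))
    (g := LinearMap.mulRight k y ∘ₗ LinearMap.mul' k A ∘ₗ
      TensorProduct.map (piLbar k A) (piR k A))
    fun r l _ hl => by simp [hl.piR_piLbar_mul hy, mul_assoc]

lemma piLbar_mul_rightAvg {x : A} (hx : x ∈ LinearMap.range (piR k A)) :
    piLbar k A x * rightAvg k A = piR k A (piL k A x) * rightAvg k A := by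
  have e1 : piLbar k A x * rightAvg k A =
      LinearMap.mul' k A (TensorProduct.map (piLbar k A) (piR k A) (comulOne k A * (x ⊗ₜ 1))) :=
    comulOne_ext
      (f := LinearMap.mulLeft k (piLbar k A x) ∘ₗ LinearMap.mul' k A ∘ₗ
        TensorProduct.map (piLbar k A) (piR k A))
      (g := LinearMap.mul' k A ∘ₗ TensorProduct.map (piLbar k A) (piR k A) ∘ₗ
        LinearMap.mulRight k (x ⊗ₜ[k] (1 : A)))
      fun r l hr _ => by simp [piLbar_mul hr hx, mul_assoc]
  have e : ∀ b : A, piR k A (b * piL k A x) = piR k A (piL k A x) * piR k A b := fun b => by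
    rw [← piR_mul_piLbar b ⟨piL k A x, rfl⟩, piLbar_piR, (isLeftBase_piL x).piLbar_eq]
  rw [e1, ← comulOne_mul_mem hx, rightAvg]
  induction comulOne k A using TensorProduct.induction_on with
  | zero => simp
  | tmul a b =>
    simp only [Algebra.TensorProduct.tmul_mul_tmul, TensorProduct.map_tmul, LinearMap.mul'_apply,
      mul_one, e]
    rw [← mul_assoc, ← mul_assoc,
      (isLeftBase_piLbar a).commute (r := piR k A (piL k A x)) ⟨_, rfl⟩]
  | add a b ha hb => simp only [map_add, mul_add, add_mul, ha, hb]

lemma piR_rightAvg_mul (a : A) : piR k A (rightAvg k A * a) = piR k A a := by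
  have e : ∀ z : A ⊗[k] A, piR k A (LinearMap.mul' k A
      (TensorProduct.map (piLbar k A) (piR k A) z) * a) =
      piR k A (LinearMap.mul' k A (LinearMap.lTensor A (piR k A) z) * a) := fun z => by
    induction z using TensorProduct.induction_on with
    | zero => simp
    | tmul x y => simp [mul_assoc, piR_piLbar_mul]
    | add x y hx hy => simp only [map_add, add_mul, hx, hy]
  rw [rightAvg, e]
  exact congrArg (fun b => piR k A (b * a)) mul_sepElt |>.trans (by rw [one_mul])

end Identities

end WeakBialg

/-! ### Separability elements and integrals -/

/-- A bimodule section of the multiplication is the same as a Casimir element with product `1`. -/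
lemma isSeparableAlg_iff {k : Type v} {A : Type u} [Field k] [Ring A] [Algebra k A] :
    IsSeparableAlg k A ↔ ∃ E : A ⊗[k] A,
      (∀ h : A, (h ⊗ₜ 1) * E = E * (1 ⊗ₜ h)) ∧ LinearMap.mul' k A E = 1 := by
  have hl : ∀ (a : A) (z : A ⊗[k] A),
      LinearMap.rTensor A (LinearMap.mulLeft k a) z = (a ⊗ₜ 1) * z := fun a z => by
    induction z using TensorProduct.induction_on with
    | zero => simp
    | tmul x y => simp
    | add x y hx hy => simp only [map_add, mul_add, hx, hy]
  have hr : ∀ (a : A) (z : A ⊗[k] A),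
      LinearMap.lTensor A (LinearMap.mulRight k a) z = z * (1 ⊗ₜ a) := fun a z => by
    induction z using TensorProduct.induction_on with
    | zero => simp
    | tmul x y => simp
    | add x y hx hy => simp only [map_add, add_mul, hx, hy]
  constructor
  · rintro ⟨s, h1, h2, h3⟩
    refine ⟨s 1, fun h => ?_, h3 1⟩
    rw [← hl, ← hr, ← h1, ← h2, mul_one, one_mul]
  · rintro ⟨E, hE, hm⟩
    have hmul : ∀ (a : A) (z : A ⊗[k] A),
        LinearMap.mul' k A ((a ⊗ₜ 1) * z) = a * LinearMap.mul' k A z := fun a z => by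
      induction z using TensorProduct.induction_on with
      | zero => simp
      | tmul x y => simp [mul_assoc]
      | add x y hx hy => simp only [map_add, mul_add, hx, hy]
    have e : ∀ a b : A, ((a * b) ⊗ₜ[k] (1 : A)) = (a ⊗ₜ 1) * (b ⊗ₜ 1) := fun a b => by simp
    refine ⟨LinearMap.mulRight k E ∘ₗ (TensorProduct.mk k A A).flip 1, fun a b => ?_,
      fun a b => ?_, fun a => ?_⟩
    · simp only [LinearMap.comp_apply, LinearMap.flip_apply, TensorProduct.mk_apply,
        LinearMap.mulRight_apply]
      rw [hl, e, mul_assoc]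
    · simp only [LinearMap.comp_apply, LinearMap.flip_apply, TensorProduct.mk_apply,
        LinearMap.mulRight_apply]
      rw [hr, e, mul_assoc, hE, mul_assoc]
    · simp only [LinearMap.comp_apply, LinearMap.flip_apply, TensorProduct.mk_apply,
        LinearMap.mulRight_apply]
      rw [hmul, hm, mul_one]

namespace WeakBialg

section Extensions

variable {k : Type v} {A : Type u} [Field k] [Ring A] [Algebra k A]

/-- The right `A`-linear map `A ⊗ A → A ⊗ A`, `a ⊗ b ↦ F(a)(1 ⊗ b)`. -/
def rightExt (F : A →ₗ[k] A ⊗[k] A) : A ⊗[k] A →ₗ[k] A ⊗[k] A :=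
  LinearMap.lTensor A (LinearMap.mul' k A) ∘ₗ (TensorProduct.assoc k A A A).toLinearMap ∘ₗ
    LinearMap.rTensor A F

/-- The left `A`-linear map `A ⊗ A → A ⊗ A`, `a ⊗ b ↦ (a ⊗ 1)F(b)`. -/
def leftExt (F : A →ₗ[k] A ⊗[k] A) : A ⊗[k] A →ₗ[k] A ⊗[k] A :=
  LinearMap.rTensor A (LinearMap.mul' k A) ∘ₗ (TensorProduct.assoc k A A A).symm.toLinearMap ∘ₗ
    LinearMap.lTensor A F

@[simp] lemma rightExt_tmul (F : A →ₗ[k] A ⊗[k] A) (a b : A) :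
    rightExt F (a ⊗ₜ b) = F a * (1 ⊗ₜ b) := by
  simp only [rightExt, LinearMap.comp_apply, LinearMap.rTensor_tmul, LinearEquiv.coe_coe]
  induction F a using TensorProduct.induction_on with
  | zero => simp
  | tmul x y => simp
  | add x y hx hy => simp only [TensorProduct.add_tmul, map_add, add_mul, hx, hy]

@[simp] lemma leftExt_tmul (F : A →ₗ[k] A ⊗[k] A) (a b : A) :
    leftExt F (a ⊗ₜ b) = (a ⊗ₜ 1) * F b := by
  simp only [leftExt, LinearMap.comp_apply, LinearMap.lTensor_tmul, LinearEquiv.coe_coe]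
  induction F b using TensorProduct.induction_on with
  | zero => simp
  | tmul x y => simp
  | add x y hx hy => simp only [TensorProduct.tmul_add, map_add, mul_add, hx, hy]

lemma rightExt_mul (F : A →ₗ[k] A ⊗[k] A) (z : A ⊗[k] A) (b : A) :
    rightExt F (z * (1 ⊗ₜ b)) = rightExt F z * (1 ⊗ₜ b) := by
  induction z using TensorProduct.induction_on with
  | zero => simp
  | tmul x y => simp [mul_assoc]
  | add x y hx hy => simp only [add_mul, map_add, hx, hy]

lemma leftExt_mul (F : A →ₗ[k] A ⊗[k] A) (a : A) (z : A ⊗[k] A) :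
    leftExt F ((a ⊗ₜ 1) * z) = (a ⊗ₜ 1) * leftExt F z := by
  induction z using TensorProduct.induction_on with
  | zero => simp
  | tmul x y => simp [← mul_assoc]
  | add x y hx hy => simp only [mul_add, map_add, hx, hy]

lemma rightExt_rightExt (F G : A →ₗ[k] A ⊗[k] A) (z : A ⊗[k] A) :
    rightExt G (rightExt F z) = rightExt (rightExt G ∘ₗ F) z := by
  induction z using TensorProduct.induction_on with
  | zero => simp
  | tmul x y => simp [rightExt_mul]
  | add x y hx hy => simp only [map_add, hx, hy]

lemma leftExt_leftExt (F G : A →ₗ[k] A ⊗[k] A) (z : A ⊗[k] A) :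
    leftExt G (leftExt F z) = leftExt (leftExt G ∘ₗ F) z := by
  induction z using TensorProduct.induction_on with
  | zero => simp
  | tmul x y => simp [leftExt_mul]
  | add x y hx hy => simp only [map_add, hx, hy]

lemma mul_rightExt (F : A →ₗ[k] A ⊗[k] A) (z : A ⊗[k] A) :
    LinearMap.mul' k A (rightExt F z) =
      LinearMap.mul' k A (LinearMap.rTensor A (LinearMap.mul' k A ∘ₗ F) z) := by
  have e : ∀ (w : A ⊗[k] A) (b : A),
      LinearMap.mul' k A (w * (1 ⊗ₜ b)) = LinearMap.mul' k A w * b := fun w b => by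
    induction w using TensorProduct.induction_on with
    | zero => simp
    | tmul x y => simp [mul_assoc]
    | add x y hx hy => simp only [add_mul, map_add, hx, hy]
  induction z using TensorProduct.induction_on with
  | zero => simp
  | tmul x y => simp [e]
  | add x y hx hy => simp only [map_add, hx, hy]

lemma mul_leftExt (F : A →ₗ[k] A ⊗[k] A) (z : A ⊗[k] A) :
    LinearMap.mul' k A (leftExt F z) =
      LinearMap.mul' k A (LinearMap.lTensor A (LinearMap.mul' k A ∘ₗ F) z) := by
  have e : ∀ (a : A) (w : A ⊗[k] A),
      LinearMap.mul' k A ((a ⊗ₜ 1) * w) = a * LinearMap.mul' k A w := fun a w => by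
    induction w using TensorProduct.induction_on with
    | zero => simp
    | tmul x y => simp [mul_assoc]
    | add x y hx hy => simp only [mul_add, map_add, hx, hy]
  induction z using TensorProduct.induction_on with
  | zero => simp
  | tmul x y => simp [e]
  | add x y hx hy => simp only [map_add, hx, hy]

variable [Coalgebra k A]

/-- `a₁ ⊗ f(a₂) g(a₃) = a₁ ⊗ (f * g)(a₂)` for the convolution product `f * g`. -/
lemma rightExt_comul (f g : A →ₗ[k] A) (a : A) :
    rightExt (LinearMap.lTensor A f ∘ₗ Coalgebra.comul (R := k))
        (LinearMap.lTensor A g (Coalgebra.comul (R := k) a)) =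
      LinearMap.lTensor A (LinearMap.mul' k A ∘ₗ TensorProduct.map f g ∘ₗ
        Coalgebra.comul (R := k)) (Coalgebra.comul (R := k) a) := by
  have e : rightExt (LinearMap.lTensor A f ∘ₗ Coalgebra.comul (R := k)) ∘ₗ LinearMap.lTensor A g =
      LinearMap.lTensor A (LinearMap.mul' k A ∘ₗ TensorProduct.map f g) ∘ₗ
        (TensorProduct.assoc k A A A).toLinearMap ∘ₗ
          LinearMap.rTensor A (Coalgebra.comul (R := k)) :=
    TensorProduct.ext' fun x y => by
      simp only [LinearMap.comp_apply, LinearMap.lTensor_tmul, LinearMap.rTensor_tmul,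
        rightExt_tmul, LinearEquiv.coe_coe]
      induction Coalgebra.comul (R := k) x using TensorProduct.induction_on with
      | zero => simp
      | tmul b c => simp
      | add b c hb hc => simp only [map_add, add_mul, TensorProduct.add_tmul, hb, hc]
  refine (LinearMap.congr_fun e (Coalgebra.comul (R := k) a)).trans ?_
  simp only [LinearMap.comp_apply, LinearEquiv.coe_coe, Coalgebra.coassoc_apply,
    LinearMap.lTensor_comp]

/-- `f(a₁) g(a₂) ⊗ a₃ = (f * g)(a₁) ⊗ a₂` for the convolution product `f * g`. -/
lemma leftExt_comul (f g : A →ₗ[k] A) (a : A) :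
    leftExt (LinearMap.rTensor A g ∘ₗ Coalgebra.comul (R := k))
        (LinearMap.rTensor A f (Coalgebra.comul (R := k) a)) =
      LinearMap.rTensor A (LinearMap.mul' k A ∘ₗ TensorProduct.map f g ∘ₗ
        Coalgebra.comul (R := k)) (Coalgebra.comul (R := k) a) := by
  have e : leftExt (LinearMap.rTensor A g ∘ₗ Coalgebra.comul (R := k)) ∘ₗ LinearMap.rTensor A f =
      LinearMap.rTensor A (LinearMap.mul' k A ∘ₗ TensorProduct.map f g) ∘ₗ
        (TensorProduct.assoc k A A A).symm.toLinearMap ∘ₗ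
          LinearMap.lTensor A (Coalgebra.comul (R := k)) :=
    TensorProduct.ext' fun x y => by
      simp only [LinearMap.comp_apply, LinearMap.lTensor_tmul, LinearMap.rTensor_tmul,
        leftExt_tmul, LinearEquiv.coe_coe]
      induction Coalgebra.comul (R := k) y using TensorProduct.induction_on with
      | zero => simp
      | tmul b c => simp
      | add b c hb hc => simp only [map_add, mul_add, TensorProduct.tmul_add, hb, hc]
  refine (LinearMap.congr_fun e (Coalgebra.comul (R := k) a)).trans ?_
  simp only [LinearMap.comp_apply, LinearEquiv.coe_coe, LinearMap.rTensor_comp]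
  rw [Coalgebra.coassoc_symm_apply]

end Extensions

section Integrals

variable {k : Type v} {A : Type u} [Field k] [Ring A] [Algebra k A] [Coalgebra k A]

section

variable [IsWeakBialgebra k A]

/-- A left integral `t` satisfies `⊓̄ᴿ(h) t = h t` as well. -/
lemma piRbar_mul_of_mul_left {t : A} (ht : ∀ h : A, h * t = piL k A h * t) (h : A) :
    piRbar k A h * t = h * t := by
  rw [ht (piRbar k A h), piL_piRbar, ← ht]

/-- A right integral `t` satisfies `t ⊓̄ᴸ(h) = t h` as well. -/
lemma mul_piLbar_of_mul_right {t : A} (ht : ∀ h : A, t * h = t * piR k A h) (h : A) :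
    t * piLbar k A h = t * h := by
  rw [ht (piLbar k A h), piR_piLbar, ← ht]

/-- From a Casimir element `Σ xᵢ ⊗ yᵢ` with product `1`, the right integral `Σ ⊓ᴿ(xᵢ) yᵢ`. -/
lemma exists_rightInt_of_isSeparableAlg (H : IsSeparableAlg k A) :
    ∃ t : A, IsNormalizedRightInt k t := by
  obtain ⟨E, hE, hm⟩ := isSeparableAlg_iff.1 H
  let f : A ⊗[k] A →ₗ[k] A := LinearMap.mul' k A ∘ₗ LinearMap.rTensor A (piR k A)
  have f1 : ∀ h z, f (z * (1 ⊗ₜ h)) = f z * h := fun h z => by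
    induction z using TensorProduct.induction_on with
    | zero => simp
    | tmul x y => simp [f, mul_assoc]
    | add x y hx hy => simp only [add_mul, map_add, hx, hy]
  have f2 : ∀ h z, f ((piR k A h ⊗ₜ 1) * z) = f ((h ⊗ₜ 1) * z) := fun h z => by
    induction z using TensorProduct.induction_on with
    | zero => simp
    | tmul x y => simp [f, piR_piR_mul]
    | add x y hx hy => simp only [mul_add, map_add, hx, hy]
  have f3 : ∀ z, piR k A (f z) = piR k A (LinearMap.mul' k A z) := fun z => by
    induction z using TensorProduct.induction_on with
    | zero => simp
    | tmul x y => simp [f, piR_piR_mul]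
    | add x y hx hy => simp only [map_add, hx, hy]
  exact ⟨f E, fun h => by rw [← f1, ← hE, ← f2, hE, f1], by rw [f3, hm, piR_one]⟩

/-- The average `t ⊓ᴸ(1₁) ⊓̄ᴿ(1₂)` of a normalized left integral `t`. -/
lemma _root_.IsNormalizedLeftInt.mul_leftAvg {t : A} (ht : IsNormalizedLeftInt k t) :
    IsNormalizedLeftInt k (t * leftAvg k A) where
  mul_left h := by rw [← mul_assoc, ht.mul_left, mul_assoc]
  normalized := by rw [piRbar_mul_leftAvg, ht.normalized]

/-- The average `⊓̄ᴸ(1₁) ⊓ᴿ(1₂) t` of a normalized right integral `t`. -/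
lemma _root_.IsNormalizedRightInt.rightAvg_mul {t : A} (ht : IsNormalizedRightInt k t) :
    IsNormalizedRightInt k (rightAvg k A * t) where
  mul_right h := by rw [mul_assoc, ht.mul_right, mul_assoc]
  normalized := by rw [piR_rightAvg_mul, ht.normalized]

end

variable [IsWeakHopfAlgebra k A]

/-- Maschke's theorem for left integrals. The idempotent `P : a ⊗ b ↦ Σ a eᵢ ⊗ fᵢ b` factorizes as
`κ can` for `can : a ⊗ b ↦ a₁ ⊗ a₂ b` and `κ : a ⊗ b ↦ a₁ ⊗ σ(a₂) b`. So the Casimir property of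
`P(κ(t ⊗ 1)) = Σ t₁ eᵢ ⊗ fᵢ σ(t₂)` can be checked on the image of `κ(t ⊗ 1)` under `can`, which is
`1₁ t ⊗ 1₂`. As `can` is a bimodule map to `A ⊗ A` with the diagonal left action, no property of `σ`
beyond its two defining identities is needed. -/
lemma _root_.IsNormalizedLeftInt.isSeparableAlg {t : A} (ht : IsNormalizedLeftInt k t) :
    IsSeparableAlg k A := by
  obtain ⟨σ, h1, h2⟩ := IsWeakHopfAlgebra.exists_antipode (k := k) (A := A)
  let Δ : A →ₗ[k] A ⊗[k] A := Coalgebra.comul (R := k)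
  let K : A →ₗ[k] A ⊗[k] A := LinearMap.lTensor A σ ∘ₗ Δ
  let P : A →ₗ[k] A ⊗[k] A := LinearMap.lTensor A (piR k A) ∘ₗ Δ
  let Q : A →ₗ[k] A ⊗[k] A := LinearMap.lTensor A (piL k A) ∘ₗ Δ
  have canκ : rightExt Δ ∘ₗ K = Q := LinearMap.ext fun a => by
    have := rightExt_comul (k := k) LinearMap.id σ a
    rw [LinearMap.lTensor_id, LinearMap.id_comp] at this
    exact this.trans (congrArg (fun f => LinearMap.lTensor A f (Δ a)) h1)
  have κcan : rightExt K ∘ₗ Δ = P := LinearMap.ext fun a => by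
    have := rightExt_comul (k := k) σ LinearMap.id a
    rw [LinearMap.lTensor_id, LinearMap.id_apply] at this
    exact this.trans (congrArg (fun f => LinearMap.lTensor A f (Δ a)) h2)
  have Pmul : ∀ h z, rightExt P ((h ⊗ₜ 1) * z) = (h ⊗ₜ 1) * rightExt P z := fun h z => by
    induction z using TensorProduct.induction_on with
    | zero => simp
    | tmul x y =>
      have e : ∀ x, P x = (x ⊗ₜ 1) * sepElt k A := lTensor_piR_comul
      simp [e, ← mul_assoc]
    | add x y hx hy => simp only [mul_add, map_add, hx, hy]
  have canmul : ∀ h z, rightExt Δ ((h ⊗ₜ 1) * z) = Δ h * rightExt Δ z := fun h z => by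
    induction z using TensorProduct.induction_on with
    | zero => simp
    | tmul x y => simp [Δ, IsWeakBialgebra.comul_mul, mul_assoc]
    | add x y hx hy => simp only [mul_add, map_add, hx, hy]
  have canκ_apply : ∀ z, rightExt Δ (rightExt K z) = comulOne k A * z := fun z => by
    rw [rightExt_rightExt, canκ]
    induction z using TensorProduct.induction_on with
    | zero => simp
    | tmul x y =>
      rw [rightExt_tmul, show Q x = _ from lTensor_piL_comul x, mul_assoc]
      simp
    | add x y hx hy => simp only [mul_add, map_add, hx, hy]
  have P_eq : ∀ z, rightExt P z = rightExt K (rightExt Δ z) := fun z => by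
    rw [rightExt_rightExt Δ K, κcan]
  have hinj : ∀ z w, rightExt Δ z = rightExt Δ w → rightExt P z = rightExt P w := fun z w H => by
    rw [P_eq, P_eq, H]
  have canK : rightExt Δ (K t) = comulOne k A * (t ⊗ₜ 1) :=
    (LinearMap.congr_fun canκ t).trans (lTensor_piL_comul t)
  refine isSeparableAlg_iff.2 ⟨rightExt P (K t), fun h => ?_, ?_⟩
  · rw [← Pmul, ← rightExt_mul]
    apply hinj
    rw [canmul, rightExt_mul, canK, ← mul_assoc, comul_mul_comulOne, mul_assoc,
      Algebra.TensorProduct.tmul_mul_tmul, one_mul, mul_one]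
    -- both sides equal `⊓̄ᴿ(h₁) t ⊗ h₂`
    have e : ∀ z : A ⊗[k] A, z * (t ⊗ₜ 1) = LinearMap.rTensor A (piRbar k A) z * (t ⊗ₜ 1) :=
      fun z => by
        induction z using TensorProduct.induction_on with
        | zero => simp
        | tmul x y => simp [piRbar_mul_of_mul_left ht.mul_left]
        | add x y hx hy => rw [add_mul, hx, hy, map_add, add_mul]
    rw [e, show LinearMap.rTensor A (piRbar k A) (Δ h) = _ from rTensor_piRbar_comul h, mul_assoc]
    simp
  · have e : LinearMap.mul' k A ∘ₗ P = LinearMap.id := LinearMap.ext mul_lTensor_piR_comul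
    rw [mul_rightExt, e, LinearMap.rTensor_id, LinearMap.id_apply]
    refine (LinearMap.congr_fun h1 t).trans ?_
    rw [← piL_piRbar, ht.normalized, piL_one]

/-- Maschke's theorem for right integrals: the left-right dual of
`IsNormalizedLeftInt.isSeparableAlg`, with `can : a ⊗ b ↦ a b₁ ⊗ b₂`, `κ : a ⊗ b ↦ a σ(b₁) ⊗ b₂` and
`P = κ can : a ⊗ b ↦ a ⊓ᴸ(1₁) ⊗ 1₂ b`. -/
lemma _root_.IsNormalizedRightInt.isSeparableAlg {t : A} (ht : IsNormalizedRightInt k t) :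
    IsSeparableAlg k A := by
  obtain ⟨σ, h1, h2⟩ := IsWeakHopfAlgebra.exists_antipode (k := k) (A := A)
  let Δ : A →ₗ[k] A ⊗[k] A := Coalgebra.comul (R := k)
  let K : A →ₗ[k] A ⊗[k] A := LinearMap.rTensor A σ ∘ₗ Δ
  let P : A →ₗ[k] A ⊗[k] A := LinearMap.rTensor A (piL k A) ∘ₗ Δ
  let Q : A →ₗ[k] A ⊗[k] A := LinearMap.rTensor A (piR k A) ∘ₗ Δ
  have canκ : leftExt Δ ∘ₗ K = Q := LinearMap.ext fun a => by
    have := leftExt_comul (k := k) σ LinearMap.id a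
    rw [LinearMap.rTensor_id, LinearMap.id_comp] at this
    exact this.trans (congrArg (fun f => LinearMap.rTensor A f (Δ a)) h2)
  have κcan : leftExt K ∘ₗ Δ = P := LinearMap.ext fun a => by
    have := leftExt_comul (k := k) LinearMap.id σ a
    rw [LinearMap.rTensor_id, LinearMap.id_apply] at this
    exact this.trans (congrArg (fun f => LinearMap.rTensor A f (Δ a)) h1)
  have Pmul : ∀ h z, leftExt P (z * (1 ⊗ₜ h)) = leftExt P z * (1 ⊗ₜ h) := fun h z => by
    induction z using TensorProduct.induction_on with
    | zero => simp
    | tmul x y =>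
      have e : ∀ x, P x = LinearMap.rTensor A (piL k A) (comulOne k A) * (1 ⊗ₜ x) :=
        rTensor_piL_comul
      simp [e, mul_assoc]
    | add x y hx hy => simp only [add_mul, map_add, hx, hy]
  have canmul : ∀ h z, leftExt Δ (z * (1 ⊗ₜ h)) = leftExt Δ z * Δ h := fun h z => by
    induction z using TensorProduct.induction_on with
    | zero => simp
    | tmul x y => simp [Δ, IsWeakBialgebra.comul_mul, mul_assoc]
    | add x y hx hy => simp only [add_mul, map_add, hx, hy]
  have canκ_apply : ∀ z, leftExt Δ (leftExt K z) = z * comulOne k A := fun z => by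
    rw [leftExt_leftExt, canκ]
    induction z using TensorProduct.induction_on with
    | zero => simp
    | tmul x y =>
      rw [leftExt_tmul, show Q y = _ from rTensor_piR_comul y, ← mul_assoc]
      simp
    | add x y hx hy => simp only [add_mul, map_add, hx, hy]
  have P_eq : ∀ z, leftExt P z = leftExt K (leftExt Δ z) := fun z => by
    rw [leftExt_leftExt Δ K, κcan]
  have hinj : ∀ z w, leftExt Δ z = leftExt Δ w → leftExt P z = leftExt P w := fun z w H => by
    rw [P_eq, P_eq, H]
  have canK : leftExt Δ (K t) = (1 ⊗ₜ t) * comulOne k A :=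
    (LinearMap.congr_fun canκ t).trans (rTensor_piR_comul t)
  refine isSeparableAlg_iff.2 ⟨leftExt P (K t), fun h => ?_, ?_⟩
  · rw [← Pmul, ← leftExt_mul]
    apply hinj
    rw [canmul, leftExt_mul, canK, mul_assoc (1 ⊗ₜ[k] t : A ⊗[k] A), comulOne_mul_comul,
      ← mul_assoc, Algebra.TensorProduct.tmul_mul_tmul, one_mul, mul_one]
    -- both sides equal `h₁ ⊗ t ⊓̄ᴸ(h₂)`
    have e : ∀ z : A ⊗[k] A, (1 ⊗ₜ t) * z = (1 ⊗ₜ t) * LinearMap.lTensor A (piLbar k A) z :=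
      fun z => by
        induction z using TensorProduct.induction_on with
        | zero => simp
        | tmul x y => simp [mul_piLbar_of_mul_right ht.mul_right]
        | add x y hx hy => rw [mul_add, hx, hy, map_add, mul_add]
    rw [e, show LinearMap.lTensor A (piLbar k A) (Δ h) = _ from lTensor_piLbar_comul h, ← mul_assoc]
    simp
  · have e : LinearMap.mul' k A ∘ₗ P = LinearMap.id := LinearMap.ext mul_rTensor_piL_comul
    rw [mul_leftExt, e, LinearMap.lTensor_id, LinearMap.id_apply]
    refine (LinearMap.congr_fun h2 t).trans ht.normalized

end Integrals

/-! ### Separability of the monoid `a` -/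

section SeparableMonoid

open AlgBimod

variable {k : Type v} {A : Type u} [Field k] [Ring A] [Algebra k A] [Coalgebra k A]
  [IsWeakBialgebra k A]

variable (k A) in
/-- The canonical projection `A ⊗ A → a • a`. -/
def projMonA : A ⊗[k] A →ₗ[k] (monA k A ⊗ monA k A : AlgBimod k (Env k A)).carrier :=
  TensorProduct.lift (tm (monA k A) (monA k A))

lemma projMonA_tmul (a b : A) :
    projMonA k A (a ⊗ₜ b) = tmul (M := monA k A) (N := monA k A) a b := rfl

lemma projMonA_surjective : Function.Surjective (projMonA k A) := fun x =>
  tm_ind (p := fun x => ∃ z, projMonA k A z = x) (fun (a b : A) => ⟨a ⊗ₜ b, rfl⟩)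
    ⟨0, map_zero _⟩ (fun _ _ ⟨z, hz⟩ ⟨w, hw⟩ => ⟨z + w, by rw [map_add, hz, hw]⟩) x

lemma lin_mul_monA (a b : A) :
    lin (MonObj.mul : monA k A ⊗ monA k A ⟶ monA k A)
      (tmul (M := monA k A) (N := monA k A) a b) = a * b :=
  lin_ofAlgHomMul _ _ _

lemma lin_mul_projMonA (z : A ⊗[k] A) :
    lin (MonObj.mul : monA k A ⊗ monA k A ⟶ monA k A) (projMonA k A z) =
      LinearMap.mul' k A z := by
  induction z using TensorProduct.induction_on with
  | zero => rw [map_zero, map_zero, map_zero]; rfl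
  | tmul x y => exact lin_mul_monA x y
  | add x y hx hy => rw [map_add, map_add, map_add, hx, hy]; rfl

lemma left_mul_projMonA (a : A) (z : A ⊗[k] A) :
    lin ((α_ (monA k A) (monA k A) (monA k A)).inv ≫ MonObj.mul ▷ monA k A)
      (tm (monA k A) (monA k A ⊗ monA k A) a (projMonA k A z)) =
      projMonA k A ((a ⊗ₜ 1) * z) := by
  induction z using TensorProduct.induction_on with
  | zero => simp only [mul_zero, map_zero]
  | tmul x y =>
    rw [projMonA_tmul, Algebra.TensorProduct.tmul_mul_tmul, one_mul, projMonA_tmul, lin_comp,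
      LinearMap.comp_apply]
    refine (congrArg _ (lin_associator_inv (M := monA k A) (N := monA k A) (P := monA k A)
      a x y)).trans ((lin_whiskerRight (M := monA k A ⊗ monA k A) _ _ _ _).trans ?_)
    exact congrArg (fun c => tmul (M := monA k A) (N := monA k A) c y) (lin_mul_monA a x)
  | add x y hx hy => simp only [mul_add, map_add, hx, hy]

lemma right_mul_projMonA (b : A) (z : A ⊗[k] A) :
    lin ((α_ (monA k A) (monA k A) (monA k A)).hom ≫ monA k A ◁ MonObj.mul)
      ((tm (monA k A ⊗ monA k A) (monA k A)).flip b (projMonA k A z)) =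
      projMonA k A (z * (1 ⊗ₜ b)) := by
  induction z using TensorProduct.induction_on with
  | zero => simp only [zero_mul, map_zero]
  | tmul x y =>
    rw [projMonA_tmul, Algebra.TensorProduct.tmul_mul_tmul, mul_one, projMonA_tmul, lin_comp,
      LinearMap.comp_apply]
    refine (congrArg _ (lin_associator_hom (M := monA k A) (N := monA k A) (P := monA k A)
      x y b)).trans ((lin_whiskerLeft (monA k A) (N := monA k A ⊗ monA k A) _ _ _).trans ?_)
    exact congrArg (fun c => tmul (M := monA k A) (N := monA k A) x c) (lin_mul_monA y b)
  | add x y hx hy => simp only [add_mul, map_add, hx, hy]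

/-- A Casimir element with product `1` induces a bimodule section of `μ : a • a → a`. -/
lemma isSeparableMon_of_isSeparableAlg (H : IsSeparableAlg k A) :
    IsSeparableMon (monA k A) := by
  obtain ⟨E, hE, hm⟩ := isSeparableAlg_iff.1 H
  let s : A →ₗ[k] A ⊗[k] A := LinearMap.mulRight k E ∘ₗ (TensorProduct.mk k A A).flip 1
  have s_l : ∀ a b, s (a * b) = (a ⊗ₜ 1) * s b := fun a b => by simp [s, ← mul_assoc]
  have s_r : ∀ a b, s (a * b) = s a * (1 ⊗ₜ b) := fun a b => by
    have e : s (a * b) = (a ⊗ₜ 1) * s b := s_l a b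
    rw [e, show s b = _ from hE b, ← mul_assoc]
    rfl
  have s_mul : ∀ a, LinearMap.mul' k A (s a) = a := fun a => by
    have e : ∀ z : A ⊗[k] A,
        LinearMap.mul' k A ((a ⊗ₜ 1) * z) = a * LinearMap.mul' k A z := fun z => by
      induction z using TensorProduct.induction_on with
      | zero => simp
      | tmul x y => simp [mul_assoc]
      | add x y hx hy => simp only [map_add, mul_add, hx, hy]
    exact (e E).trans (by rw [hm, mul_one])
  have p_l : ∀ (c : Env k A) (z : A ⊗[k] A), projMonA k A ((unitHom k A c ⊗ₜ 1) * z) =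
      (monA k A ⊗ monA k A : AlgBimod k (Env k A)).lact c (projMonA k A z) := fun c z => by
    induction z using TensorProduct.induction_on with
    | zero => simp only [mul_zero, map_zero]
    | tmul x y =>
      rw [Algebra.TensorProduct.tmul_mul_tmul, one_mul]
      exact (tensor_lact (M := monA k A) (N := monA k A) c x y).symm
    | add x y hx hy => simp only [mul_add, map_add, hx, hy]
  have p_r : ∀ (c : Env k A) (z : A ⊗[k] A), projMonA k A (z * (1 ⊗ₜ unitHom k A c)) =
      (monA k A ⊗ monA k A : AlgBimod k (Env k A)).ract c (projMonA k A z) := fun c z => by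
    induction z using TensorProduct.induction_on with
    | zero => simp only [zero_mul, map_zero]
    | tmul x y =>
      rw [Algebra.TensorProduct.tmul_mul_tmul, mul_one]
      exact (tensor_ract (M := monA k A) (N := monA k A) c x y).symm
    | add x y hx hy => simp only [add_mul, map_add, hx, hy]
  let n : monA k A ⟶ monA k A ⊗ monA k A :=
    ⟨projMonA k A ∘ₗ s,
      fun (c : Env k A) (a : A) =>
        (congrArg (projMonA k A) (s_l (unitHom k A c) a)).trans (p_l c _),
      fun (c : Env k A) (a : A) =>
        (congrArg (projMonA k A) (s_r a (unitHom k A c))).trans (p_r c _)⟩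
  refine ⟨n, tensor_ext fun (a b : A) => ?_, tensor_ext fun (a b : A) => ?_,
    hom_ext (LinearMap.ext fun (a : A) => (lin_mul_projMonA (s a)).trans (s_mul a))⟩
  · refine (congrArg _ (lin_whiskerLeft (monA k A) n a b)).trans
      ((left_mul_projMonA a (s b)).trans ?_)
    rw [← s_l]
    exact (congrArg (lin n) (lin_mul_monA a b)).symm
  · refine (congrArg _ (lin_whiskerRight n (monA k A) a b)).trans
      ((right_mul_projMonA b (s a)).trans ?_)
    rw [← s_r]
    exact (congrArg (lin n) (lin_mul_monA a b)).symm

variable (k A) in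
/-- The map `a • a → A`, `a ⊗ c ↦ Σ a eᵢ ⊓ᴸ(fᵢ c)`. -/
def sepPiLTensor : (monA k A ⊗ monA k A : AlgBimod k (Env k A)).carrier →ₗ[k] A :=
  tl (M := monA k A) (N := monA k A) ((LinearMap.mul k A).compl₂ (sepPiL k A))
    (fun (a : A) (b : Env k A) (c : A) => by
      have e : ∀ b : Env k A, ∀ c : A,
          unitHom k A b * sepPiL k A c = sepPiL k A (unitHom k A b * c) := fun b c => by
        induction b using TensorProduct.induction_on with
        | zero => simp
        | tmul x y =>
          rw [unitHom_tmul, mul_assoc, (isLeftBase_piLbar _).mul_sepPiL, mem_mul_sepPiL x.2,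
            mul_assoc]
        | add x y hx hy => simp only [map_add, add_mul, hx, hy]
      exact (mul_assoc a _ _).trans (congrArg (a * ·) (e b c)))

lemma sepPiLTensor_projMonA_tmul (a c : A) :
    sepPiLTensor k A (projMonA k A (a ⊗ₜ c)) = a * sepPiL k A c :=
  tl_tm (M := monA k A) (N := monA k A) ((LinearMap.mul k A).compl₂ (sepPiL k A)) _ a c

/-- From a bimodule section `∇` of `μ : a • a → a`, the left integral
`Σ xⱼ eᵢ ⊓ᴸ(fᵢ yⱼ)` with `∇(1) = Σ xⱼ ⊗ yⱼ`. -/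
lemma exists_leftInt_of_isSeparableMon (H : IsSeparableMon (monA k A)) :
    ∃ t : A, IsNormalizedLeftInt k t := by
  obtain ⟨n, h1, h2, h3⟩ := H
  let n' : A → (monA k A ⊗ monA k A : AlgBimod k (Env k A)).carrier := lin n
  obtain ⟨z, hz⟩ := projMonA_surjective (n' 1)
  let f : A ⊗[k] A →ₗ[k] A := sepPiLTensor k A ∘ₗ projMonA k A
  have f1 : ∀ h z, f ((h ⊗ₜ 1) * z) = h * f z := fun h z => by
    induction z using TensorProduct.induction_on with
    | zero => simp
    | tmul x y => simp [f, sepPiLTensor_projMonA_tmul, mul_assoc]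
    | add x y hx hy => simp only [mul_add, map_add, hx, hy]
  have f2 : ∀ h z, f (z * (1 ⊗ₜ piL k A h)) = f (z * (1 ⊗ₜ h)) := fun h z => by
    induction z using TensorProduct.induction_on with
    | zero => simp
    | tmul x y => simp [f, sepPiLTensor_projMonA_tmul, sepPiL_mul_piL]
    | add x y hx hy => simp only [add_mul, map_add, hx, hy]
  have f3 : ∀ z, piRbar k A (f z) = piRbar k A (LinearMap.mul' k A z) := fun z => by
    induction z using TensorProduct.induction_on with
    | zero => simp
    | tmul x y => simp [f, sepPiLTensor_projMonA_tmul, piRbar_mul_sepPiL]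
    | add x y hx hy => simp only [map_add, hx, hy]
  have e1 : ∀ h : A, projMonA k A ((h ⊗ₜ 1) * z) = n' h := fun h => by
    have e : lin ((α_ (monA k A) (monA k A) (monA k A)).inv ≫ MonObj.mul ▷ monA k A)
        (tm (monA k A) (monA k A ⊗ monA k A) h (n' 1)) = n' (h * 1) :=
      (congrArg _ (lin_whiskerLeft (monA k A) n h (1 : A)).symm).trans
        ((LinearMap.congr_fun (congrArg lin h1) (tmul (M := monA k A) (N := monA k A) h
          (1 : A))).trans (congrArg (lin n) (lin_mul_monA h 1)))
    rwa [← hz, left_mul_projMonA, mul_one] at e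
  have e2 : ∀ h : A, projMonA k A (z * (1 ⊗ₜ h)) = n' h := fun h => by
    have e : lin ((α_ (monA k A) (monA k A) (monA k A)).hom ≫ monA k A ◁ MonObj.mul)
        ((tm (monA k A ⊗ monA k A) (monA k A)).flip h (n' 1)) = n' (1 * h) :=
      (congrArg _ (lin_whiskerRight n (monA k A) (1 : A) h).symm).trans
        ((LinearMap.congr_fun (congrArg lin h2) (tmul (M := monA k A) (N := monA k A) (1 : A)
          h)).trans (congrArg (lin n) (lin_mul_monA 1 h)))
    rwa [← hz, right_mul_projMonA, one_mul] at e
  have e12 : ∀ h, f ((h ⊗ₜ 1) * z) = f (z * (1 ⊗ₜ h)) := fun h =>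
    congrArg (sepPiLTensor k A) ((e1 h).trans (e2 h).symm)
  have e3 : LinearMap.mul' k A z = 1 := by
    rw [← lin_mul_projMonA, hz]
    exact LinearMap.congr_fun (congrArg lin h3) (1 : A)
  exact ⟨f z, fun h => by rw [← f1, e12, ← f2, ← e12, f1], by rw [f3, e3, piRbar_one]⟩

end SeparableMonoid

/-! ### Integrals of the bimonoid `a` -/

section BimonoidIntegrals

open AlgBimod

variable {k : Type v} {A : Type u} [Field k] [Ring A] [Algebra k A] [Coalgebra k A]
  [IsWeakBialgebra k A]

variable (k A) in
/-- The map `R ⊗ R → A`, `p ⊗ q ↦ ψ(p) q`. -/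
def psiFst : baseAlgebra k A ⊗[k] baseAlgebra k A →ₗ[k] A :=
  (baseAlgebra k A).val.toLinearMap ∘ₗ (TensorProduct.lid k (baseAlgebra k A)).toLinearMap ∘ₗ
    LinearMap.rTensor (baseAlgebra k A) psi

variable (k A) in
/-- The map `R ⊗ R → A`, `p ⊗ q ↦ ψ(q) p`. -/
def psiSnd : baseAlgebra k A ⊗[k] baseAlgebra k A →ₗ[k] A :=
  (baseAlgebra k A).val.toLinearMap ∘ₗ (TensorProduct.rid k (baseAlgebra k A)).toLinearMap ∘ₗ
    LinearMap.lTensor (baseAlgebra k A) psi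

@[simp] lemma psiFst_tmul (p q : baseAlgebra k A) :
    psiFst k A (p ⊗ₜ q) = psi p • (q : A) := by simp [psiFst]

@[simp] lemma psiSnd_tmul (p q : baseAlgebra k A) :
    psiSnd k A (p ⊗ₜ q) = psi q • (p : A) := by simp [psiSnd]

lemma psiFst_epsFun (h : A) : psiFst k A (epsFun (k := k) h) = piRbar k A h := by
  have e : ∀ z : A ⊗[k] A, psiFst k A (TensorProduct.map piRR piRbarR z) =
      piRbar k A (sliceL (Coalgebra.counit (R := k)) z) := fun z => by
    induction z using TensorProduct.induction_on with
    | zero => simp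
    | tmul x y =>
      have := psi_piRR (k := k) x 1
      rw [mul_one, OneMemClass.coe_one, mul_one] at this
      simp [this]
    | add x y hx hy => simp only [map_add, hx, hy]
  exact (e _).trans (by rw [sliceL_counit])

lemma psiSnd_epsFun (h : A) : psiSnd k A (epsFun (k := k) h) = piR k A h := by
  have e : ∀ z : A ⊗[k] A, psiSnd k A (TensorProduct.map piRR piRbarR z) =
      piR k A (sliceR (Coalgebra.counit (R := k)) z) := fun z => by
    induction z using TensorProduct.induction_on with
    | zero => simp
    | tmul x y =>
      have := psi_piRbarR (k := k) y 1
      rw [one_mul, OneMemClass.coe_one, one_mul] at this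
      simp [this]
    | add x y hx hy => simp only [map_add, hx, hy]
  exact (e _).trans (by rw [sliceR_counit])

/-- The left action of `a` on `i` through `ε`. -/
lemma xiFun_epsFun_tmul (h : A) (p q : baseAlgebra k A) :
    xiFun k A (epsFun h) (p ⊗ₜ q) = p ⊗ₜ[k] piRbarR (h * (q : A)) := by
  refine (xi_left _ p q).trans ?_
  congr 1
  refine Subtype.ext ?_
  rw [coe_piRbarR, coe_piRbarR, ← comul_mul_piL h q.2, sliceL_right, sliceL_counit, piRbar_mul_piL]

/-- The right action of `a` on `i` through `ε`. -/
lemma xiFun_tmul_epsFun (h : A) (p q : baseAlgebra k A) :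
    xiFun k A (p ⊗ₜ q) (epsFun h) = piRR ((p : A) * h) ⊗ₜ[k] q := by
  refine (xi_right _ p q).trans ?_
  rw [← comul_mem_mul p.2, sliceR_counit]

lemma psiFst_xiFun_congr {v v' : baseAlgebra k A ⊗[k] baseAlgebra k A}
    (h : psiFst k A v = psiFst k A v') (u : baseAlgebra k A ⊗[k] baseAlgebra k A) :
    psiFst k A (xiFun k A u v) = psiFst k A (xiFun k A u v') := by
  have e : ∀ (p q : baseAlgebra k A) (v), psiFst k A (xiFun k A (p ⊗ₜ q) v) =
      Coalgebra.counit (R := k) ((p : A) * psiFst k A v) • (q : A) := fun p q v => by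
    induction v using TensorProduct.induction_on with
    | zero => simp
    | tmul x y => simp [psi_apply, smul_smul, mul_comm]
    | add x y hx hy => simp only [map_add, mul_add, add_smul, hx, hy]
  induction u using TensorProduct.induction_on with
  | zero => simp
  | tmul p q => rw [e, e, h]
  | add x y hx hy => simp only [map_add, LinearMap.add_apply, hx, hy]

lemma psiSnd_xiFun_congr {u u' : baseAlgebra k A ⊗[k] baseAlgebra k A}
    (h : psiSnd k A u = psiSnd k A u') (v : baseAlgebra k A ⊗[k] baseAlgebra k A) :
    psiSnd k A (xiFun k A u v) = psiSnd k A (xiFun k A u' v) := by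
  have e : ∀ (p q : baseAlgebra k A) (u), psiSnd k A (xiFun k A u (p ⊗ₜ q)) =
      Coalgebra.counit (R := k) (psiSnd k A u * (q : A)) • (p : A) := fun p q u => by
    induction u using TensorProduct.induction_on with
    | zero => simp
    | tmul x y => simp [psi_apply, smul_smul, mul_comm]
    | add x y hx hy => simp only [map_add, LinearMap.add_apply, add_mul, add_smul, hx, hy]
  induction v using TensorProduct.induction_on with
  | zero => simp
  | tmul p q => rw [e, e, h]
  | add x y hx hy => simp only [map_add, hx, hy]

lemma psiFst_xiFun_epsFun (h : A) (u : baseAlgebra k A ⊗[k] baseAlgebra k A) :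
    psiFst k A (xiFun k A (epsFun h) u) = piRbar k A (h * psiFst k A u) := by
  induction u using TensorProduct.induction_on with
  | zero => simp
  | tmul p q => simp [xiFun_epsFun_tmul]
  | add x y hx hy => simp only [map_add, mul_add, hx, hy]

lemma psiSnd_xiFun_epsFun (h : A) (u : baseAlgebra k A ⊗[k] baseAlgebra k A) :
    psiSnd k A (xiFun k A u (epsFun h)) = piR k A (psiSnd k A u * h) := by
  induction u using TensorProduct.induction_on with
  | zero => simp
  | tmul p q => simp [xiFun_tmul_epsFun]
  | add x y hx hy => simp only [map_add, LinearMap.add_apply, add_mul, hx, hy]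

/-! ### Left integrals -/

variable (k A) in
/-- The underlying vector space of `a • i`. -/
abbrev TensAI : Type u := (monA k A ⊗ unitI k A : AlgBimod k (Env k A)).carrier

variable (k A) in
/-- The class of `a ⊗ u` in `a • i`. -/
def tensAI : A →ₗ[k] baseAlgebra k A ⊗[k] baseAlgebra k A →ₗ[k] TensAI k A :=
  tm (monA k A) (unitI k A)

lemma tensAI_ext {P : Type*} [AddCommGroup P] [Module k P] {f g : TensAI k A →ₗ[k] P}
    (h : ∀ a u, f (tensAI k A a u) = g (tensAI k A a u)) : f = g :=
  tm_ext (M := monA k A) (N := unitI k A) h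

lemma tensAI_lact (c : Env k A) (a : A) (u : baseAlgebra k A ⊗[k] baseAlgebra k A) :
    (monA k A ⊗ unitI k A : AlgBimod k (Env k A)).lact c (tensAI k A a u) =
      tensAI k A (unitHom k A c * a) u :=
  tensor_lact (M := monA k A) (N := unitI k A) c a u

lemma tensAI_ract (c : Env k A) (a : A) (u : baseAlgebra k A ⊗[k] baseAlgebra k A) :
    (monA k A ⊗ unitI k A : AlgBimod k (Env k A)).ract c (tensAI k A a u) =
      tensAI k A a (iR c u) :=
  tensor_ract (M := monA k A) (N := unitI k A) c a u

variable (k) in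
/-- The left action of `a` on `a • i`. -/
def actAI (a : A) : TensAI k A →ₗ[k] TensAI k A :=
  lin ((α_ (monA k A) (monA k A) (unitI k A)).inv ≫ MonObj.mul ▷ unitI k A) ∘ₗ
    tm (monA k A) (monA k A ⊗ unitI k A) a

lemma actAI_tensAI (a b : A) (u : baseAlgebra k A ⊗[k] baseAlgebra k A) :
    actAI k a (tensAI k A b u) = tensAI k A (a * b) u :=
  (congrArg (lin (MonObj.mul ▷ unitI k A)) (lin_associator_inv (M := monA k A) (N := monA k A)
    (P := unitI k A) a b u)).trans ((lin_whiskerRight (M := monA k A ⊗ monA k A) _ _ _ _).trans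
      (congrArg (fun c => tensAI k A c u) (lin_mul_monA a b)))

variable (k A) in
/-- The right action of `i` on `a • i`. -/
def ractAI (v : baseAlgebra k A ⊗[k] baseAlgebra k A) : TensAI k A →ₗ[k] TensAI k A :=
  lin ((α_ (monA k A) (unitI k A) (unitI k A)).hom ≫ monA k A ◁ MonObj.mul) ∘ₗ
    (tm (monA k A ⊗ unitI k A) (unitI k A)).flip v

lemma ractAI_tensAI (a : A) (u v : baseAlgebra k A ⊗[k] baseAlgebra k A) :
    ractAI k A v (tensAI k A a u) = tensAI k A a (xiFun k A u v) :=
  (congrArg (lin (monA k A ◁ MonObj.mul)) (lin_associator_hom (M := monA k A) (N := unitI k A)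
    (P := unitI k A) a u v)).trans ((lin_whiskerLeft (monA k A) (N := unitI k A ⊗ unitI k A)
      _ _ _).trans (congrArg (tensAI k A a) (lin_xiZero u v)))

variable (k A) in
/-- The left action `a • i → i`. -/
def actI : TensAI k A →ₗ[k] baseAlgebra k A ⊗[k] baseAlgebra k A :=
  lin (epsHom k A ▷ unitI k A ≫ MonObj.mul)

lemma actI_tensAI (a : A) (u : baseAlgebra k A ⊗[k] baseAlgebra k A) :
    actI k A (tensAI k A a u) = xiFun k A (epsFun a) u :=
  (congrArg (lin (MonObj.mul : unitI k A ⊗ unitI k A ⟶ unitI k A))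
    (lin_whiskerRight (epsHom k A) (unitI k A) a u)).trans (lin_xiZero _ _)

lemma isNormalizedLeftIntegral_iff (θ : unitI k A ⟶ monA k A ⊗ unitI k A)
    (f : baseAlgebra k A ⊗[k] baseAlgebra k A →ₗ[k] TensAI k A) (hf : lin θ = f) :
    IsNormalizedLeftIntegral (epsHom k A) θ ↔
      (∀ (a : A) u, actAI k a (f u) = f (xiFun k A (epsFun a) u)) ∧
      (∀ u v, ractAI k A v (f u) = f (xiFun k A u v)) ∧ ∀ u, actI k A (f u) = u := by
  subst hf
  have h1 : ∀ (a : A) (u : baseAlgebra k A ⊗[k] baseAlgebra k A),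
      lin (epsHom k A ▷ unitI k A ≫ MonObj.mul ≫ θ)
        (tmul (M := monA k A) (N := unitI k A) a u) = lin θ (xiFun k A (epsFun a) u) :=
    fun a u => congrArg (lin θ) (actI_tensAI a u)
  have h2 : ∀ (u v : baseAlgebra k A ⊗[k] baseAlgebra k A),
      lin (MonObj.mul ≫ θ) (tmul (M := unitI k A) (N := unitI k A) u v) =
        lin θ (xiFun k A u v) :=
    fun u v => congrArg (lin θ) (lin_xiZero u v)
  have h3 : ∀ (a : A) (u : baseAlgebra k A ⊗[k] baseAlgebra k A),
      lin (monA k A ◁ θ ≫ (α_ (monA k A) (monA k A) (unitI k A)).inv ≫ MonObj.mul ▷ unitI k A)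
        (tmul (M := monA k A) (N := unitI k A) a u) = actAI k a (lin θ u) :=
    fun a u => congrArg
      (lin ((α_ (monA k A) (monA k A) (unitI k A)).inv ≫ MonObj.mul ▷ unitI k A))
      (lin_whiskerLeft (monA k A) θ a u)
  have h4 : ∀ (u v : baseAlgebra k A ⊗[k] baseAlgebra k A),
      lin (θ ▷ unitI k A ≫ (α_ (monA k A) (unitI k A) (unitI k A)).hom ≫ monA k A ◁ MonObj.mul)
        (tmul (M := unitI k A) (N := unitI k A) u v) = ractAI k A v (lin θ u) :=
    fun u v => congrArg
      (lin ((α_ (monA k A) (unitI k A) (unitI k A)).hom ≫ monA k A ◁ MonObj.mul))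
      (lin_whiskerRight θ (unitI k A) u v)
  constructor
  · rintro ⟨l, r, n⟩
    exact ⟨fun a u => (h3 a u).symm.trans ((LinearMap.congr_fun (congrArg lin l) _).trans (h1 a u)),
      fun u v => (h4 u v).symm.trans ((LinearMap.congr_fun (congrArg lin r) _).trans (h2 u v)),
      fun u => LinearMap.congr_fun (congrArg lin n) u⟩
  · rintro ⟨l, r, n⟩
    exact ⟨tensor_ext fun a u => (h3 a u).trans ((l a u).trans (h1 a u).symm),
      tensor_ext fun u v => (h4 u v).trans ((r u v).trans (h2 u v).symm),
      hom_ext (LinearMap.ext n)⟩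

variable (k A) in
/-- The map `a • i → A`, `h ⊗ (p ⊗ q) ↦ ψ(p) h q ⊓ᴸ(1₁) ⊓̄ᴿ(1₂)`. -/
def leftAvgTens : TensAI k A →ₗ[k] A :=
  tl (M := monA k A) (N := unitI k A)
    ((LinearMap.mul k A).compl₂ (LinearMap.mulRight k (leftAvg k A) ∘ₗ psiFst k A))
    (fun (a : A) (c : Env k A) (u : baseAlgebra k A ⊗[k] baseAlgebra k A) => by
      have e : ∀ (c : Env k A) (u : baseAlgebra k A ⊗[k] baseAlgebra k A),
          unitHom k A c * (psiFst k A u * leftAvg k A) =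
            psiFst k A (iL c u) * leftAvg k A := fun c u => by
        induction c using TensorProduct.induction_on with
        | zero => simp
        | tmul x y =>
          induction u using TensorProduct.induction_on with
          | zero => simp
          | tmul p q =>
            simp only [unitHom_tmul, psiFst_tmul, iL_tmul, smul_mul_assoc, mul_smul_comm,
              MulMemClass.coe_mul, coe_nakR]
            rw [mul_assoc (x : A), ← mul_assoc (piLbar k A _), ← (isLeftBase_piLbar _).commute q.2,
              mul_assoc (q : A), piLbar_mul_leftAvg]
            simp only [mul_assoc]
          | add u u' hu hu' => simp only [map_add, add_mul, mul_add, hu, hu']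
        | add x y hx hy => simp only [map_add, add_mul, hx, hy, LinearMap.add_apply]
      exact (mul_assoc a _ _).trans (congrArg (a * ·) (e c u)))

lemma leftAvgTens_tensAI (a : A) (u : baseAlgebra k A ⊗[k] baseAlgebra k A) :
    leftAvgTens k A (tensAI k A a u) = a * (psiFst k A u * leftAvg k A) :=
  tl_tm (M := monA k A) (N := unitI k A)
    ((LinearMap.mul k A).compl₂ (LinearMap.mulRight k (leftAvg k A) ∘ₗ psiFst k A)) _ a u

/-- From `θ : i → a • i`, the element of `A` obtained by applying `leftAvgTens` to `θ(1)`, where `1`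
is the unit of the algebra `i`. It is an integral because `h θ(1) = θ(ε(h)) = θ(1) ε(h)` and
`leftAvgTens` only sees `(ψ ⊗ id)(ε(h)) = ⊓̄ᴿ(h)`, which does not change if `h` is replaced by
`⊓ᴸ(h)`. -/
lemma exists_leftInt_of_isNormalizedLeftIntegral {θ : unitI k A ⟶ monA k A ⊗ unitI k A}
    (H : IsNormalizedLeftIntegral (epsHom k A) θ) : ∃ t : A, IsNormalizedLeftInt k t := by
  obtain ⟨f, hf⟩ : ∃ f : baseAlgebra k A ⊗[k] baseAlgebra k A →ₗ[k] TensAI k A, lin θ = f :=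
    ⟨_, rfl⟩
  obtain ⟨h1, h2, h3⟩ := (isNormalizedLeftIntegral_iff θ f hf).1 H
  have e1 : ∀ (a : A) (x : TensAI k A),
      leftAvgTens k A (actAI k a x) = a * leftAvgTens k A x := fun a x =>
    LinearMap.congr_fun (f := leftAvgTens k A ∘ₗ actAI k a)
      (g := LinearMap.mulLeft k a ∘ₗ leftAvgTens k A) (tensAI_ext fun b u => by
        simp [actAI_tensAI, leftAvgTens_tensAI, mul_assoc]) x
  have e2 : ∀ (x : TensAI k A) {v v' : baseAlgebra k A ⊗[k] baseAlgebra k A},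
      psiFst k A v = psiFst k A v' →
        leftAvgTens k A (ractAI k A v x) = leftAvgTens k A (ractAI k A v' x) := fun x v v' h =>
    LinearMap.congr_fun (f := leftAvgTens k A ∘ₗ ractAI k A v)
      (g := leftAvgTens k A ∘ₗ ractAI k A v') (tensAI_ext fun b u => by
        simp [ractAI_tensAI, leftAvgTens_tensAI, psiFst_xiFun_congr h]) x
  have e3 : ∀ x : TensAI k A,
      piRbar k A (leftAvgTens k A x) = psiFst k A (actI k A x) := fun x =>
    LinearMap.congr_fun (f := piRbar k A ∘ₗ leftAvgTens k A)
      (g := psiFst k A ∘ₗ actI k A) (tensAI_ext fun b u => by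
        simp [actI_tensAI, leftAvgTens_tensAI, ← mul_assoc, piRbar_mul_leftAvg,
          psiFst_xiFun_epsFun]) x
  have e4 : ∀ a : A, a * leftAvgTens k A (f (epsFun 1)) =
      leftAvgTens k A (ractAI k A (epsFun a) (f (epsFun 1))) := fun a => by
    rw [← e1, h1, h2, xi_one_left, xi_one_right]
  refine ⟨leftAvgTens k A (f (epsFun 1)), fun h => ?_, ?_⟩
  · rw [e4, e4]
    exact e2 _ (by rw [psiFst_epsFun, psiFst_epsFun, piRbar_piL])
  · rw [e3, h3, psiFst_epsFun, piRbar_one]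

/-- A normalized left integral `t` in `A` induces `θ : p ⊗ q ↦ q t ⊗ (p ⊗ 1)`. -/
lemma _root_.IsNormalizedLeftInt.exists_isNormalizedLeftIntegral {t : A}
    (ht : IsNormalizedLeftInt k t) :
    ∃ θ : unitI k A ⟶ monA k A ⊗ unitI k A, IsNormalizedLeftIntegral (epsHom k A) θ := by
  let f : baseAlgebra k A ⊗[k] baseAlgebra k A →ₗ[k] TensAI k A :=
    TensorProduct.lift ((tensAI k A).compl₁₂
      (LinearMap.mulRight k t ∘ₗ (baseAlgebra k A).val.toLinearMap)
      ((TensorProduct.mk k (baseAlgebra k A) (baseAlgebra k A)).flip 1)).flip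
  have f_tmul : ∀ p q : baseAlgebra k A,
      f (p ⊗ₜ q) = tensAI k A ((q : A) * t) (p ⊗ₜ 1) := fun p q => by simp [f]
  have f_l : ∀ (c : Env k A) (u), f (iL c u) =
      (monA k A ⊗ unitI k A : AlgBimod k (Env k A)).lact c (f u) := fun c u => by
    induction c using TensorProduct.induction_on with
    | zero => simp
    | tmul x y =>
      induction u using TensorProduct.induction_on with
      | zero => simp
      | tmul p q =>
        have e : piLbar k A (y.unop : A) * t = nak k A (y.unop : A) * t := by
          rw [nak_eq, piRbar_mul_of_mul_left ht.mul_left]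
        have e2 : (x : A) * piLbar k A (y.unop : A) * ((q : A) * t) =
            (x : A) * (q : A) * nak k A (y.unop : A) * t := by
          rw [mul_assoc (x : A), ← mul_assoc (piLbar k A _), ← (isLeftBase_piLbar _).commute q.2,
            mul_assoc (q : A), e]
          simp only [mul_assoc]
        rw [iL_tmul, f_tmul, f_tmul, tensAI_lact, unitHom_tmul, e2]
        rfl
      | add u u' hu hu' => simp only [map_add, hu, hu']
    | add x y hx hy => simp only [map_add, LinearMap.add_apply, hx, hy]
  have f_r : ∀ (c : Env k A) (u), f (iR c u) =
      (monA k A ⊗ unitI k A : AlgBimod k (Env k A)).ract c (f u) := fun c u => by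
    induction c using TensorProduct.induction_on with
    | zero => simp
    | tmul x y =>
      induction u using TensorProduct.induction_on with
      | zero => simp
      | tmul p q => rw [iR_tmul, f_tmul, f_tmul, tensAI_ract, iR_tmul]
      | add u u' hu hu' => simp only [map_add, hu, hu']
    | add x y hx hy => simp only [map_add, LinearMap.add_apply, hx, hy]
  refine ⟨⟨f, f_l, f_r⟩, (isNormalizedLeftIntegral_iff _ f rfl).2
    ⟨fun a u => ?_, fun u v => ?_, fun u => ?_⟩⟩
  · induction u using TensorProduct.induction_on with
    | zero => simp
    | tmul p q =>
      rw [f_tmul, actAI_tensAI, xiFun_epsFun_tmul, f_tmul, coe_piRbarR,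
        piRbar_mul_of_mul_left ht.mul_left, mul_assoc]
    | add u u' hu hu' => simp only [map_add, hu, hu']
  · induction u using TensorProduct.induction_on with
    | zero => simp
    | tmul p q =>
      rw [f_tmul, ractAI_tensAI]
      induction v using TensorProduct.induction_on with
      | zero => simp
      | tmul p' q' =>
        rw [xiFun_tmul, xiFun_tmul, map_smul, map_smul, f_tmul]
      | add v v' hv hv' => simp only [map_add, hv, hv']
    | add u u' hu hu' => simp only [map_add, LinearMap.add_apply, hu, hu']
  · induction u using TensorProduct.induction_on with
    | zero => simp
    | tmul p q =>
      rw [f_tmul, actI_tensAI, xiFun_epsFun_tmul]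
      congr 1
      refine Subtype.ext ?_
      rw [coe_piRbarR, OneMemClass.coe_one, mul_one, piRbar_mem_mul _ q.2, ht.normalized, mul_one]
    | add u u' hu hu' => simp only [map_add, hu, hu']

end BimonoidIntegrals

/-! ### Right integrals -/

section BimonoidRightIntegrals

open AlgBimod

variable {k : Type v} {A : Type u} [Field k] [Ring A] [Algebra k A] [Coalgebra k A]
  [IsWeakBialgebra k A]

variable (k A) in
/-- The underlying vector space of `i • a`. -/
abbrev TensIA : Type u := (unitI k A ⊗ monA k A : AlgBimod k (Env k A)).carrier

variable (k A) in
/-- The class of `u ⊗ a` in `i • a`. -/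
def tensIA : baseAlgebra k A ⊗[k] baseAlgebra k A →ₗ[k] A →ₗ[k] TensIA k A :=
  tm (unitI k A) (monA k A)

lemma tensIA_ext {P : Type*} [AddCommGroup P] [Module k P] {f g : TensIA k A →ₗ[k] P}
    (h : ∀ u a, f (tensIA k A u a) = g (tensIA k A u a)) : f = g :=
  tm_ext (M := unitI k A) (N := monA k A) h

lemma tensIA_lact (c : Env k A) (u : baseAlgebra k A ⊗[k] baseAlgebra k A) (a : A) :
    (unitI k A ⊗ monA k A : AlgBimod k (Env k A)).lact c (tensIA k A u a) =
      tensIA k A (iL c u) a :=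
  tensor_lact (M := unitI k A) (N := monA k A) c u a

lemma tensIA_ract (c : Env k A) (u : baseAlgebra k A ⊗[k] baseAlgebra k A) (a : A) :
    (unitI k A ⊗ monA k A : AlgBimod k (Env k A)).ract c (tensIA k A u a) =
      tensIA k A u (a * unitHom k A c) :=
  tensor_ract (M := unitI k A) (N := monA k A) c u a

variable (k) in
/-- The right action of `a` on `i • a`. -/
def ractIA (a : A) : TensIA k A →ₗ[k] TensIA k A :=
  lin ((α_ (unitI k A) (monA k A) (monA k A)).hom ≫ unitI k A ◁ MonObj.mul) ∘ₗ
    (tm (unitI k A ⊗ monA k A) (monA k A)).flip a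

lemma ractIA_tensIA (a b : A) (u : baseAlgebra k A ⊗[k] baseAlgebra k A) :
    ractIA k a (tensIA k A u b) = tensIA k A u (b * a) :=
  (congrArg (lin (unitI k A ◁ MonObj.mul)) (lin_associator_hom (M := unitI k A) (N := monA k A)
    (P := monA k A) u b a)).trans ((lin_whiskerLeft (unitI k A) (N := monA k A ⊗ monA k A)
      _ _ _).trans (congrArg (tensIA k A u) (lin_mul_monA b a)))

variable (k A) in
/-- The left action of `i` on `i • a`. -/
def actIA (v : baseAlgebra k A ⊗[k] baseAlgebra k A) : TensIA k A →ₗ[k] TensIA k A :=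
  lin ((α_ (unitI k A) (unitI k A) (monA k A)).inv ≫ MonObj.mul ▷ monA k A) ∘ₗ
    tm (unitI k A) (unitI k A ⊗ monA k A) v

lemma actIA_tensIA (u v : baseAlgebra k A ⊗[k] baseAlgebra k A) (a : A) :
    actIA k A v (tensIA k A u a) = tensIA k A (xiFun k A v u) a :=
  (congrArg (lin (MonObj.mul ▷ monA k A)) (lin_associator_inv (M := unitI k A) (N := unitI k A)
    (P := monA k A) v u a)).trans ((lin_whiskerRight (M := unitI k A ⊗ unitI k A) _ _ _ _).trans
      (congrArg (fun w => tensIA k A w a) (lin_xiZero v u)))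

variable (k A) in
/-- The right action `i • a → i`. -/
def ractI : TensIA k A →ₗ[k] baseAlgebra k A ⊗[k] baseAlgebra k A :=
  lin (unitI k A ◁ epsHom k A ≫ MonObj.mul)

lemma ractI_tensIA (u : baseAlgebra k A ⊗[k] baseAlgebra k A) (a : A) :
    ractI k A (tensIA k A u a) = xiFun k A u (epsFun a) :=
  (congrArg (lin (MonObj.mul : unitI k A ⊗ unitI k A ⟶ unitI k A))
    (lin_whiskerLeft (unitI k A) (epsHom k A) u a)).trans (lin_xiZero _ _)

lemma isNormalizedRightIntegral_iff (θ : unitI k A ⟶ unitI k A ⊗ monA k A)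
    (f : baseAlgebra k A ⊗[k] baseAlgebra k A →ₗ[k] TensIA k A) (hf : lin θ = f) :
    IsNormalizedRightIntegral (epsHom k A) θ ↔
      (∀ (u) (a : A), ractIA k a (f u) = f (xiFun k A u (epsFun a))) ∧
      (∀ u v, actIA k A u (f v) = f (xiFun k A u v)) ∧ ∀ u, ractI k A (f u) = u := by
  subst hf
  have h1 : ∀ (u : baseAlgebra k A ⊗[k] baseAlgebra k A) (a : A),
      lin (unitI k A ◁ epsHom k A ≫ MonObj.mul ≫ θ)
        (tmul (M := unitI k A) (N := monA k A) u a) = lin θ (xiFun k A u (epsFun a)) :=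
    fun u a => congrArg (lin θ) (ractI_tensIA u a)
  have h2 : ∀ (u v : baseAlgebra k A ⊗[k] baseAlgebra k A),
      lin (MonObj.mul ≫ θ) (tmul (M := unitI k A) (N := unitI k A) u v) =
        lin θ (xiFun k A u v) :=
    fun u v => congrArg (lin θ) (lin_xiZero u v)
  have h3 : ∀ (u : baseAlgebra k A ⊗[k] baseAlgebra k A) (a : A),
      lin (θ ▷ monA k A ≫ (α_ (unitI k A) (monA k A) (monA k A)).hom ≫ unitI k A ◁ MonObj.mul)
        (tmul (M := unitI k A) (N := monA k A) u a) = ractIA k a (lin θ u) :=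
    fun u a => congrArg
      (lin ((α_ (unitI k A) (monA k A) (monA k A)).hom ≫ unitI k A ◁ MonObj.mul))
      (lin_whiskerRight θ (monA k A) u a)
  have h4 : ∀ (u v : baseAlgebra k A ⊗[k] baseAlgebra k A),
      lin (unitI k A ◁ θ ≫ (α_ (unitI k A) (unitI k A) (monA k A)).inv ≫ MonObj.mul ▷ monA k A)
        (tmul (M := unitI k A) (N := unitI k A) u v) = actIA k A u (lin θ v) :=
    fun u v => congrArg
      (lin ((α_ (unitI k A) (unitI k A) (monA k A)).inv ≫ MonObj.mul ▷ monA k A))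
      (lin_whiskerLeft (unitI k A) θ u v)
  constructor
  · rintro ⟨r, l, n⟩
    exact ⟨fun u a => (h3 u a).symm.trans ((LinearMap.congr_fun (congrArg lin r) _).trans (h1 u a)),
      fun u v => (h4 u v).symm.trans ((LinearMap.congr_fun (congrArg lin l) _).trans (h2 u v)),
      fun u => LinearMap.congr_fun (congrArg lin n) u⟩
  · rintro ⟨r, l, n⟩
    exact ⟨tensor_ext fun u a => (h3 u a).trans ((r u a).trans (h1 u a).symm),
      tensor_ext fun u v => (h4 u v).trans ((l u v).trans (h2 u v).symm),
      hom_ext (LinearMap.ext n)⟩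

variable (k A) in
/-- The map `i • a → A`, `(p ⊗ q) ⊗ h ↦ ψ(q) ⊓̄ᴸ(1₁) ⊓ᴿ(1₂) p h`. -/
def rightAvgTens : TensIA k A →ₗ[k] A :=
  tl (M := unitI k A) (N := monA k A)
    (LinearMap.mul k A ∘ₗ LinearMap.mulLeft k (rightAvg k A) ∘ₗ psiSnd k A)
    (fun (u : baseAlgebra k A ⊗[k] baseAlgebra k A) (c : Env k A) (a : A) => by
      have e : ∀ (c : Env k A) (u : baseAlgebra k A ⊗[k] baseAlgebra k A),
          rightAvg k A * psiSnd k A (iR c u) =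
            rightAvg k A * psiSnd k A u * unitHom k A c := fun c u => by
        induction c using TensorProduct.induction_on with
        | zero => simp
        | tmul x y =>
          induction u using TensorProduct.induction_on with
          | zero => simp
          | tmul p q =>
            simp only [unitHom_tmul, psiSnd_tmul, iR_tmul, smul_mul_assoc, mul_smul_comm,
              MulMemClass.coe_mul]
            congr 1
            rw [← mul_assoc, ← mul_assoc, ← rightAvg_mul_piLbar y.unop.2, mul_assoc _ _ (p : A),
              mul_assoc _ _ (x : A), mul_assoc _ _ (x : A),
              ← (isLeftBase_piLbar (y.unop : A)).commute
                (mul_mem p.2 x.2 : (p : A) * x ∈ baseAlgebra k A)]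
            simp only [mul_assoc]
          | add u u' hu hu' => simp only [map_add, add_mul, mul_add, hu, hu']
        | add x y hx hy => simp only [map_add, mul_add, hx, hy, LinearMap.add_apply]
      exact (congrArg (· * a) (e c u)).trans (mul_assoc _ _ a))

lemma rightAvgTens_tensIA (u : baseAlgebra k A ⊗[k] baseAlgebra k A) (a : A) :
    rightAvgTens k A (tensIA k A u a) = rightAvg k A * psiSnd k A u * a :=
  tl_tm (M := unitI k A) (N := monA k A)
    (LinearMap.mul k A ∘ₗ LinearMap.mulLeft k (rightAvg k A) ∘ₗ psiSnd k A) _ u a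

/-- From `θ : i → i • a`, the element of `A` obtained by applying `rightAvgTens` to `θ(1)`, where
`1` is the unit of the algebra `i`. It is an integral because `θ(1) h = θ(ε(h)) = ε(h) θ(1)` and
`rightAvgTens` only sees `(id ⊗ ψ)(ε(h)) = ⊓ᴿ(h)`. -/
lemma exists_rightInt_of_isNormalizedRightIntegral {θ : unitI k A ⟶ unitI k A ⊗ monA k A}
    (H : IsNormalizedRightIntegral (epsHom k A) θ) : ∃ t : A, IsNormalizedRightInt k t := by
  obtain ⟨f, hf⟩ : ∃ f : baseAlgebra k A ⊗[k] baseAlgebra k A →ₗ[k] TensIA k A, lin θ = f :=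
    ⟨_, rfl⟩
  obtain ⟨h1, h2, h3⟩ := (isNormalizedRightIntegral_iff θ f hf).1 H
  have e1 : ∀ (a : A) (x : TensIA k A),
      rightAvgTens k A (ractIA k a x) = rightAvgTens k A x * a := fun a x =>
    LinearMap.congr_fun (f := rightAvgTens k A ∘ₗ ractIA k a)
      (g := LinearMap.mulRight k a ∘ₗ rightAvgTens k A) (tensIA_ext fun u b => by
        simp [ractIA_tensIA, rightAvgTens_tensIA, mul_assoc]) x
  have e2 : ∀ (x : TensIA k A) {v v' : baseAlgebra k A ⊗[k] baseAlgebra k A},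
      psiSnd k A v = psiSnd k A v' →
        rightAvgTens k A (actIA k A v x) = rightAvgTens k A (actIA k A v' x) := fun x v v' h =>
    LinearMap.congr_fun (f := rightAvgTens k A ∘ₗ actIA k A v)
      (g := rightAvgTens k A ∘ₗ actIA k A v') (tensIA_ext fun u b => by
        simp [actIA_tensIA, rightAvgTens_tensIA, psiSnd_xiFun_congr h]) x
  have e3 : ∀ x : TensIA k A,
      piR k A (rightAvgTens k A x) = psiSnd k A (ractI k A x) := fun x =>
    LinearMap.congr_fun (f := piR k A ∘ₗ rightAvgTens k A)
      (g := psiSnd k A ∘ₗ ractI k A) (tensIA_ext fun u b => by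
        simp [ractI_tensIA, rightAvgTens_tensIA, mul_assoc, piR_rightAvg_mul,
          psiSnd_xiFun_epsFun]) x
  have e4 : ∀ a : A, rightAvgTens k A (f (epsFun 1)) * a =
      rightAvgTens k A (actIA k A (epsFun a) (f (epsFun 1))) := fun a => by
    rw [← e1, h1, h2, xi_one_left, xi_one_right]
  refine ⟨rightAvgTens k A (f (epsFun 1)), fun h => ?_, ?_⟩
  · rw [e4, e4]
    exact e2 _ (by rw [psiSnd_epsFun, psiSnd_epsFun, piR_of_mem ⟨h, rfl⟩])
  · rw [e3, h3, psiSnd_epsFun, piR_one]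

/-- A normalized right integral `t` in `A` induces `θ : p ⊗ q ↦ (1 ⊗ q) ⊗ t p`. -/
lemma _root_.IsNormalizedRightInt.exists_isNormalizedRightIntegral {t : A}
    (ht : IsNormalizedRightInt k t) :
    ∃ θ : unitI k A ⟶ unitI k A ⊗ monA k A, IsNormalizedRightIntegral (epsHom k A) θ := by
  let f : baseAlgebra k A ⊗[k] baseAlgebra k A →ₗ[k] TensIA k A :=
    TensorProduct.lift ((tensIA k A).compl₁₂
      (TensorProduct.mk k (baseAlgebra k A) (baseAlgebra k A) 1)
      (LinearMap.mulLeft k t ∘ₗ (baseAlgebra k A).val.toLinearMap)).flip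
  have f_tmul : ∀ p q : baseAlgebra k A,
      f (p ⊗ₜ q) = tensIA k A (1 ⊗ₜ q) (t * (p : A)) := fun p q => by simp [f]
  have f_l : ∀ (c : Env k A) (u), f (iL c u) =
      (unitI k A ⊗ monA k A : AlgBimod k (Env k A)).lact c (f u) := fun c u => by
    induction c using TensorProduct.induction_on with
    | zero => simp
    | tmul x y =>
      induction u using TensorProduct.induction_on with
      | zero => simp
      | tmul p q => rw [iL_tmul, f_tmul, f_tmul, tensIA_lact, iL_tmul]
      | add u u' hu hu' => simp only [map_add, hu, hu']
    | add x y hx hy => simp only [map_add, LinearMap.add_apply, hx, hy]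
  have f_r : ∀ (c : Env k A) (u), f (iR c u) =
      (unitI k A ⊗ monA k A : AlgBimod k (Env k A)).ract c (f u) := fun c u => by
    induction c using TensorProduct.induction_on with
    | zero => simp
    | tmul x y =>
      induction u using TensorProduct.induction_on with
      | zero => simp
      | tmul p q =>
        have e : t * (p : A) * ((x : A) * piLbar k A (y.unop : A)) =
            t * ((y.unop : A) * p * x) := by
          rw [mul_assoc, ← mul_assoc (p : A), (isLeftBase_piLbar (y.unop : A)).commute
              (mul_mem p.2 x.2 : (p : A) * x ∈ baseAlgebra k A), ← mul_assoc,
            mul_piLbar_of_mul_right ht.mul_right]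
          simp only [mul_assoc]
        rw [iR_tmul, f_tmul, f_tmul, tensIA_ract, unitHom_tmul, e]
        rfl
      | add u u' hu hu' => simp only [map_add, hu, hu']
    | add x y hx hy => simp only [map_add, LinearMap.add_apply, hx, hy]
  refine ⟨⟨f, f_l, f_r⟩, (isNormalizedRightIntegral_iff _ f rfl).2
    ⟨fun u a => ?_, fun u v => ?_, fun u => ?_⟩⟩
  · induction u using TensorProduct.induction_on with
    | zero => simp
    | tmul p q =>
      rw [f_tmul, ractIA_tensIA, xiFun_tmul_epsFun, f_tmul, coe_piRR, ← ht.mul_right, mul_assoc]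
    | add u u' hu hu' => simp only [map_add, LinearMap.add_apply, hu, hu']
  · induction v using TensorProduct.induction_on with
    | zero => simp
    | tmul p q =>
      rw [f_tmul, actIA_tensIA]
      induction u using TensorProduct.induction_on with
      | zero => simp
      | tmul p' q' =>
        rw [xiFun_tmul, xiFun_tmul, map_smul, map_smul, f_tmul, LinearMap.smul_apply]
      | add v v' hv hv' => simp only [map_add, LinearMap.add_apply, hv, hv']
    | add u u' hu hu' => simp only [map_add, hu, hu']
  · induction u using TensorProduct.induction_on with
    | zero => simp
    | tmul p q =>
      rw [f_tmul, ractI_tensIA, xiFun_tmul_epsFun]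
      congr 1
      refine Subtype.ext ?_
      rw [coe_piRR, OneMemClass.coe_one, one_mul, piR_mul_mem _ p.2, ht.normalized, one_mul]
    | add u u' hu hu' => simp only [map_add, hu, hu']

end BimonoidRightIntegrals

end WeakBialg

theorem mainTheorem6 (k : Type v) (A : Type u) [Field k] [Ring A] [Algebra k A] [Coalgebra k A]
    [IsWeakHopfAlgebra k A] :
    List.TFAE [
      -- `A` is a separable `k`-algebra
      IsSeparableAlg k A,
      -- `A` with `η : R ⊗ Rᵒᵖ → A` is a separable monoid in `bim(R ⊗ Rᵒᵖ)`
      IsSeparableMon (WeakBialg.monA k A),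
      -- there is a normalized left integral in `A`
      ∃ t : A, IsNormalizedLeftInt k t,
      -- there is a normalized left integral `i ⟶ a • i` of the bimonoid `a` in the duoidal category `bim(R ⊗ Rᵒᵖ)`
      ∃ θ : WeakBialg.unitI k A ⟶ WeakBialg.monA k A ⊗ WeakBialg.unitI k A,
        IsNormalizedLeftIntegral (WeakBialg.epsHom k A) θ,
      -- the same in terms of elements
      ∃ t : A, IsNormalizedLeftInt k t ∧
        ∀ x ∈ WeakBialg.baseAlgebra k A,
          t * WeakBialg.piL k A x = t * WeakBialg.piRbar k A (WeakBialg.piLbar k A x),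
      -- there is a normalized right integral in `A`
      ∃ t : A, IsNormalizedRightInt k t,
      -- there is a normalized right integral `i ⟶ i • a` of the bimonoid `a` in the duoidal category `bim(R ⊗ Rᵒᵖ)`
      ∃ θ : WeakBialg.unitI k A ⟶ WeakBialg.unitI k A ⊗ WeakBialg.monA k A,
        IsNormalizedRightIntegral (WeakBialg.epsHom k A) θ,
      -- the same in terms of elements
      ∃ t : A, IsNormalizedRightInt k t ∧
        ∀ x ∈ WeakBialg.baseAlgebra k A,
          WeakBialg.piLbar k A x * t = WeakBialg.piR k A (WeakBialg.piL k A x) * t] := by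
  tfae_have 1 → 2 := WeakBialg.isSeparableMon_of_isSeparableAlg
  tfae_have 2 → 3 := WeakBialg.exists_leftInt_of_isSeparableMon
  tfae_have 3 → 1 := fun ⟨_, ht⟩ => ht.isSeparableAlg
  tfae_have 3 → 4 := fun ⟨_, ht⟩ => ht.exists_isNormalizedLeftIntegral
  tfae_have 4 → 3 := fun ⟨_, hθ⟩ => WeakBialg.exists_leftInt_of_isNormalizedLeftIntegral hθ
  tfae_have 3 → 5 := fun ⟨t, ht⟩ => ⟨t * WeakBialg.leftAvg k A, ht.mul_leftAvg, fun x hx => by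
    rw [mul_assoc, WeakBialg.leftAvg_mul_piL hx, WeakBialg.nak_eq, mul_assoc]⟩
  tfae_have 5 → 3 := fun ⟨t, ht, _⟩ => ⟨t, ht⟩
  tfae_have 1 → 6 := WeakBialg.exists_rightInt_of_isSeparableAlg
  tfae_have 6 → 1 := fun ⟨_, ht⟩ => ht.isSeparableAlg
  tfae_have 6 → 7 := fun ⟨_, ht⟩ => ht.exists_isNormalizedRightIntegral
  tfae_have 7 → 6 := fun ⟨_, hθ⟩ => WeakBialg.exists_rightInt_of_isNormalizedRightIntegral hθ
  tfae_have 6 → 8 := fun ⟨t, ht⟩ => ⟨WeakBialg.rightAvg k A * t, ht.rightAvg_mul, fun x hx => by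
    rw [← mul_assoc, WeakBialg.piLbar_mul_rightAvg hx, mul_assoc]⟩
  tfae_have 8 → 6 := fun ⟨t, ht, _⟩ => ⟨t, ht⟩
  tfae_finish
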